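/- Let $M$ be a compact oriented smooth surface with boundary and let $(M,\mathcal E,\langle\cdot,\cdot\rangle,D,\psi)$ be a coherent tangent bundle over $M$: $\mathcal E$ is a smooth orientable rank-$2$ vector bundle with a metric $\langle\cdot,\cdot\rangle$, $D$ is a metric connection, and $\psi:TM\to\mathcal E$ is a smooth bundle homomorphism with $D_X\psi(Y)-D_Y\psi(X)=\psi([X,Y])$ for all smooth vector fields $X,Y$. Fix a co-orientation, i.e. a smooth skew-symmetric bilinear form $\mu$ on $\mathcal E$ with $\mu(e_1,e_2)=\pm1$ for orthonormal $e_1,e_2$. A point $p$ is singular if $\psi_p:T_pM\to\mathcal E_p$ is not bijective; $\Sigma$ is the set of singular points. In local coordinates $(u,v)$ put $\lambda=\mu(\psi(\partial_u),\psi(\partial_v))$. A singular point $p$ is non-degenerate if $d\lambda_p\neq0$. The null direction at $p$ is $\ker\psi_p$. A singular direction at $p$ is $\ker d\lambda_p$ (the tangent line of the singular curve $\{\lambda=0\}$) if $p$ is non-degenerate, and the tangent line at $p$ of a $C^1$-regular arc in $\Sigma$ emanating from $p$ if $p$ is degenerate. An $A_2$-point is a non-degenerate singular point at which the null and singular directions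 are transversal. A peak is a singular point $p$, not an $A_2$-point, with $\operatorname{rank}\psi_p=1$ and a neighbourhood $U$ such that all points of $(\Sigma\cap U)\setminus\{p\}$ are $A_2$-points and $\Sigma\cap U$ consists of $p$ and finitely many $C^1$-regular simple arcs emanating from $p$. Let $M^+$ (resp. $M^-$) be the set of regular points where $\psi^*\mu$ is positive (resp. negative) with respect to the orientation of $M$. Let $p\in\partial M$ be an $A_2$-point or a peak. For a curve $\gamma$ emanating from $p$ let $\Psi_\gamma=\lim_{t\to0+}\psi(\dot\gamma(t))/|\psi(\dot\gamma(t))|\in\mathcal E_p$ be its initial vector. In a neighbourhood $U$ of $p$, a singular sector at $p$ is a domain $\Omega\subset U$ disjoint from $\Sigma\cup\partial M$ whose boundary in $U$ consists of two $C^1$-regular arcs $\sigma,\tau$ emanating from $p$ that meet only at $p$, $\sigma$ lying in $\Sigma$ and $\tau$ lying in $\Sigma$ or in $\partial M$; its interior angle is $\arccos\langle\Psi_\sigma,\Psi_\tau\rangle$, and it is positive (resp. negative) if $\Omega\subset M^+$ (resp. $\Omega\subset M^-$). Let $\alpha_+(p)$ (resp. $\alpha_-(p)$) be the sum of the interior angles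 of the positive (resp. negative) singular sectors at $p$ in an open neighbourhood $U$ of $p$ that $\Sigma\cup\partial M$ cuts into singular sectors at $p$. Theorem. Suppose that there is a singular direction at $p$ and that every singular direction at $p$ is transversal to $\partial M$. 1. If the null direction at $p$ is transversal to $\partial M$, then $\alpha_\pm(p)$ are well defined (there are arbitrarily small neighbourhoods $U$ as above, in each such $U$ there are finitely many sectors, each positive or negative and with existing initial vectors of its bounding arcs, and the sums do not depend on $U$), and $$\alpha_+(p)+\alpha_-(p)=\pi,\qquad \alpha_+(p)-\alpha_-(p)\in\{-\pi,\pi\}.$$ 2. If $p$ is non-degenerate and the null direction at $p$ is tangent to $\partial M$, then $\alpha_\pm(p)$ are well defined in the same sense and $\alpha_+(p)=\alpha_-(p)$. -/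

import Mathlib

open Set Filter Topology Bundle
open scoped Manifold ContDiff

noncomputable section

/-- The model space `ℝ²`, used both for the surface and for the fibres of the bundle. -/
abbrev Plane : Type := EuclideanSpace ℝ (Fin 2)

/-- An orientation of a surface, given by a smooth nowhere vanishing `2`-form `form`: a pair
`(v, w)` of tangent vectors is positively oriented iff `0 < form x v w`.
Only the sign of `form` is used below. -/
structure SurfaceOrientation (M : Type*) [TopologicalSpace M]
    [ChartedSpace (EuclideanHalfSpace 2) M] [IsManifold (𝓡∂ 2) ∞ M] where
  form : ∀ x : M, TangentSpace (𝓡∂ 2) x →L[ℝ] TangentSpace (𝓡∂ 2) x →L[ℝ] ℝ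
  skew : ∀ x v w, form x v w = - form x w v
  nonvanishing : ∀ x, ∃ v w, form x v w ≠ 0
  smooth : ContMDiff (𝓡∂ 2) ((𝓡∂ 2).prod 𝓘(ℝ, Plane →L[ℝ] Plane →L[ℝ] ℝ)) ∞
    (fun x ↦ TotalSpace.mk' (Plane →L[ℝ] Plane →L[ℝ] ℝ)
      (E := fun x : M ↦ TangentSpace (𝓡∂ 2) x →L[ℝ] TangentSpace (𝓡∂ 2) x →L[ℝ] ℝ) x (form x))

/-- A coherent tangent bundle structure on a smooth rank `2` vector bundle `E` with a smooth
fibre metric `inner ℝ` over a surface `M` with boundary, together with a co-orientation `mu`. -/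
structure CoherentTangentBundle (M : Type*) [TopologicalSpace M]
    [ChartedSpace (EuclideanHalfSpace 2) M] [IsManifold (𝓡∂ 2) ∞ M]
    (E : M → Type*) [TopologicalSpace (TotalSpace Plane E)]
    [∀ x, NormedAddCommGroup (E x)] [∀ x, InnerProductSpace ℝ (E x)]
    [FiberBundle Plane E] [VectorBundle ℝ Plane E]
    [ContMDiffVectorBundle ∞ Plane E (𝓡∂ 2)]
    [IsContMDiffRiemannianBundle (𝓡∂ 2) ∞ Plane E] where
  /-- The connection; `D σ x v` is the covariant derivative of `σ` at `x` in the direction `v`. -/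
  D : CovariantDerivative (𝓡∂ 2) Plane E
  smooth_D : CovariantDerivative.ContMDiffCovariantDerivative D ∞
  metric_D : D.IsMetricCompatible
  /-- The bundle homomorphism `TM → E`. -/
  psi : ∀ x : M, TangentSpace (𝓡∂ 2) x →L[ℝ] E x
  smooth_psi : ContMDiff (𝓡∂ 2) ((𝓡∂ 2).prod 𝓘(ℝ, Plane →L[ℝ] Plane)) ∞
    (fun x ↦ TotalSpace.mk' (Plane →L[ℝ] Plane)
      (E := fun x : M ↦ TangentSpace (𝓡∂ 2) x →L[ℝ] E x) x (psi x))
  coherent : ∀ (X Y : ∀ x : M, TangentSpace (𝓡∂ 2) x),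
    ContMDiff (𝓡∂ 2) ((𝓡∂ 2).prod 𝓘(ℝ, Plane)) ∞
      (fun x ↦ TotalSpace.mk' Plane (E := (TangentSpace (𝓡∂ 2) : M → Type)) x (X x)) →
    ContMDiff (𝓡∂ 2) ((𝓡∂ 2).prod 𝓘(ℝ, Plane)) ∞
      (fun x ↦ TotalSpace.mk' Plane (E := (TangentSpace (𝓡∂ 2) : M → Type)) x (Y x)) →
    ∀ x : M, D (fun y ↦ psi y (Y y)) x (X x) - D (fun y ↦ psi y (X y)) x (Y x) =
      psi x (VectorField.mlieBracket (𝓡∂ 2) X Y x)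
  /-- The co-orientation. -/
  mu : ∀ x : M, E x →L[ℝ] E x →L[ℝ] ℝ
  mu_skew : ∀ x v w, mu x v w = - mu x w v
  mu_orthonormal : ∀ (x : M) (e₁ e₂ : E x),
    ‖e₁‖ = 1 → ‖e₂‖ = 1 → inner ℝ e₁ e₂ = 0 → mu x e₁ e₂ = 1 ∨ mu x e₁ e₂ = -1
  smooth_mu : ContMDiff (𝓡∂ 2) ((𝓡∂ 2).prod 𝓘(ℝ, Plane →L[ℝ] Plane →L[ℝ] ℝ)) ∞
    (fun x ↦ TotalSpace.mk' (Plane →L[ℝ] Plane →L[ℝ] ℝ)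
      (E := fun x : M ↦ E x →L[ℝ] E x →L[ℝ] ℝ) x (mu x))

section Curves

variable {M : Type*} [TopologicalSpace M] [ChartedSpace (EuclideanHalfSpace 2) M]

/-- The velocity at `t` of a curve on `[0, 1]`, one-sided at the endpoints. -/
def velocity (γ : ℝ → M) (t : ℝ) : TangentSpace (𝓡∂ 2) (γ t) :=
  mfderivWithin 𝓘(ℝ, ℝ) (𝓡∂ 2) γ (Icc 0 1) t (1 : ℝ)

/-- `γ` restricted to `[0, 1]` is a `C¹`-regular simple arc emanating from `p`. -/
structure IsRegularArc (p : M) (γ : ℝ → M) : Prop where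
  start : γ 0 = p
  contMDiffOn : ContMDiffOn 𝓘(ℝ, ℝ) (𝓡∂ 2) 1 γ (Icc 0 1)
  regular : ∀ t ∈ Icc (0 : ℝ) 1, velocity γ t ≠ 0
  injOn : InjOn γ (Icc 0 1)

/-- The tangent vector `v` at the boundary point `p` is tangent to `∂M`. Tangent vectors at `p`
are read in the preferred chart at `p`, in which `M` is the half-plane `0 ≤ x 0`. -/
def IsTangentToBoundary (p : M) (v : TangentSpace (𝓡∂ 2) p) : Prop :=
  (show Plane from v) 0 = 0

end Curves

namespace CoherentTangentBundle

variable {M : Type*} [TopologicalSpace M]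
    [ChartedSpace (EuclideanHalfSpace 2) M] [IsManifold (𝓡∂ 2) ∞ M]
    {E : M → Type*} [TopologicalSpace (TotalSpace Plane E)]
    [∀ x, NormedAddCommGroup (E x)] [∀ x, InnerProductSpace ℝ (E x)]
    [FiberBundle Plane E] [VectorBundle ℝ Plane E]
    [ContMDiffVectorBundle ∞ Plane E (𝓡∂ 2)]
    [IsContMDiffRiemannianBundle (𝓡∂ 2) ∞ Plane E]
    (C : CoherentTangentBundle M E) (o : SurfaceOrientation M)

/-- The set `Σ` of singular points. -/
def singularSet : Set M := {x | ¬ Function.Bijective (C.psi x)}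

/-- `M⁺`: the regular points where the signed area form `ψ^*μ` is positive on positively
oriented pairs of tangent vectors, i.e. agrees with the unsigned area form. -/
def positivePart : Set M :=
  {x | x ∉ C.singularSet ∧ ∀ v w, 0 < o.form x v w → 0 < C.mu x (C.psi x v) (C.psi x w)}

/-- `M⁻`: the regular points where the signed area form is negative on positively
oriented pairs of tangent vectors, i.e. is minus the unsigned area form. -/
def negativePart : Set M :=
  {x | x ∉ C.singularSet ∧ ∀ v w, 0 < o.form x v w → C.mu x (C.psi x v) (C.psi x w) < 0}

/-- The coordinate vector field `∂/∂xᵢ` of the preferred chart `x` at `p`, at a point `q` of the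
domain of that chart. -/
def coordField (p : M) (i : Fin 2) (q : M) : TangentSpace (𝓡∂ 2) q :=
  (trivializationAt Plane (TangentSpace (𝓡∂ 2)) p).symm q (EuclideanSpace.single i 1)

/-- The signed area density function `λ = μ(ψ(∂/∂x₀), ψ(∂/∂x₁))` of the preferred chart at `p`.
If that chart is negatively oriented this differs by a sign from the density in an oriented
chart, which is immaterial for the vanishing and for the kernel of its differential. -/
def areaDensity (p q : M) : ℝ :=
  C.mu q (C.psi q (coordField p 0 q)) (C.psi q (coordField p 1 q))

/-- The differential of the signed area density function at `p`. -/
def dAreaDensity (p : M) : TangentSpace (𝓡∂ 2) p → ℝ :=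
  fun v ↦ mfderiv (𝓡∂ 2) 𝓘(ℝ, ℝ) (C.areaDensity p) p v

/-- `p` is a non-degenerate singular point. -/
def IsNonDegenerate (p : M) : Prop :=
  p ∈ C.singularSet ∧ ∃ v, C.dAreaDensity p v ≠ 0

/-- `γ` is a `C¹`-regular singular curve emanating from `p`. -/
def IsSingularArc (p : M) (γ : ℝ → M) : Prop :=
  IsRegularArc p γ ∧ γ '' Icc 0 1 ⊆ C.singularSet

/-- `γ` is a `C¹`-regular arc of `∂M` emanating from `p`. -/
def IsBoundaryArc (p : M) (γ : ℝ → M) : Prop :=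
  IsRegularArc p γ ∧ γ '' Icc 0 1 ⊆ (𝓡∂ 2).boundary M

/-- `v` spans a singular direction at `p`. At a non-degenerate point this is the tangent line
of the regular curve `λ = 0`; at a degenerate point it is the tangent line at `p` of any
`C¹`-regular singular curve emanating from `p`. -/
def IsSingularDirection (p : M) (v : TangentSpace (𝓡∂ 2) p) : Prop :=
  v ≠ 0 ∧ ((C.IsNonDegenerate p ∧ C.dAreaDensity p v = 0) ∨
    (¬ C.IsNonDegenerate p ∧
      ∃ γ, C.IsSingularArc p γ ∧ ∃ c : ℝ, (show Plane from v) = c • (show Plane from velocity γ 0)))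

/-- `v` spans the null direction at `p`. -/
def IsNullVector (p : M) (v : TangentSpace (𝓡∂ 2) p) : Prop :=
  v ≠ 0 ∧ C.psi p v = 0

/-- `A₂`-points (intrinsic cuspidal edges): non-degenerate singular points at which the null
direction is transversal to the singular direction. -/
def IsA2 (p : M) : Prop :=
  C.IsNonDegenerate p ∧ ∀ v, C.IsSingularDirection p v → ¬ C.IsNullVector p v

/-- Peaks, possibly degenerate. -/
def IsPeak (p : M) : Prop :=
  p ∈ C.singularSet ∧ ¬ C.IsA2 p ∧
    ∃ U : Set M, IsOpen U ∧ p ∈ U ∧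
      (∀ q ∈ C.singularSet ∩ U, q ≠ p → C.IsA2 q) ∧
      Module.finrank ℝ (LinearMap.range (C.psi p : TangentSpace (𝓡∂ 2) p →ₗ[ℝ] E p)) = 1 ∧
      ∃ (n : ℕ) (γ : Fin n → ℝ → M), (∀ i, IsRegularArc p (γ i)) ∧
        C.singularSet ∩ U = {p} ∪ ⋃ i, γ i '' Ico 0 1

/-- There is a singular direction at the boundary point `p`, and every singular direction at `p`
is transversal to `∂M`. -/
def SingularDirectionTransversal (p : M) : Prop :=
  (∃ v, C.IsSingularDirection p v) ∧ ∀ v, C.IsSingularDirection p v → ¬ IsTangentToBoundary p v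

/-- The null direction at the boundary point `p` is transversal to `∂M`. -/
def NullDirectionTransversal (p : M) : Prop :=
  ∀ v, C.IsNullVector p v → ¬ IsTangentToBoundary p v

/-- The null direction at the boundary point `p` is tangent to `∂M`. -/
def NullDirectionTangent (p : M) : Prop :=
  ∀ v, C.IsNullVector p v → IsTangentToBoundary p v

/-- `Ψ ∈ E_p` is the `E`-initial vector at `p` of the curve `γ` emanating from `p`: the limit, in
the total space of `E`, of `ψ(γ'(t)) / |ψ(γ'(t))|` as `t → 0+`. -/
def IsInitialVector (p : M) (γ : ℝ → M) (Ψ : E p) : Prop :=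
  Tendsto (fun t ↦ TotalSpace.mk' Plane (γ t)
      ((‖C.psi (γ t) (velocity γ t)‖)⁻¹ • C.psi (γ t) (velocity γ t)))
    (𝓝[>] 0) (𝓝 (TotalSpace.mk' Plane p Ψ)) ∧
  ∀ᶠ t in 𝓝[>] (0 : ℝ), C.psi (γ t) (velocity γ t) ≠ 0

/-- `Ω` is a singular sector at the boundary point `p` in the neighbourhood `U` of `p`, bounded
by the curves `σ` and `τ`: a domain in `U`, free of singular points and of boundary points of
`M`, whose boundary consists of `σ`, `τ` and a part of the boundary of `U`, where `σ` is a
singular curve and `τ` is a singular curve or a curve in `∂M`. -/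
structure IsSectorBetween (p : M) (U Ω : Set M) (σ τ : ℝ → M) : Prop where
  subset : Ω ⊆ U
  isOpen : IsOpen Ω
  isConnected : IsConnected Ω
  disjoint_singular : Disjoint Ω C.singularSet
  disjoint_boundary : Disjoint Ω ((𝓡∂ 2).boundary M)
  left : C.IsSingularArc p σ
  right : C.IsSingularArc p τ ∨ IsBoundaryArc p τ
  inter : σ '' Ico 0 1 ∩ τ '' Ico 0 1 = {p}
  frontier_inter : frontier Ω ∩ U = σ '' Ico 0 1 ∪ τ '' Ico 0 1

/-- The set of singular sectors at `p` in `U`. -/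
def sectors (p : M) (U : Set M) : Set (Set M) :=
  {Ω | ∃ σ τ, C.IsSectorBetween p U Ω σ τ}

/-- `U` is an open neighbourhood of the boundary point `p` which `Σ ∪ ∂M` cuts into singular
sectors at `p`. -/
def IsSectorNhd (p : M) (U : Set M) : Prop :=
  IsOpen U ∧ p ∈ U ∧ U \ (C.singularSet ∪ (𝓡∂ 2).boundary M) = ⋃₀ C.sectors p U

/-- `θ` is the interior angle of the sector `Ω`: the angle between the initial vectors of the
two curves bounding `Ω`, whatever the parametrization of these curves. -/
def IsInteriorAngle (p : M) (U Ω : Set M) (θ : ℝ) : Prop :=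
  ∀ σ τ, C.IsSectorBetween p U Ω σ τ →
    ∃ Ψ Φ : E p, C.IsInitialVector p σ Ψ ∧ C.IsInitialVector p τ Φ ∧
      θ = Real.arccos (inner ℝ Ψ Φ)

/-- The sums `α₊(p)` and `α₋(p)` of the interior angles of the positive, respectively negative,
singular sectors at the boundary point `p` are well defined, and equal `a` and `b`: there are
arbitrarily small neighbourhoods of `p` which are cut into singular sectors, and in each of them
the sectors are finitely many, each is positive or negative and has an interior angle, and these
angles add up to `a` over the positive and to `b` over the negative sectors. -/
def HasAngleSums (p : M) (a b : ℝ) : Prop :=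
  (∀ V ∈ 𝓝 p, ∃ U ⊆ V, C.IsSectorNhd p U) ∧
  ∀ U, C.IsSectorNhd p U →
    (C.sectors p U).Finite ∧
    (∀ Ω ∈ C.sectors p U, Ω ⊆ C.positivePart o ∨ Ω ⊆ C.negativePart o) ∧
    ∃ θ : Set M → ℝ, (∀ Ω ∈ C.sectors p U, C.IsInteriorAngle p U Ω (θ Ω)) ∧
      (∑ᶠ Ω ∈ {Ω | Ω ∈ C.sectors p U ∧ Ω ⊆ C.positivePart o}, θ Ω) = a ∧
      (∑ᶠ Ω ∈ {Ω | Ω ∈ C.sectors p U ∧ Ω ⊆ C.negativePart o}, θ Ω) = b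

end CoherentTangentBundle

end

/-!
The whole argument takes place in the preferred chart at `p`, in which the surface is the half-plane
`0 ≤ x` and the boundary is `x = 0`; write `∂₀`, `∂₁` for the coordinate fields, `λ` for the signed
area density in this chart, and `Σ = {λ = 0}` for the singular set.

*The shape of `Σ`.* Every singular curve emanating from `p` is transversal to the boundary, hence is a
`C¹` graph `y = g x` over `x ≥ 0`. Near `p`, the singular set is the union of finitely many such graphs
`g 1 < ⋯ < g m` which meet only at the origin (`CoherentTangentBundle.IsGraphSystem`). If `p` is
non-degenerate, transversality of the singular direction means `∂₁λ ≠ 0`, and the implicit function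
argument, carried out up to the boundary, gives `m = 1`
(`CoherentTangentBundle.exists_isGraphSystem_of_isNonDegenerate`). At a degenerate peak the arcs are
given; since `∂₁λ ≠ 0` along each of them outside `p`, two of them that meet outside `p` coincide
(`CoherentTangentBundle.eqOn_graph`, `CoherentTangentBundle.exists_isGraphSystem_of_isPeak`).

*The angle sums are well defined.* The graphs cut arbitrarily small boxes around `p` into `m + 1`
sectors (`CoherentTangentBundle.IsGraphSystem.isSectorDecomposition`). In any neighbourhood of `p` that
`Σ ∪ ∂M` cuts into sectors, every sector contains exactly one of the sectors of a small box, has the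
same sign, and is bounded by curves which start along the same two arcs. Hence the angle sums can be
computed from the box (`CoherentTangentBundle.hasAngleSums_of_sectorDecomposition`), and they are unique
(`CoherentTangentBundle.HasAngleSums.unique`).

*Null direction transversal to the boundary.* Here `ψ(∂₁) ≠ 0` near `p`, and `ψ(∂₀) = A ψ(∂₁)` on `Σ`
for a smooth function `A`. So `ψ` maps the velocity `∂₀ + g' ∂₁` of a graph to `(g' + A) ψ(∂₁)`, and the
coefficient does not vanish for `x > 0`, because the null and singular directions differ at
`A₂`-points. With the unit vector `e` in the direction of `ψ(∂₁)` at `p`, the lower and the upper half of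
the boundary have the initial vectors `-e` and `e`, and each graph has one of these two. If a lower graph
`g j` had `e` and an upper graph `g k` had `-e`, then `g k' + A < 0 < g j' + A`, and the difference
`f = g k - g j` would satisfy `f' ≤ K f` with `f 0 = 0`, where `K` is a Lipschitz constant of `A`; by
Grönwall's argument `f ≤ 0`, which is absurd
(`CoherentTangentBundle.IsGraphSystem.not_graphSlope_pos_neg`). So the initial vectors change from `-e` to
`e` exactly once: one sector has the angle `π`, and all others have the angle `0`.

*Null direction tangent to the boundary.* Here `p` is non-degenerate and `ψ(∂₁)` vanishes at `p`. The
singular curve has the initial vector given by `ψ(∂₀)`. On the boundary `ψ(∂₁) = y (w + o(1))` with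
`w ≠ 0`, because `|∂₁λ| ≤ |ψ(∂₀)| |w|` at `p`; the field `ψ(∂₁)` thus reverses its direction at `p`, and
both halves of the boundary have the initial vector `w / |w|`. So the two sectors have the same angle,
and their signs are opposite because `λ` changes its sign across `Σ`
(`CoherentTangentBundle.exists_hasAngleSums_of_nullDirectionTangent`).
-/

noncomputable section

/-! ### Neighbourhoods cut into singular sectors -/

section Arcs

variable {M : Type*} [TopologicalSpace M] [ChartedSpace (EuclideanHalfSpace 2) M]

theorem IsRegularArc.continuousOn {p : M} {γ : ℝ → M} (h : IsRegularArc p γ) :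
    ContinuousOn γ (Icc 0 1) := h.contMDiffOn.continuousOn

theorem IsRegularArc.tendsto {p : M} {γ : ℝ → M} (h : IsRegularArc p γ) :
    Tendsto γ (𝓝[>] 0) (𝓝 p) := by
  have h1 : ContinuousWithinAt γ (Icc 0 1) 0 := h.continuousOn 0 (by simp)
  have h2 := h1.tendsto
  rw [h.start] at h2
  refine h2.mono_left ?_
  rw [← nhdsWithin_Ioc_eq_nhdsGT (zero_lt_one' ℝ)]
  exact nhdsWithin_mono _ Ioc_subset_Icc_self

theorem IsRegularArc.ne {p : M} {γ : ℝ → M} (h : IsRegularArc p γ) {t : ℝ} (h0 : 0 < t)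
    (h1 : t ≤ 1) : γ t ≠ p := by
  intro ht
  rw [← h.start] at ht
  have := h.injOn ⟨h0.le, h1⟩ (by simp) ht
  exact h0.ne' this

theorem IsRegularArc.eventually_ne {p : M} {γ : ℝ → M} (h : IsRegularArc p γ) :
    ∀ᶠ t in 𝓝[>] (0 : ℝ), γ t ≠ p := by
  filter_upwards [Ioc_mem_nhdsGT (zero_lt_one' ℝ)] with t ht
  exact h.ne ht.1 ht.2

/-- Near its starting point a simple arc is its germ: the remainder of the arc is compact and
stays away from `p`. -/
theorem IsRegularArc.exists_nhds_inter_subset [T2Space M] {p : M} {γ : ℝ → M}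
    (h : IsRegularArc p γ) {A : Set M} (hp : p ∈ A) (hA : ∀ᶠ t in 𝓝[>] (0 : ℝ), γ t ∈ A) :
    ∃ W ∈ 𝓝 p, γ '' Icc 0 1 ∩ W ⊆ A := by
  obtain ⟨ε, hε, hεA⟩ := mem_nhdsGT_iff_exists_Ioo_subset.1 hA
  have hε' : 0 < ε := hε
  have hcl : IsClosed (γ '' Icc ε 1) :=
    (isCompact_Icc.image_of_continuousOn
      (h.continuousOn.mono (Icc_subset_Icc_left hε'.le))).isClosed
  refine ⟨(γ '' Icc ε 1)ᶜ, hcl.isOpen_compl.mem_nhds ?_, ?_⟩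
  · rintro ⟨t, ht, hγ⟩
    exact h.ne (hε'.trans_le ht.1) ht.2 hγ
  · rintro _ ⟨⟨t, ht, rfl⟩, hW⟩
    rcases ht.1.eq_or_lt with h0 | h0
    · rw [← h0, h.start]; exact hp
    · refine hεA ⟨h0, ?_⟩
      by_contra hlt
      exact hW ⟨t, ⟨not_lt.1 hlt, ht.2⟩, rfl⟩

end Arcs

namespace CoherentTangentBundle

variable {M : Type*} [TopologicalSpace M]
    [ChartedSpace (EuclideanHalfSpace 2) M] [IsManifold (𝓡∂ 2) ∞ M]
    {E : M → Type*} [TopologicalSpace (TotalSpace Plane E)]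
    [∀ x, NormedAddCommGroup (E x)] [∀ x, InnerProductSpace ℝ (E x)]
    [FiberBundle Plane E] [VectorBundle ℝ Plane E]
    [ContMDiffVectorBundle ∞ Plane E (𝓡∂ 2)]
    [IsContMDiffRiemannianBundle (𝓡∂ 2) ∞ Plane E]
    (C : CoherentTangentBundle M E) (o : SurfaceOrientation M)

/-- `Σ ∪ ∂M` cuts the neighbourhood `R` of the boundary point `p` into the sectors
`S 0, …, S m`, in this order. The sector `S k` lies between the arcs `A k` and `A (k + 1)`;
`A 0` and `A (m + 1)` are the two halves of `∂M` and `A 1, …, A m` are singular arcs. Every singular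
or boundary curve emanating from `p` starts along one of the `A k` (the field `germ`). -/
structure IsSectorDecomposition (p : M) (m : ℕ) (R : Set M) (S A : ℕ → Set M) : Prop where
  isOpen : IsOpen R
  mem : p ∈ R
  one_le : 1 ≤ m
  diff_eq : ∀ q, q ∈ R \ (C.singularSet ∪ (𝓡∂ 2).boundary M) ↔ ∃ k ≤ m, q ∈ S k
  sector_isOpen : ∀ k ≤ m, IsOpen (S k)
  sector_isConnected : ∀ k ≤ m, IsConnected (S k)
  frontier_inter : ∀ k ≤ m, frontier (S k) ∩ R = A k ∪ A (k + 1)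
  inter : ∀ j k, j ≤ m + 1 → k ≤ m + 1 → j ≠ k → A j ∩ A k = {p}
  arc : ∀ k ≤ m + 1, ∃ γ : ℝ → M, IsRegularArc p γ ∧ γ '' Ico 0 1 = A k ∧
    (1 ≤ k → k ≤ m → C.IsSingularArc p γ) ∧ (k = 0 ∨ k = m + 1 → IsBoundaryArc p γ)
  germ : ∀ γ, C.IsSingularArc p γ ∨ IsBoundaryArc p γ →
    ∃ k ≤ m + 1, ∀ᶠ t in 𝓝[>] (0 : ℝ), γ t ∈ A k

namespace IsSectorDecomposition

variable {C} {p : M} {m : ℕ} {R : Set M} {S A : ℕ → Set M}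

theorem sector_subset (h : C.IsSectorDecomposition p m R S A) {k : ℕ} (hk : k ≤ m) :
    S k ⊆ R \ (C.singularSet ∪ (𝓡∂ 2).boundary M) :=
  fun q hq ↦ (h.diff_eq q).2 ⟨k, hk, hq⟩

theorem sector_mem (h : C.IsSectorDecomposition p m R S A) {k : ℕ} (hk : k ≤ m) :
    S k ∈ C.sectors p R := by
  have key : ∀ σ τ, C.IsSingularArc p σ → (C.IsSingularArc p τ ∨ IsBoundaryArc p τ) →
      σ '' Ico 0 1 ∩ τ '' Ico 0 1 = {p} → frontier (S k) ∩ R = σ '' Ico 0 1 ∪ τ '' Ico 0 1 →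
      S k ∈ C.sectors p R := fun σ τ h1 h2 h3 h4 ↦ ⟨σ, τ,
    { subset := (h.sector_subset hk).trans sdiff_subset
      isOpen := h.sector_isOpen k hk
      isConnected := h.sector_isConnected k hk
      disjoint_singular := disjoint_left.2 fun q hq hs ↦ (h.sector_subset hk hq).2 (Or.inl hs)
      disjoint_boundary := disjoint_left.2 fun q hq hs ↦ (h.sector_subset hk hq).2 (Or.inr hs)
      left := h1
      right := h2
      inter := h3
      frontier_inter := h4 }⟩
  obtain ⟨γ, h1, h2, h3, h4⟩ := h.arc k (by omega)
  obtain ⟨γ', h1', h2', h3', h4'⟩ := h.arc (k + 1) (by omega)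
  have hi := h.inter k (k + 1) (by omega) (by omega) (by omega)
  have hf := h.frontier_inter k hk
  rw [← h2, ← h2'] at hi hf
  have hm := h.one_le
  rcases Nat.eq_zero_or_pos k with hk0 | hk0
  · rw [inter_comm] at hi
    rw [union_comm] at hf
    exact key γ' γ (h3' (by omega) (by omega)) (Or.inr (h4 (Or.inl hk0))) hi hf
  · refine key γ γ' (h3 hk0 hk) ?_ hi hf
    rcases hk.eq_or_lt with hkm | hkm
    · exact Or.inr (h4' (Or.inr (by omega)))
    · exact Or.inl (h3' (by omega) (by omega))

theorem isSectorNhd (h : C.IsSectorDecomposition p m R S A) : C.IsSectorNhd p R := by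
  refine ⟨h.isOpen, h.mem, Subset.antisymm ?_ ?_⟩
  · intro q hq
    obtain ⟨k, hk, hqk⟩ := (h.diff_eq q).1 hq
    exact ⟨S k, h.sector_mem hk, hqk⟩
  · rintro q ⟨Ω, ⟨σ, τ, hΩ⟩, hq⟩
    refine ⟨hΩ.subset hq, ?_⟩
    rintro (hs | hs)
    · exact disjoint_left.1 hΩ.disjoint_singular hq hs
    · exact disjoint_left.1 hΩ.disjoint_boundary hq hs

variable {U Ω : Set M} {σ τ : ℝ → M}

/-- A connected set which avoids `Σ ∪ ∂M` and meets a sector is contained in it. -/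
theorem _root_.CoherentTangentBundle.IsSectorBetween.subset_of_isPreconnected
    (hΩ : C.IsSectorBetween p U Ω σ τ) {T : Set M} (hT : IsPreconnected T)
    (hTU : T ⊆ U \ (C.singularSet ∪ (𝓡∂ 2).boundary M)) (hne : (T ∩ Ω).Nonempty) : T ⊆ Ω := by
  by_contra hcon
  obtain ⟨x, hx, hxΩ⟩ := not_subset.1 hcon
  have : (T ∩ frontier Ω).Nonempty := by
    by_contra hemp
    refine hxΩ (IsPreconnected.subset_left_of_subset_union hΩ.isOpen isClosed_closure.isOpen_compl
      (disjoint_left.2 fun y hy hy' ↦ hy' (subset_closure hy)) (fun y hy ↦ ?_) hne hT hx)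
    by_cases hyc : y ∈ closure Ω
    · left
      by_contra hyΩ
      exact hemp ⟨y, hy, hyc, by rwa [hΩ.isOpen.interior_eq]⟩
    · exact Or.inr hyc
  obtain ⟨y, hyT, hyf⟩ := this
  have hy : y ∈ frontier Ω ∩ U := ⟨hyf, (hTU hyT).1⟩
  rw [hΩ.frontier_inter] at hy
  refine (hTU hyT).2 ?_
  rcases hy with hy | hy
  · exact Or.inl (hΩ.left.2 (image_mono Ico_subset_Icc_self hy))
  · rcases hΩ.right with h | h
    · exact Or.inl (h.2 (image_mono Ico_subset_Icc_self hy))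
    · exact Or.inr (h.2 (image_mono Ico_subset_Icc_self hy))

/-- Since `p` lies on the boundary of every sector `Ω`, some `S k` meets `Ω`, and hence lies in it. -/
theorem exists_subset_of_isSectorBetween (h : C.IsSectorDecomposition p m R S A)
    (hRU : R ⊆ U) (hΩ : C.IsSectorBetween p U Ω σ τ) : ∃ k ≤ m, S k ⊆ Ω := by
  have hp : p ∈ frontier Ω ∩ U := by
    rw [hΩ.frontier_inter]
    exact Or.inl ⟨0, by simp, hΩ.left.1.start⟩
  obtain ⟨x, hxR, hxΩ⟩ := mem_closure_iff.1 hp.1.1 R h.isOpen h.mem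
  have hx : x ∈ R \ (C.singularSet ∪ (𝓡∂ 2).boundary M) := by
    refine ⟨hxR, ?_⟩
    rintro (hs | hs)
    · exact disjoint_left.1 hΩ.disjoint_singular hxΩ hs
    · exact disjoint_left.1 hΩ.disjoint_boundary hxΩ hs
  obtain ⟨k, hk, hxk⟩ := (h.diff_eq x).1 hx
  refine ⟨k, hk, hΩ.subset_of_isPreconnected (h.sector_isConnected k hk).isPreconnected ?_
    ⟨x, hxk, hxΩ⟩⟩
  exact (h.sector_subset hk).trans (sdiff_subset_sdiff_left hRU)

/-- The two arcs bounding a sector `Ω` in any neighbourhood start along the two arcs bounding the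
sector `S k` contained in `Ω`: the latter are contained in `∂Ω`, and near `p` each of the former
is a single arc of the decomposition. -/
theorem germs_of_subset [T2Space M] (h : C.IsSectorDecomposition p m R S A)
    (hRU : R ⊆ U) (hΩ : C.IsSectorBetween p U Ω σ τ) {k : ℕ} (hk : k ≤ m) (hkΩ : S k ⊆ Ω) :
    ((∀ᶠ t in 𝓝[>] (0 : ℝ), σ t ∈ A k) ∧ ∀ᶠ t in 𝓝[>] (0 : ℝ), τ t ∈ A (k + 1)) ∨
    ((∀ᶠ t in 𝓝[>] (0 : ℝ), σ t ∈ A (k + 1)) ∧ ∀ᶠ t in 𝓝[>] (0 : ℝ), τ t ∈ A k) := by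
  have hpA : ∀ j ≤ m + 1, p ∈ A j := fun j hj ↦ by
    obtain ⟨γ, h1, h2, -⟩ := h.arc j hj
    rw [← h2]; exact ⟨0, by simp, h1.start⟩
  have hτ : IsRegularArc p τ := hΩ.right.elim And.left And.left
  obtain ⟨i, hi, hσi⟩ := h.germ σ (Or.inl hΩ.left)
  obtain ⟨j, hj, hτj⟩ := h.germ τ hΩ.right
  obtain ⟨W₁, hW₁, hσW⟩ := hΩ.left.1.exists_nhds_inter_subset (hpA i hi) hσi
  obtain ⟨W₂, hW₂, hτW⟩ := hτ.exists_nhds_inter_subset (hpA j hj) hτj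
  have key : ∀ l, l ≤ m + 1 → A l ⊆ frontier (S k) ∩ R → l = i ∨ l = j := by
    intro l hl hlA
    obtain ⟨γ, h1, h2, -⟩ := h.arc l hl
    have hev : ∀ᶠ t in 𝓝[>] (0 : ℝ), t ∈ Ioo (0 : ℝ) 1 ∧ γ t ∈ W₁ ∩ W₂ := by
      filter_upwards [Ioo_mem_nhdsGT (zero_lt_one' ℝ), h1.tendsto (inter_mem hW₁ hW₂)]
        with t ht1 ht2 using ⟨ht1, ht2⟩
    obtain ⟨t, ht, htW⟩ := hev.exists
    have htA : γ t ∈ A l := by rw [← h2]; exact ⟨t, ⟨ht.1.le, ht.2⟩, rfl⟩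
    have htne : γ t ≠ p := h1.ne ht.1 ht.2.le
    have htf := hlA htA
    have hfr : γ t ∈ frontier Ω ∩ U := by
      refine ⟨⟨closure_mono hkΩ htf.1.1, ?_⟩, hRU htf.2⟩
      rw [hΩ.isOpen.interior_eq]
      intro htΩ
      have : γ t ∈ R \ (C.singularSet ∪ (𝓡∂ 2).boundary M) := by
        refine ⟨htf.2, ?_⟩
        rintro (hs | hs)
        · exact disjoint_left.1 hΩ.disjoint_singular htΩ hs
        · exact disjoint_left.1 hΩ.disjoint_boundary htΩ hs
      obtain ⟨n, hn, htn⟩ := (h.diff_eq _).1 this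
      -- the point lies on a bounding arc, hence in `Σ ∪ ∂M`
      obtain ⟨γ', h1', h2', h3', h4'⟩ := h.arc l hl
      rw [← h2'] at htA
      have hmem := image_mono Ico_subset_Icc_self htA
      rcases Nat.eq_zero_or_pos l with h0 | h0
      · exact this.2 (Or.inr ((h4' (Or.inl h0)).2 hmem))
      · rcases hl.eq_or_lt with h0' | h0'
        · exact this.2 (Or.inr ((h4' (Or.inr h0')).2 hmem))
        · exact this.2 (Or.inl ((h3' h0 (by omega)).2 hmem))
    rw [hΩ.frontier_inter] at hfr
    rcases hfr with hfr | hfr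
    · left
      by_contra hne
      have : γ t ∈ A l ∩ A i := ⟨htA, hσW ⟨image_mono Ico_subset_Icc_self hfr, htW.1⟩⟩
      rw [h.inter l i hl hi hne] at this
      exact htne this
    · right
      by_contra hne
      have : γ t ∈ A l ∩ A j := ⟨htA, hτW ⟨image_mono Ico_subset_Icc_self hfr, htW.2⟩⟩
      rw [h.inter l j hl hj hne] at this
      exact htne this
  have hf := h.frontier_inter k hk
  have k1 := key k (by omega) (hf ▸ subset_union_left)
  have k2 := key (k + 1) (by omega) (hf ▸ subset_union_right)
  rcases k1 with rfl | rfl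
  · rcases k2 with hk2 | rfl
    · omega
    · exact Or.inl ⟨hσi, hτj⟩
  · rcases k2 with rfl | hk2
    · exact Or.inr ⟨hσi, hτj⟩
    · omega

/-- A sector in a larger neighbourhood contains only one of the `S k`, because its bounding arcs start
along those of `S k`. -/
theorem eq_of_subset [T2Space M] (h : C.IsSectorDecomposition p m R S A)
    (hRU : R ⊆ U) (hΩ : C.IsSectorBetween p U Ω σ τ) {j k : ℕ} (hj : j ≤ m) (hk : k ≤ m)
    (hjΩ : S j ⊆ Ω) (hkΩ : S k ⊆ Ω) : j = k := by
  have uniq : ∀ γ : ℝ → M, IsRegularArc p γ → ∀ a b, a ≤ m + 1 → b ≤ m + 1 →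
      (∀ᶠ t in 𝓝[>] (0 : ℝ), γ t ∈ A a) → (∀ᶠ t in 𝓝[>] (0 : ℝ), γ t ∈ A b) → a = b := by
    intro γ hγ a b ha hb h1 h2
    obtain ⟨t, ht1, ht2, ht3⟩ := (h1.and (h2.and hγ.eventually_ne)).exists
    by_contra hne
    have : γ t ∈ A a ∩ A b := ⟨ht1, ht2⟩
    rw [h.inter a b ha hb hne] at this
    exact ht3 this
  have hτ : IsRegularArc p τ := hΩ.right.elim And.left And.left
  have u1 := uniq σ hΩ.left.1
  have u2 := uniq τ hτ
  rcases h.germs_of_subset hRU hΩ hj hjΩ with ⟨a1, a2⟩ | ⟨a1, a2⟩ <;>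
  rcases h.germs_of_subset hRU hΩ hk hkΩ with ⟨b1, b2⟩ | ⟨b1, b2⟩
  · exact u1 j k (by omega) (by omega) a1 b1
  · have e1 := u1 j (k + 1) (by omega) (by omega) a1 b1
    have e2 := u2 (j + 1) k (by omega) (by omega) a2 b2
    omega
  · have e1 := u1 (j + 1) k (by omega) (by omega) a1 b1
    have e2 := u2 j (k + 1) (by omega) (by omega) a2 b2
    omega
  · exact u2 j k (by omega) (by omega) a2 b2

end IsSectorDecomposition

open Classical in
/-- The angle sums, from arbitrarily small sector decompositions and the initial vectors `Ψ k` of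
their arcs. Every neighbourhood cut into sectors has exactly one sector around each `S k`, with the
same sign and the same pair of initial vectors. -/
theorem hasAngleSums_of_sectorDecomposition [T2Space M] {p : M} {m : ℕ} {R : Set M}
    {S A : ℕ → Set M} (h : C.IsSectorDecomposition p m R S A)
    (hsmall : ∀ V ∈ 𝓝 p, ∃ R' ⊆ V, ∃ S' A' : ℕ → Set M,
      C.IsSectorDecomposition p m R' S' A' ∧ (∀ k ≤ m, S' k ⊆ S k) ∧ ∀ k ≤ m + 1, A' k ⊆ A k)
    (hsign : ∀ T : Set M, IsPreconnected T → Disjoint T C.singularSet →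
      T ⊆ C.positivePart o ∨ T ⊆ C.negativePart o)
    (hdisj : Disjoint (C.positivePart o) (C.negativePart o))
    (Ψ : ℕ → E p)
    (hΨ : ∀ k ≤ m + 1, ∀ γ, C.IsSingularArc p γ ∨ IsBoundaryArc p γ →
      (∀ᶠ t in 𝓝[>] (0 : ℝ), γ t ∈ A k) → C.IsInitialVector p γ (Ψ k)) :
    C.HasAngleSums o p
      (∑ k ∈ Finset.range (m + 1), if S k ⊆ C.positivePart o then
        Real.arccos (inner ℝ (Ψ k) (Ψ (k + 1))) else 0)
      (∑ k ∈ Finset.range (m + 1), if S k ⊆ C.negativePart o then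
        Real.arccos (inner ℝ (Ψ k) (Ψ (k + 1))) else 0) := by
  refine ⟨fun V hV ↦ ?_, fun U hU ↦ ?_⟩
  · obtain ⟨R', hR', S', A', h', -, -⟩ := hsmall V hV
    exact ⟨R', hR', h'.isSectorNhd⟩
  obtain ⟨R', hR', S', A', h', hS, hA⟩ := hsmall U (hU.1.mem_nhds hU.2.1)
  -- the sector of `U` around each `S' k`
  have hex : ∀ k, ∃ Ω, k ≤ m → Ω ∈ C.sectors p U ∧ S' k ⊆ Ω := by
    intro k
    by_cases hk : k ≤ m
    · obtain ⟨x, hx⟩ := (h'.sector_isConnected k hk).nonempty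
      have hsub := (h'.sector_subset hk).trans (sdiff_subset_sdiff_left hR')
      have hxU := hsub hx
      rw [hU.2.2] at hxU
      obtain ⟨Ω, hΩ, hxΩ⟩ := hxU
      obtain ⟨σ, τ, hστ⟩ := hΩ
      exact ⟨Ω, fun _ ↦ ⟨⟨σ, τ, hστ⟩, hστ.subset_of_isPreconnected
        (h'.sector_isConnected k hk).isPreconnected hsub ⟨x, hx, hxΩ⟩⟩⟩
    · exact ⟨∅, fun hk' ↦ absurd hk' hk⟩
  choose W hW using hex
  have hWinj : ∀ j ≤ m, ∀ k ≤ m, W j = W k → j = k := by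
    intro j hj k hk hjk
    obtain ⟨⟨σ, τ, hστ⟩, hsub⟩ := hW j hj
    exact h'.eq_of_subset hR' hστ hj hk hsub (hjk ▸ (hW k hk).2)
  have hWsurj : ∀ Ω ∈ C.sectors p U, ∃ k ≤ m, W k = Ω := by
    rintro Ω ⟨σ, τ, hστ⟩
    obtain ⟨k, hk, hkΩ⟩ := h'.exists_subset_of_isSectorBetween hR' hστ
    refine ⟨k, hk, ?_⟩
    obtain ⟨⟨σ', τ', hστ'⟩, hsub⟩ := hW k hk
    obtain ⟨x, hx⟩ := (h'.sector_isConnected k hk).nonempty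
    have a1 := hστ.subset_of_isPreconnected (T := W k) hστ'.isConnected.isPreconnected
      (by rw [hU.2.2]; exact subset_sUnion_of_mem (hW k hk).1) ⟨x, hsub hx, hkΩ hx⟩
    have a2 := hστ'.subset_of_isPreconnected (T := Ω) hστ.isConnected.isPreconnected
      (by rw [hU.2.2]; exact subset_sUnion_of_mem ⟨σ, τ, hστ⟩) ⟨x, hkΩ hx, hsub hx⟩
    exact Subset.antisymm a1 a2
  have hsec : C.sectors p U = W '' (Finset.range (m + 1) : Set ℕ) := by
    ext Ω
    constructor
    · intro hΩ
      obtain ⟨k, hk, rfl⟩ := hWsurj Ω hΩ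
      exact ⟨k, by simp; omega, rfl⟩
    · rintro ⟨k, hk, rfl⟩
      exact (hW k (by simp at hk; omega)).1
  have hpm : ∀ Ω ∈ C.sectors p U, Ω ⊆ C.positivePart o ∨ Ω ⊆ C.negativePart o := by
    rintro Ω ⟨σ, τ, hστ⟩
    exact hsign Ω hστ.isConnected.isPreconnected hστ.disjoint_singular
  have hSpm : ∀ k ≤ m, S k ⊆ C.positivePart o ∨ S k ⊆ C.negativePart o := by
    intro k hk
    exact hsign _ (h.sector_isConnected k hk).isPreconnected
      (disjoint_left.2 fun q hq hs ↦ (h.sector_subset hk hq).2 (Or.inl hs))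
  have hiff : ∀ k ≤ m, (W k ⊆ C.positivePart o ↔ S k ⊆ C.positivePart o) ∧
      (W k ⊆ C.negativePart o ↔ S k ⊆ C.negativePart o) := by
    intro k hk
    obtain ⟨x, hx⟩ := (h'.sector_isConnected k hk).nonempty
    have hxW := (hW k hk).2 hx
    have hxS := hS k hk hx
    have hd : x ∈ C.positivePart o → x ∉ C.negativePart o := fun hx ↦ disjoint_left.1 hdisj hx
    rcases hpm _ (hW k hk).1 with h1 | h1 <;> rcases hSpm k hk with h2 | h2
    · exact ⟨by tauto, ⟨fun h3 ↦ absurd (h3 hxW) (hd (h1 hxW)),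
        fun h3 ↦ absurd (h3 hxS) (hd (h2 hxS))⟩⟩
    · exact absurd (h2 hxS) (hd (h1 hxW))
    · exact absurd (h1 hxW) (hd (h2 hxS))
    · exact ⟨⟨fun h3 ↦ absurd (h1 hxW) (hd (h3 hxW)),
        fun h3 ↦ absurd (h2 hxS) (hd (h3 hxS))⟩, by tauto⟩
  have hfin : (C.sectors p U).Finite := by
    rw [hsec]; exact (Finset.finite_toSet _).image _
  have hkey : ∀ (P : Set M) (θ : Set M → ℝ) (f : ℕ → ℝ), (∀ k ≤ m, θ (W k) = f k) →
      (∀ k ≤ m, (W k ⊆ P ↔ S k ⊆ P)) →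
      (∑ᶠ Ω ∈ {Ω | Ω ∈ C.sectors p U ∧ Ω ⊆ P}, θ Ω) =
        ∑ k ∈ Finset.range (m + 1), if S k ⊆ P then f k else 0 := by
    intro P θ f hf hP
    have hset : {Ω | Ω ∈ C.sectors p U ∧ Ω ⊆ P} =
        W '' (((Finset.range (m + 1)).filter fun k ↦ S k ⊆ P : Finset ℕ) : Set ℕ) := by
      ext Ω
      constructor
      · rintro ⟨hΩ, hΩP⟩
        obtain ⟨k, hk, rfl⟩ := hWsurj Ω hΩ
        exact ⟨k, by simp only [Finset.coe_filter, Finset.mem_range, mem_ofPred_eq]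
                     exact ⟨by omega, (hP k hk).1 hΩP⟩, rfl⟩
      · rintro ⟨k, hk, rfl⟩
        simp only [Finset.coe_filter, Finset.mem_range, mem_ofPred_eq] at hk
        exact ⟨(hW k (by omega)).1, (hP k (by omega)).2 hk.2⟩
    rw [hset, finsum_mem_image, finsum_mem_coe_finset, Finset.sum_filter]
    · refine Finset.sum_congr rfl fun k hk ↦ ?_
      rw [hf k (by simp at hk; omega)]
    · intro a ha b hb hab
      simp only [Finset.coe_filter, Finset.mem_range, mem_ofPred_eq] at ha hb
      exact hWinj a (by omega) b (by omega) hab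
  -- the angle of the sector around `S' k`
  have hex' : ∀ Ω, ∃ x : ℝ, ∀ k ≤ m, W k = Ω → x = Real.arccos (inner ℝ (Ψ k) (Ψ (k + 1))) := by
    intro Ω
    by_cases hk : ∃ k ≤ m, W k = Ω
    · obtain ⟨k, hk, rfl⟩ := hk
      refine ⟨Real.arccos (inner ℝ (Ψ k) (Ψ (k + 1))), fun j hj hjk ↦ ?_⟩
      rw [hWinj j hj k hk hjk]
    · exact ⟨0, fun k hk' hkΩ ↦ absurd ⟨k, hk', hkΩ⟩ hk⟩
  choose θ hθ using hex'
  refine ⟨hfin, hpm, θ, ?_, hkey _ _ _ (fun k hk ↦ hθ _ k hk rfl) (fun k hk ↦ (hiff k hk).1),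
    hkey _ _ _ (fun k hk ↦ hθ _ k hk rfl) (fun k hk ↦ (hiff k hk).2)⟩
  intro Ω hΩ σ τ hστ
  obtain ⟨k, hk, rfl⟩ := hWsurj Ω hΩ
  have hmono : ∀ γ : ℝ → M, ∀ j ≤ m + 1, (∀ᶠ t in 𝓝[>] (0 : ℝ), γ t ∈ A' j) →
      ∀ᶠ t in 𝓝[>] (0 : ℝ), γ t ∈ A j := fun γ j hj hγ ↦ hγ.mono fun t ht ↦ hA j hj ht
  rcases h'.germs_of_subset hR' hστ hk (hW k hk).2 with ⟨a1, a2⟩ | ⟨a1, a2⟩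
  · exact ⟨Ψ k, Ψ (k + 1),
      hΨ _ (by omega) _ (Or.inl hστ.left) (hmono _ _ (by omega) a1),
      hΨ _ (by omega) _ hστ.right (hmono _ _ (by omega) a2), hθ _ k hk rfl⟩
  · refine ⟨Ψ (k + 1), Ψ k,
      hΨ _ (by omega) _ (Or.inl hστ.left) (hmono _ _ (by omega) a1),
      hΨ _ (by omega) _ hστ.right (hmono _ _ (by omega) a2), ?_⟩
    rw [real_inner_comm]
    exact hθ _ k hk rfl

theorem IsInitialVector.unique {p : M} {γ : ℝ → M} {Ψ Φ : E p} (h : C.IsInitialVector p γ Ψ)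
    (h' : C.IsInitialVector p γ Φ) : Ψ = Φ := by
  have hp := FiberBundle.mem_baseSet_trivializationAt' (F := Plane) (E := E) p
  have hs : ∀ v : E p, TotalSpace.mk' Plane p v ∈ (trivializationAt Plane E p).source := fun v ↦
    (trivializationAt Plane E p).mem_source.2 hp
  have h1 := (((trivializationAt Plane E p).tendsto_nhds_iff (hs Ψ)).1 h.1).2
  have h2 := (((trivializationAt Plane E p).tendsto_nhds_iff (hs Φ)).1 h'.1).2
  have h3 := tendsto_nhds_unique h1 h2
  have h4 : (trivializationAt Plane E p).linearEquivAt ℝ p hp Ψ =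
      (trivializationAt Plane E p).linearEquivAt ℝ p hp Φ := h3
  exact (LinearEquiv.injective _) h4

theorem HasAngleSums.unique {p : M} {a b a' b' : ℝ} (h : C.HasAngleSums o p a b)
    (h' : C.HasAngleSums o p a' b') : a = a' ∧ b = b' := by
  obtain ⟨U, -, hU⟩ := h.1 univ univ_mem
  obtain ⟨-, -, θ, h1, rfl, rfl⟩ := h.2 U hU
  obtain ⟨-, -, θ', h1', rfl, rfl⟩ := h'.2 U hU
  have hθ : ∀ Ω ∈ C.sectors p U, θ Ω = θ' Ω := by
    rintro Ω ⟨σ, τ, hστ⟩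
    obtain ⟨Ψ, Φ, a1, a2, a3⟩ := h1 Ω ⟨σ, τ, hστ⟩ σ τ hστ
    obtain ⟨Ψ', Φ', b1, b2, b3⟩ := h1' Ω ⟨σ, τ, hστ⟩ σ τ hστ
    rw [a3, b3, IsInitialVector.unique C a1 b1, IsInitialVector.unique C a2 b2]
  exact ⟨finsum_mem_congr rfl fun Ω hΩ ↦ hθ Ω hΩ.1, finsum_mem_congr rfl fun Ω hΩ ↦ hθ Ω hΩ.1⟩

end CoherentTangentBundle

/-! ### Coordinates at a boundary point -/

section Coordinates

variable {M : Type*} [TopologicalSpace M] [ChartedSpace (EuclideanHalfSpace 2) M]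

/-- The first coordinate of `q` in the preferred chart at `p`. -/
def chartFst (p q : M) : ℝ := (extChartAt (𝓡∂ 2) p q) 0

/-- The second coordinate of `q` in the preferred chart at `p`, normalized to vanish at `p`. -/
def chartSnd (p q : M) : ℝ := (extChartAt (𝓡∂ 2) p q) 1 - (extChartAt (𝓡∂ 2) p p) 1

/-- The point with coordinates `chartFst p = x` and `chartSnd p = y`. -/
def chartPoint (p : M) (x y : ℝ) : M :=
  (extChartAt (𝓡∂ 2) p).symm !₂[x, (extChartAt (𝓡∂ 2) p p) 1 + y]

/-- All `(x, y)` with `0 ≤ x ≤ r` and `|y| ≤ r` are coordinates of a point. -/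
def IsChartRadius (p : M) (r : ℝ) : Prop :=
  0 < r ∧ ∀ x y, 0 ≤ x → x ≤ r → |y| ≤ r →
    !₂[x, (extChartAt (𝓡∂ 2) p p) 1 + y] ∈ (extChartAt (𝓡∂ 2) p).target

/-- The points with coordinates in `[0, δ) × (-η, η)`. -/
def chartBox (p : M) (δ η : ℝ) : Set M :=
  {q | q ∈ (chartAt (EuclideanHalfSpace 2) p).source ∧ chartFst p q < δ ∧ |chartSnd p q| < η}

variable {p q : M} {r δ η x y : ℝ}

theorem chartFst_self (hp : p ∈ (𝓡∂ 2).boundary M) : chartFst p p = 0 := by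
  have h : extChartAt (𝓡∂ 2) p p ∈ frontier (range (𝓡∂ 2)) := hp
  rw [frontier_range_modelWithCornersEuclideanHalfSpace] at h
  exact h.symm

theorem chartSnd_self : chartSnd p p = 0 := sub_self _

theorem chartFst_nonneg (hq : q ∈ (chartAt (EuclideanHalfSpace 2) p).source) :
    0 ≤ chartFst p q := by
  have h : extChartAt (𝓡∂ 2) p q ∈ (extChartAt (𝓡∂ 2) p).target :=
    (extChartAt (𝓡∂ 2) p).map_source (by rwa [extChartAt_source])
  have h' := extChartAt_target_subset_range p h
  rw [range_modelWithCornersEuclideanHalfSpace] at h'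
  exact h'

theorem plane_eta (z : Plane) : !₂[z 0, z 1] = z := by
  ext i; fin_cases i <;> rfl

theorem chartPoint_chartFst_chartSnd (hq : q ∈ (chartAt (EuclideanHalfSpace 2) p).source) :
    chartPoint p (chartFst p q) (chartSnd p q) = q := by
  unfold chartPoint chartFst chartSnd
  rw [add_sub_cancel, plane_eta]
  exact (extChartAt (𝓡∂ 2) p).left_inv (by rwa [extChartAt_source])

theorem chartPoint_zero (hp : p ∈ (𝓡∂ 2).boundary M) : chartPoint p 0 0 = p := by
  have := chartPoint_chartFst_chartSnd (mem_chart_source (EuclideanHalfSpace 2) p)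
  rwa [chartFst_self hp, chartSnd_self] at this

theorem continuousOn_extChart (p : M) :
    ContinuousOn (extChartAt (𝓡∂ 2) p) (chartAt (EuclideanHalfSpace 2) p).source := by
  have := continuousOn_extChartAt (I := 𝓡∂ 2) p
  rwa [extChartAt_source] at this

theorem continuousOn_chartFst (p : M) :
    ContinuousOn (chartFst p) (chartAt (EuclideanHalfSpace 2) p).source :=
  (EuclideanSpace.proj (𝕜 := ℝ) (0 : Fin 2)).continuous.comp_continuousOn (continuousOn_extChart p)

theorem continuousOn_chartSnd (p : M) :
    ContinuousOn (chartSnd p) (chartAt (EuclideanHalfSpace 2) p).source :=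
  ((EuclideanSpace.proj (𝕜 := ℝ) (1 : Fin 2)).continuous.comp_continuousOn
    (continuousOn_extChart p)).sub continuousOn_const

namespace IsChartRadius

theorem mem_source (h : IsChartRadius p r) (h1 : 0 ≤ x) (h2 : x ≤ r) (h3 : |y| ≤ r) :
    chartPoint p x y ∈ (chartAt (EuclideanHalfSpace 2) p).source := by
  have := (extChartAt (𝓡∂ 2) p).map_target (h.2 x y h1 h2 h3)
  rwa [extChartAt_source] at this

theorem extChartAt_chartPoint (h : IsChartRadius p r) (h1 : 0 ≤ x) (h2 : x ≤ r) (h3 : |y| ≤ r) :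
    extChartAt (𝓡∂ 2) p (chartPoint p x y) = !₂[x, (extChartAt (𝓡∂ 2) p p) 1 + y] :=
  (extChartAt (𝓡∂ 2) p).right_inv (h.2 x y h1 h2 h3)

theorem chartFst_chartPoint (h : IsChartRadius p r) (h1 : 0 ≤ x) (h2 : x ≤ r) (h3 : |y| ≤ r) :
    chartFst p (chartPoint p x y) = x := by
  unfold chartFst
  rw [h.extChartAt_chartPoint h1 h2 h3]; rfl

theorem chartSnd_chartPoint (h : IsChartRadius p r) (h1 : 0 ≤ x) (h2 : x ≤ r) (h3 : |y| ≤ r) :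
    chartSnd p (chartPoint p x y) = y := by
  unfold chartSnd
  rw [h.extChartAt_chartPoint h1 h2 h3]
  exact add_sub_cancel_left _ _

end IsChartRadius

theorem continuous_planeMk (b : ℝ) : Continuous fun z : ℝ × ℝ ↦ (!₂[z.1, b + z.2] : Plane) := by
  refine (PiLp.continuous_toLp 2 _).comp (continuous_pi fun i ↦ ?_)
  fin_cases i
  · exact continuous_fst
  · exact continuous_const.add continuous_snd

theorem continuousOn_chartPoint (h : IsChartRadius p r) :
    ContinuousOn (fun z : ℝ × ℝ ↦ chartPoint p z.1 z.2) (Icc 0 r ×ˢ Icc (-r) r) :=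
  (continuousOn_extChartAt_symm p).comp (continuous_planeMk _).continuousOn
    fun _ hz ↦ h.2 _ _ hz.1.1 hz.1.2 (abs_le.2 hz.2)

/-- Half-squares around the origin correspond to arbitrarily small neighbourhoods of `p`. -/
theorem exists_isChartRadius (hp : p ∈ (𝓡∂ 2).boundary M) {V : Set M} (hV : V ∈ 𝓝 p) :
    ∃ r, IsChartRadius p r ∧ ∀ x y, 0 ≤ x → x ≤ r → |y| ≤ r → chartPoint p x y ∈ V := by
  have h1 := extChartAt_target_mem_nhdsWithin (I := 𝓡∂ 2) p
  have h2 : (extChartAt (𝓡∂ 2) p).symm ⁻¹' V ∈ 𝓝[range (𝓡∂ 2)] (extChartAt (𝓡∂ 2) p p) := by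
    have h3 := (continuousOn_extChartAt_symm (I := 𝓡∂ 2) p) _ (mem_extChartAt_target p)
    have h4 := h3.tendsto
    rw [nhdsWithin_extChartAt_target_eq, extChartAt_to_inv] at h4
    exact h4 hV
  have h5 := inter_mem h1 h2
  have h6 : extChartAt (𝓡∂ 2) p p = !₂[(0 : ℝ), (extChartAt (𝓡∂ 2) p p) 1 + 0] := by
    have := plane_eta (extChartAt (𝓡∂ 2) p p)
    rw [add_zero]
    conv_lhs => rw [← this]
    have h0 : (extChartAt (𝓡∂ 2) p p) 0 = 0 := chartFst_self hp
    rw [h0]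
  have h7 : Tendsto (fun z : ℝ × ℝ ↦ (!₂[z.1, (extChartAt (𝓡∂ 2) p p) 1 + z.2] : Plane))
      (𝓝[{z | 0 ≤ z.1}] (0, 0)) (𝓝[range (𝓡∂ 2)] (extChartAt (𝓡∂ 2) p p)) := by
    refine tendsto_nhdsWithin_iff.2 ⟨?_, ?_⟩
    · have := (continuous_planeMk ((extChartAt (𝓡∂ 2) p p) 1)).tendsto (0, 0)
      conv_rhs => rw [h6]
      exact this.mono_left nhdsWithin_le_nhds
    · filter_upwards [self_mem_nhdsWithin] with z hz
      rw [range_modelWithCornersEuclideanHalfSpace]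
      exact hz
  have h8 := h7 h5
  rw [mem_map, Metric.mem_nhdsWithin_iff] at h8
  obtain ⟨ε, hε, h9⟩ := h8
  have h10 : ∀ x y, 0 ≤ x → x ≤ ε / 2 → |y| ≤ ε / 2 →
      (!₂[x, (extChartAt (𝓡∂ 2) p p) 1 + y] : Plane) ∈ (extChartAt (𝓡∂ 2) p).target ∩
        (extChartAt (𝓡∂ 2) p).symm ⁻¹' V := by
    intro x y hx1 hx2 hy
    refine h9 (a := (x, y)) ⟨?_, hx1⟩
    rw [Metric.mem_ball, Prod.dist_eq, max_lt_iff, Real.dist_eq, Real.dist_eq, sub_zero, sub_zero,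
      abs_of_nonneg hx1]
    exact ⟨by linarith, by linarith⟩
  exact ⟨ε / 2, ⟨half_pos hε, fun x y a b c ↦ (h10 x y a b c).1⟩, fun x y a b c ↦ (h10 x y a b c).2⟩

theorem tendsto_chartPoint_zero (hp : p ∈ (𝓡∂ 2).boundary M) :
    Tendsto (chartPoint p 0) (𝓝 0) (𝓝 p) := by
  obtain ⟨r, hr, -⟩ := exists_isChartRadius hp univ_mem
  have hr0 := hr.1
  have h1 : ContinuousOn (chartPoint p 0) (Icc (-r) r) := by
    refine (continuousOn_chartPoint hr).comp (f := fun y : ℝ ↦ ((0 : ℝ), y))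
      (continuousOn_const.prodMk continuousOn_id) ?_
    exact fun y hy ↦ ⟨⟨le_rfl, hr0.le⟩, hy⟩
  have h2 := h1.continuousAt (Icc_mem_nhds (by linarith : -r < 0) hr0)
  have h3 := h2.tendsto
  rwa [chartPoint_zero hp] at h3

theorem isOpen_chartBox : IsOpen (chartBox p δ η) := by
  have ho := (chartAt (EuclideanHalfSpace 2) p).open_source
  have h1 := (continuousOn_chartFst p).isOpen_inter_preimage ho (isOpen_Iio (a := δ))
  have h2 := (continuousOn_chartSnd p).abs.isOpen_inter_preimage ho (isOpen_Iio (a := η))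
  convert h1.inter h2 using 1
  ext q
  constructor
  · rintro ⟨a, b, c⟩; exact ⟨⟨a, b⟩, ⟨a, c⟩⟩
  · rintro ⟨⟨a, b⟩, ⟨-, c⟩⟩; exact ⟨a, b, c⟩

theorem mem_chartBox_self (hp : p ∈ (𝓡∂ 2).boundary M) (hδ : 0 < δ) (hη : 0 < η) :
    p ∈ chartBox p δ η := by
  refine ⟨mem_chart_source _ p, ?_, ?_⟩
  · rwa [chartFst_self hp]
  · rwa [chartSnd_self, abs_zero]

theorem chartPoint_mem_chartBox (h : IsChartRadius p r) (hδ : δ ≤ r) (hη : η ≤ r) (h1 : 0 ≤ x)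
    (h2 : x < δ) (h3 : |y| < η) : chartPoint p x y ∈ chartBox p δ η := by
  have a2 := h2.le.trans hδ
  have a3 := h3.le.trans hη
  refine ⟨h.mem_source h1 a2 a3, ?_, ?_⟩
  · rwa [h.chartFst_chartPoint h1 a2 a3]
  · rwa [h.chartSnd_chartPoint h1 a2 a3]

theorem chartBox_subset {V : Set M}
    (hV : ∀ x y, 0 ≤ x → x ≤ r → |y| ≤ r → chartPoint p x y ∈ V) (hδ : δ ≤ r) (hη : η ≤ r) :
    chartBox p δ η ⊆ V := by
  rintro q ⟨h1, h2, h3⟩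
  rw [← chartPoint_chartFst_chartSnd h1]
  exact hV _ _ (chartFst_nonneg h1) (h2.le.trans hδ) (h3.le.trans hη)

theorem mem_boundary_iff [IsManifold (𝓡∂ 2) ∞ M]
    (hq : q ∈ (chartAt (EuclideanHalfSpace 2) p).source) :
    q ∈ (𝓡∂ 2).boundary M ↔ chartFst p q = 0 := by
  have h1 : (𝓡∂ 2).IsInteriorPoint q ↔ extChartAt (𝓡∂ 2) p q ∈
      interior (extChartAt (𝓡∂ 2) p).target :=
    (𝓡∂ 2).isInteriorPoint_iff_of_mem_atlas (n := ∞) (by simp) (chart_mem_atlas _ p) hq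
  have h2 : extChartAt (𝓡∂ 2) p q ∈ interior (extChartAt (𝓡∂ 2) p).target ↔
      extChartAt (𝓡∂ 2) p q ∈ interior (range (𝓡∂ 2)) := by
    constructor
    · intro h
      exact (chartAt _ p).interior_extend_target_subset_interior_range h
    · intro h
      exact (chartAt _ p).mem_interior_extend_target ((chartAt _ p).map_source hq) h
  rw [h2, interior_range_modelWithCornersEuclideanHalfSpace] at h1
  rw [← (𝓡∂ 2).compl_interior, mem_compl_iff]
  have h3 : 0 ≤ chartFst p q := chartFst_nonneg hq
  have h4 : q ∈ (𝓡∂ 2).interior M ↔ 0 < chartFst p q := h1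
  rw [h4, not_lt]
  exact ⟨fun h ↦ le_antisymm h h3, fun h ↦ h.le⟩

theorem chartFst_mem_Icc (hq : q ∈ chartBox p δ η) : chartFst p q ∈ Icc 0 δ :=
  ⟨chartFst_nonneg hq.1, hq.2.1.le⟩

theorem continuousOn_snd_chartBox : ContinuousOn (chartSnd p) (chartBox p δ η) :=
  (continuousOn_chartSnd p).mono fun _ hq ↦ hq.1

theorem continuousOn_fst_chartBox : ContinuousOn (chartFst p) (chartBox p δ η) :=
  (continuousOn_chartFst p).mono fun _ hq ↦ hq.1

theorem eq_of_chart_eq_zero (hp : p ∈ (𝓡∂ 2).boundary M) (hq : q ∈ chartBox p δ η)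
    (h0 : chartFst p q = 0) (h1 : chartSnd p q = 0) : q = p := by
  rw [← chartPoint_chartFst_chartSnd hq.1, h0, h1, chartPoint_zero hp]

theorem chartBox_mono {δ' η' : ℝ} (hδ : δ' ≤ δ) (hη : η' ≤ η) :
    chartBox p δ' η' ⊆ chartBox p δ η :=
  fun _ hq ↦ ⟨hq.1, hq.2.1.trans_le hδ, hq.2.2.trans_le hη⟩

end Coordinates

/-! ### Derivatives and curves in coordinates -/

section CoordinateDerivatives

open CoherentTangentBundle

variable {M : Type*} [TopologicalSpace M] [ChartedSpace (EuclideanHalfSpace 2) M]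
  [IsManifold (𝓡∂ 2) ∞ M] {F : Type*} [NormedAddCommGroup F] [NormedSpace ℝ F]
  {p q : M} {r x y : ℝ}

/-- The derivative at `q` of `f` along the `i`-th coordinate vector field of the preferred chart
at `p`. -/
def coordDeriv (p : M) (i : Fin 2) (f : M → F) (q : M) : F :=
  mfderiv (𝓡∂ 2) 𝓘(ℝ, F) f q (coordField p i q)

theorem mem_tangent_baseSet (hq : q ∈ (chartAt (EuclideanHalfSpace 2) p).source) :
    q ∈ (trivializationAt Plane (TangentSpace (𝓡∂ 2)) p).baseSet := by
  rwa [TangentBundle.trivializationAt_baseSet]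

/-- The coordinate fields are the standard frame in the trivialization of the tangent bundle at `p`. -/
theorem coordField_eq_symmL (hq : q ∈ (chartAt (EuclideanHalfSpace 2) p).source) (i : Fin 2) :
    coordField p i q =
    (trivializationAt Plane (TangentSpace (𝓡∂ 2)) p).symmL ℝ q (EuclideanSpace.single i 1) :=
  (Trivialization.symmL_apply (R := ℝ) (trivializationAt Plane (TangentSpace (𝓡∂ 2)) p)
    (mem_tangent_baseSet hq) _).symm

theorem coordField_eq (hq : q ∈ (chartAt (EuclideanHalfSpace 2) p).source) (i : Fin 2) :
    coordField p i q = mfderivWithin 𝓘(ℝ, Plane) (𝓡∂ 2) (extChartAt (𝓡∂ 2) p).symm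
      (range (𝓡∂ 2)) (extChartAt (𝓡∂ 2) p q) (EuclideanSpace.single i (1 : ℝ) : Plane) := by
  rw [← TangentBundle.symmL_trivializationAt hq]
  exact coordField_eq_symmL hq i

/-- The partial derivatives of the coordinate expression of `f`, up to the boundary, are the
derivatives of `f` along the coordinate fields. -/
theorem hasFDerivWithinAt_comp_extChartAt_symm {f : M → F}
    (hq : q ∈ (chartAt (EuclideanHalfSpace 2) p).source)
    (hf : MDifferentiableAt (𝓡∂ 2) 𝓘(ℝ, F) f q) :
    ∃ D : Plane →L[ℝ] F, HasFDerivWithinAt (f ∘ (extChartAt (𝓡∂ 2) p).symm) D (range (𝓡∂ 2))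
      (extChartAt (𝓡∂ 2) p q) ∧ ∀ i, D (EuclideanSpace.single i 1) = coordDeriv p i f q := by
  have hq' : q ∈ (extChartAt (𝓡∂ 2) p).source := by rwa [extChartAt_source]
  have hinv := (extChartAt (𝓡∂ 2) p).left_inv hq'
  have h1 : MDifferentiableWithinAt 𝓘(ℝ, Plane) (𝓡∂ 2) (extChartAt (𝓡∂ 2) p).symm
      (range (𝓡∂ 2)) (extChartAt (𝓡∂ 2) p q) :=
    mdifferentiableWithinAt_extChartAt_symm ((extChartAt (𝓡∂ 2) p).map_source hq')
  have h2 := h1.hasMFDerivWithinAt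
  have h3 : HasMFDerivAt (𝓡∂ 2) 𝓘(ℝ, F) f ((extChartAt (𝓡∂ 2) p).symm (extChartAt (𝓡∂ 2) p q))
      (mfderiv (𝓡∂ 2) 𝓘(ℝ, F) f ((extChartAt (𝓡∂ 2) p).symm (extChartAt (𝓡∂ 2) p q))) := by
    rw [← hinv] at hf
    exact hf.hasMFDerivAt
  have h4 := h3.comp_hasMFDerivWithinAt _ h2
  refine ⟨_, hasMFDerivWithinAt_iff_hasFDerivWithinAt.1 h4, fun i ↦ ?_⟩
  unfold coordDeriv
  rw [coordField_eq hq]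
  have key : ∀ q', q' = q → ∀ v : Plane,
      (show Plane →L[ℝ] F from mfderiv (𝓡∂ 2) 𝓘(ℝ, F) f q') v =
        (show Plane →L[ℝ] F from mfderiv (𝓡∂ 2) 𝓘(ℝ, F) f q) v := by
    rintro _ rfl v; rfl
  exact key _ hinv _

theorem planeMk_eq (a b : ℝ) : (!₂[a, b] : Plane) =
    a • (EuclideanSpace.single 0 (1 : ℝ) : Plane) + b • (EuclideanSpace.single 1 (1 : ℝ) : Plane) := by
  ext i; fin_cases i <;> simp

theorem hasDerivWithinAt_planeMk {f g : ℝ → ℝ} {s : Set ℝ} {t u v : ℝ} (b : ℝ)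
    (hf : HasDerivWithinAt f u s t) (hg : HasDerivWithinAt g v s t) :
    HasDerivWithinAt (fun t ↦ (!₂[f t, b + g t] : Plane))
      (u • EuclideanSpace.single 0 (1 : ℝ) + v • EuclideanSpace.single 1 (1 : ℝ)) s t := by
  simp only [planeMk_eq]
  exact (hf.smul_const _).add ((hg.const_add b).smul_const _)

/-- The second coordinate is not constrained by the half-space, so that a two-sided derivative in
this coordinate exists at boundary points as well. -/
theorem hasDerivAt_chartPoint_right {f : M → F} (h : IsChartRadius p r) (h1 : 0 ≤ x)
    (h2 : x ≤ r) (h3 : |y| ≤ r) (hf : MDifferentiableAt (𝓡∂ 2) 𝓘(ℝ, F) f (chartPoint p x y)) :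
    HasDerivAt (fun s ↦ f (chartPoint p x s)) (coordDeriv p 1 f (chartPoint p x y)) y := by
  obtain ⟨D, hD, hDi⟩ := hasFDerivWithinAt_comp_extChartAt_symm (h.mem_source h1 h2 h3) hf
  rw [← hDi]
  rw [h.extChartAt_chartPoint h1 h2 h3] at hD
  have hd := hasDerivWithinAt_planeMk (extChartAt (𝓡∂ 2) p p 1) (hasDerivWithinAt_const y univ x)
    (hasDerivWithinAt_id y univ)
  rw [one_smul, zero_smul, zero_add] at hd
  rw [← hasDerivWithinAt_univ]
  refine hD.comp_hasDerivWithinAt_of_eq y hd ?_ rfl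
  intro s hs
  rw [range_modelWithCornersEuclideanHalfSpace]
  exact h1

theorem continuousAt_coordDeriv {f : M → F}
    (hq : q ∈ (chartAt (EuclideanHalfSpace 2) p).source) (i : Fin 2)
    (hf : ContMDiffAt (𝓡∂ 2) 𝓘(ℝ, F) 1 f q) :
    ContinuousAt (coordDeriv p i f) q := by
  have hq' : q ∈ (extChartAt (𝓡∂ 2) p).source := by rwa [extChartAt_source]
  have hinv := (extChartAt (𝓡∂ 2) p).left_inv hq'
  have hc : ContDiffWithinAt ℝ 1 (f ∘ (extChartAt (𝓡∂ 2) p).symm) (range (𝓡∂ 2))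
      (extChartAt (𝓡∂ 2) p q) := by
    have h1 : ContMDiffWithinAt 𝓘(ℝ, Plane) (𝓡∂ 2) 1 (extChartAt (𝓡∂ 2) p).symm
      (range (𝓡∂ 2)) (extChartAt (𝓡∂ 2) p q) :=
      contMDiffWithinAt_extChartAt_symm_range p ((extChartAt (𝓡∂ 2) p).map_source hq')
    rw [← contMDiffWithinAt_iff_contDiffWithinAt]
    rw [← hinv] at hf
    exact hf.comp_contMDiffWithinAt _ h1
  have hc' := (hc.fderivWithin_right (m := 0) (𝓡∂ 2).uniqueDiffOn (by simp)
    (extChartAt_target_subset_range p ((extChartAt (𝓡∂ 2) p).map_source hq'))).continuousWithinAt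
  have h3 : ContinuousAt (extChartAt (𝓡∂ 2) p) q := continuousAt_extChartAt' hq'
  have h4 : Tendsto (extChartAt (𝓡∂ 2) p) (𝓝 q) (𝓝[range (𝓡∂ 2)] (extChartAt (𝓡∂ 2) p q)) := by
    refine tendsto_nhdsWithin_iff.2 ⟨h3, Eventually.of_forall fun q' ↦ ?_⟩
    exact mem_range_self _
  have h5 := hc'.tendsto.comp h4
  have h6 : ∀ᶠ q' in 𝓝 q, coordDeriv p i f q' = fderivWithin ℝ (f ∘ (extChartAt (𝓡∂ 2) p).symm)
      (range (𝓡∂ 2)) (extChartAt (𝓡∂ 2) p q') (EuclideanSpace.single i 1) := by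
    have h7 : ∀ᶠ q' in 𝓝 q, q' ∈ (chartAt (EuclideanHalfSpace 2) p).source :=
      (chartAt (EuclideanHalfSpace 2) p).open_source.mem_nhds hq
    have h8 := (contMDiffAt_iff_contMDiffAt_nhds (by simp)).1 hf
    filter_upwards [h7, h8] with q' a b
    obtain ⟨D, hD, hDi⟩ := hasFDerivWithinAt_comp_extChartAt_symm a
      (b.mdifferentiableAt (by simp))
    rw [← hDi, hD.fderivWithin]
    exact (𝓡∂ 2).uniqueDiffOn _ (mem_range_self _)
  have h9 : Tendsto (coordDeriv p i f) (𝓝 q) (𝓝 (fderivWithin ℝ (f ∘ (extChartAt (𝓡∂ 2) p).symm)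
      (range (𝓡∂ 2)) (extChartAt (𝓡∂ 2) p q) (EuclideanSpace.single i 1))) := by
    refine Tendsto.congr' (h6.mono fun _ h ↦ h.symm) ?_
    exact ((ContinuousLinearMap.apply ℝ F (EuclideanSpace.single i (1 : ℝ) : Plane)).continuous.tendsto
      _).comp h5
  unfold ContinuousAt
  rwa [h6.self_of_nhds]

theorem coordField_combination (hq : q ∈ (chartAt (EuclideanHalfSpace 2) p).source) (z : Plane) :
    z 0 • coordField p 0 q + z 1 • coordField p 1 q =
      (trivializationAt Plane (TangentSpace (𝓡∂ 2)) p).symmL ℝ q z := by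
  rw [coordField_eq_symmL hq, coordField_eq_symmL hq, ← map_smul, ← map_smul, ← map_add, ← planeMk_eq,
    plane_eta]

theorem exists_eq_coordField_combination (hq : q ∈ (chartAt (EuclideanHalfSpace 2) p).source)
    (v : TangentSpace (𝓡∂ 2) q) : ∃ a b : ℝ, v = a • coordField p 0 q + b • coordField p 1 q := by
  have h := coordField_combination hq
    ((trivializationAt Plane (TangentSpace (𝓡∂ 2)) p).continuousLinearMapAt ℝ q v)
  rw [Trivialization.symmL_continuousLinearMapAt _ (mem_tangent_baseSet hq)] at h
  exact ⟨_, _, h.symm⟩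

theorem coordField_independent (hq : q ∈ (chartAt (EuclideanHalfSpace 2) p).source) {a b : ℝ}
    (h : a • coordField p 0 q + b • coordField p 1 q = 0) : a = 0 ∧ b = 0 := by
  have h1 := coordField_combination hq !₂[a, b]
  have h2 : (!₂[a, b] : Plane) 0 = a := rfl
  have h3 : (!₂[a, b] : Plane) 1 = b := rfl
  rw [h2, h3, h] at h1
  have h4 := Trivialization.continuousLinearMapAt_symmL (R := ℝ)
    (trivializationAt Plane (TangentSpace (𝓡∂ 2)) p) (mem_tangent_baseSet hq) !₂[a, b]
  rw [← h1, map_zero] at h4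
  exact ⟨by rw [← h2, ← h4]; rfl, by rw [← h3, ← h4]; rfl⟩

theorem coordField_self (p : M) (i : Fin 2) :
    (show Plane from coordField p i p) = EuclideanSpace.single i (1 : ℝ) := by
  rw [coordField_eq (mem_chart_source _ p), mfderivWithin_range_extChartAt_symm]
  rfl

/-- The velocity of a curve in terms of the derivatives of its coordinates. -/
theorem velocity_eq {γ : ℝ → M} {t : ℝ}
    (hγ : MDifferentiableWithinAt 𝓘(ℝ, ℝ) (𝓡∂ 2) γ (Icc 0 1) t)
    (hs : γ t ∈ (chartAt (EuclideanHalfSpace 2) p).source) :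
    ∃ u v : ℝ, HasDerivWithinAt (fun s ↦ chartFst p (γ s)) u (Icc 0 1) t ∧
      HasDerivWithinAt (fun s ↦ chartSnd p (γ s)) v (Icc 0 1) t ∧
      velocity γ t = u • coordField p 0 (γ t) + v • coordField p 1 (γ t) := by
  have h1 : MDifferentiableAt (𝓡∂ 2) 𝓘(ℝ, Plane) (extChartAt (𝓡∂ 2) p) (γ t) :=
    mdifferentiableAt_extChartAt hs
  have h2 := h1.hasMFDerivAt.comp_hasMFDerivWithinAt t hγ.hasMFDerivWithinAt
  obtain ⟨w, hw, hwv⟩ : ∃ w : Plane,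
      HasDerivWithinAt (fun s ↦ extChartAt (𝓡∂ 2) p (γ s)) w (Icc 0 1) t ∧
      (trivializationAt Plane (TangentSpace (𝓡∂ 2)) p).continuousLinearMapAt ℝ (γ t)
        (velocity γ t) = w := by
    obtain ⟨D, hD, hD1⟩ : ∃ D : ℝ →L[ℝ] Plane,
        HasFDerivWithinAt (fun s ↦ extChartAt (𝓡∂ 2) p (γ s)) D (Icc 0 1) t ∧
        D 1 = mfderiv (𝓡∂ 2) 𝓘(ℝ, Plane) (extChartAt (𝓡∂ 2) p) (γ t) (velocity γ t) :=
      ⟨_, hasMFDerivWithinAt_iff_hasFDerivWithinAt.1 h2, rfl⟩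
    refine ⟨D 1, hD.hasDerivWithinAt, ?_⟩
    rw [TangentBundle.continuousLinearMapAt_trivializationAt hs, hD1]
    rfl
  have h4 := fun i ↦ (EuclideanSpace.proj (𝕜 := ℝ) (i : Fin 2)).hasFDerivAt.comp_hasDerivWithinAt t hw
  refine ⟨w 0, w 1, h4 0, (h4 1).sub_const _, ?_⟩
  have h5 := coordField_combination hs
    ((trivializationAt Plane (TangentSpace (𝓡∂ 2)) p).continuousLinearMapAt ℝ (γ t) (velocity γ t))
  rw [Trivialization.symmL_continuousLinearMapAt _ (mem_tangent_baseSet hs), hwv] at h5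
  exact h5.symm

/-- A curve given by its coordinates. -/
theorem isRegularArc_chartPoint (h : IsChartRadius p r) (hp : p ∈ (𝓡∂ 2).boundary M)
    {f g : ℝ → ℝ} (hf : ContDiffOn ℝ 1 f (Icc 0 1)) (hg : ContDiffOn ℝ 1 g (Icc 0 1))
    (hfr : ∀ t ∈ Icc (0 : ℝ) 1, 0 ≤ f t ∧ f t ≤ r) (hgr : ∀ t ∈ Icc (0 : ℝ) 1, |g t| ≤ r)
    (hf0 : f 0 = 0) (hg0 : g 0 = 0)
    (hne : ∀ t ∈ Icc (0 : ℝ) 1, derivWithin f (Icc 0 1) t ≠ 0 ∨ derivWithin g (Icc 0 1) t ≠ 0)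
    (hinj : ∀ s ∈ Icc (0 : ℝ) 1, ∀ t ∈ Icc (0 : ℝ) 1, f s = f t → g s = g t → s = t) :
    IsRegularArc p fun t ↦ chartPoint p (f t) (g t) := by
  have hsm : ContMDiffOn 𝓘(ℝ, ℝ) (𝓡∂ 2) 1 (fun t ↦ chartPoint p (f t) (g t)) (Icc 0 1) := by
    refine (contMDiffOn_extChartAt_symm p).comp (t := (extChartAt (𝓡∂ 2) p).target) ?_ ?_
    · rw [contMDiffOn_iff_contDiffOn]
      simp only [planeMk_eq]
      exact (hf.smul contDiffOn_const).add ((contDiffOn_const.add hg).smul contDiffOn_const)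
    · intro t ht
      exact h.2 _ _ (hfr t ht).1 (hfr t ht).2 (hgr t ht)
  have hF : ∀ t ∈ Icc (0 : ℝ) 1, chartFst p (chartPoint p (f t) (g t)) = f t := fun t ht ↦
    h.chartFst_chartPoint (hfr t ht).1 (hfr t ht).2 (hgr t ht)
  have hG : ∀ t ∈ Icc (0 : ℝ) 1, chartSnd p (chartPoint p (f t) (g t)) = g t := fun t ht ↦
    h.chartSnd_chartPoint (hfr t ht).1 (hfr t ht).2 (hgr t ht)
  refine ⟨by rw [hf0, hg0, chartPoint_zero hp], hsm, fun t ht hv ↦ ?_, fun s hs t ht hst ↦ ?_⟩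
  · have hsrc := h.mem_source (hfr t ht).1 (hfr t ht).2 (hgr t ht)
    obtain ⟨u, v, hu, hv', huv⟩ := velocity_eq (p := p)
      ((hsm t ht).mdifferentiableWithinAt (by simp)) hsrc
    rw [hv] at huv
    have hu' := (hu.congr (fun t ht ↦ (hF t ht).symm) (hF t ht).symm).derivWithin
      (uniqueDiffOn_Icc zero_lt_one t ht)
    have hv'' := (hv'.congr (fun t ht ↦ (hG t ht).symm) (hG t ht).symm).derivWithin
      (uniqueDiffOn_Icc zero_lt_one t ht)
    obtain ⟨rfl, rfl⟩ := coordField_independent hsrc huv.symm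
    exact (hne t ht).elim (fun h ↦ h hu') (fun h ↦ h hv'')
  · refine hinj s hs t ht ?_ ?_
    · rw [← hF s hs, ← hF t ht]; exact congrArg _ hst
    · rw [← hG s hs, ← hG t ht]; exact congrArg _ hst

theorem contDiffOn_chart_comp {γ : ℝ → M} {s : Set ℝ}
    (hγ : ContMDiffOn 𝓘(ℝ, ℝ) (𝓡∂ 2) 1 γ s)
    (hs : ∀ t ∈ s, γ t ∈ (chartAt (EuclideanHalfSpace 2) p).source) :
    ContDiffOn ℝ 1 (fun t ↦ chartFst p (γ t)) s ∧ ContDiffOn ℝ 1 (fun t ↦ chartSnd p (γ t)) s := by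
  have h1 : ContDiffOn ℝ 1 (fun t ↦ extChartAt (𝓡∂ 2) p (γ t)) s := by
    rw [← contMDiffOn_iff_contDiffOn]
    exact contMDiffOn_extChartAt.comp hγ hs
  exact ⟨(EuclideanSpace.proj (𝕜 := ℝ) (0 : Fin 2)).contDiff.comp_contDiffOn h1,
    ((EuclideanSpace.proj (𝕜 := ℝ) (1 : Fin 2)).contDiff.comp_contDiffOn h1).sub contDiffOn_const⟩

end CoordinateDerivatives

/-! ### The signed area density -/

namespace CoherentTangentBundle

variable {M : Type*} [TopologicalSpace M]
    [ChartedSpace (EuclideanHalfSpace 2) M] [IsManifold (𝓡∂ 2) ∞ M]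
    {E : M → Type*} [TopologicalSpace (TotalSpace Plane E)]
    [∀ x, NormedAddCommGroup (E x)] [∀ x, InnerProductSpace ℝ (E x)]
    [FiberBundle Plane E] [VectorBundle ℝ Plane E]
    [ContMDiffVectorBundle ∞ Plane E (𝓡∂ 2)]
    [IsContMDiffRiemannianBundle (𝓡∂ 2) ∞ Plane E]
    (C : CoherentTangentBundle M E) (o : SurfaceOrientation M) {p q : M}

theorem finrank_fiber (_ : CoherentTangentBundle M E) (q : M) : Module.finrank ℝ (E q) = 2 := by
  have e := (trivializationAt Plane E q).linearEquivAt ℝ q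
    (FiberBundle.mem_baseSet_trivializationAt' (F := Plane) (E := E) q)
  rw [e.finrank_eq]
  simp

/-- The Lagrange identity: `μ` is an area form for the metric. -/
theorem mu_sq_add_inner_sq (q : M) (v w : E q) :
    C.mu q v w ^ 2 + (inner ℝ v w) ^ 2 = ‖v‖ ^ 2 * ‖w‖ ^ 2 := by
  have : FiniteDimensional ℝ (E q) := FiniteDimensional.of_finrank_pos
    (by rw [C.finrank_fiber]; norm_num)
  let b := (stdOrthonormalBasis ℝ (E q)).reindex (finCongr (C.finrank_fiber q))
  have hself : ∀ v, C.mu q v v = 0 := fun v ↦ by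
    have := C.mu_skew q v v; linarith
  have h10 := C.mu_skew q (b 1) (b 0)
  have h01 : C.mu q (b 0) (b 1) ^ 2 = 1 := by
    rcases C.mu_orthonormal q (b 0) (b 1) (b.orthonormal.1 0) (b.orthonormal.1 1)
      (b.orthonormal.2 (by simp)) with h | h <;> rw [h] <;> norm_num
  have hv := b.sum_repr v
  have hw := b.sum_repr w
  rw [Fin.sum_univ_two] at hv hw
  set v0 := b.repr v 0
  set v1 := b.repr v 1
  set w0 := b.repr w 0
  set w1 := b.repr w 1
  have e00 : inner ℝ (b 0) (b 0) = (1 : ℝ) := by simp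
  have e11 : inner ℝ (b 1) (b 1) = (1 : ℝ) := by simp
  have e01 : inner ℝ (b 0) (b 1) = (0 : ℝ) := b.orthonormal.2 (by simp)
  have e10 : inner ℝ (b 1) (b 0) = (0 : ℝ) := b.orthonormal.2 (by simp)
  have m1 : C.mu q v w = (v0 * w1 - v1 * w0) * C.mu q (b 0) (b 1) := by
    rw [← hv, ← hw]
    simp only [map_add, map_smul, _root_.add_apply, _root_.smul_apply,
      smul_eq_mul, hself, h10]
    ring
  have i1 : ∀ a b' c d : ℝ, inner ℝ (a • b 0 + b' • b 1) (c • b 0 + d • b 1) = a * c + b' * d := by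
    intro a b' c d
    simp only [inner_add_left, inner_add_right, real_inner_smul_left, real_inner_smul_right,
      e00, e01, e10, e11]
    ring
  rw [m1, mul_pow, h01, ← real_inner_self_eq_norm_sq, ← real_inner_self_eq_norm_sq, ← hv, ← hw,
    i1, i1, i1]
  ring

theorem abs_mu_le (q : M) (v w : E q) : |C.mu q v w| ≤ ‖v‖ * ‖w‖ := by
  refine abs_le_of_sq_le_sq ?_ (by positivity)
  have := C.mu_sq_add_inner_sq q v w
  nlinarith [sq_nonneg (inner ℝ v w : ℝ)]

/-- The form `ψ^* μ` in coordinates. -/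
theorem mu_psi_combination (a b c d : ℝ) :
    C.mu q (C.psi q (a • coordField p 0 q + b • coordField p 1 q))
      (C.psi q (c • coordField p 0 q + d • coordField p 1 q)) =
    (a * d - b * c) * C.areaDensity p q := by
  unfold areaDensity
  have hself : ∀ v, C.mu q v v = 0 := fun v ↦ by
    have := C.mu_skew q v v; linarith
  have h10 := C.mu_skew q (C.psi q (coordField p 1 q)) (C.psi q (coordField p 0 q))
  simp only [map_add, map_smul, _root_.add_apply, _root_.smul_apply,
    smul_eq_mul, hself, h10]
  ring

/-- Both fibres have dimension two, so that `ψ` is bijective as soon as its kernel vanishes. -/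
theorem mem_singularSet_iff_exists_isNullVector :
    q ∈ C.singularSet ↔ ∃ v, C.IsNullVector q v := by
  have : FiniteDimensional ℝ (E q) := FiniteDimensional.of_finrank_pos
    (by rw [C.finrank_fiber]; norm_num)
  have hfin : Module.finrank ℝ (TangentSpace (𝓡∂ 2) q) = Module.finrank ℝ (E q) := by
    rw [C.finrank_fiber]
    exact finrank_euclideanSpace_fin
  have : FiniteDimensional ℝ (TangentSpace (𝓡∂ 2) q) :=
    inferInstanceAs (FiniteDimensional ℝ Plane)
  have hbij : Function.Bijective (C.psi q) ↔ Function.Injective (C.psi q) := by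
    refine ⟨fun h ↦ h.1, fun h ↦ ⟨h, ?_⟩⟩
    exact (LinearMap.injective_iff_surjective_of_finrank_eq_finrank hfin
      (f := (C.psi q : TangentSpace (𝓡∂ 2) q →ₗ[ℝ] E q))).1 h
  have h0 : q ∈ C.singularSet ↔ ¬ Function.Injective (C.psi q) := by rw [← hbij]; rfl
  rw [h0, injective_iff_map_eq_zero]
  push Not
  exact exists_congr fun v ↦ and_comm

/-- On the domain of a chart, the singular points are the zeros of the signed area density. -/
theorem mem_singularSet_iff (hq : q ∈ (chartAt (EuclideanHalfSpace 2) p).source) :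
    q ∈ C.singularSet ↔ C.areaDensity p q = 0 := by
  constructor
  · intro h
    obtain ⟨v, hv0, hv⟩ := C.mem_singularSet_iff_exists_isNullVector.1 h
    obtain ⟨a, b, rfl⟩ := exists_eq_coordField_combination hq v
    have h1 := C.mu_psi_combination (p := p) (q := q) a b (-b) a
    rw [hv] at h1
    simp only [map_zero, _root_.zero_apply] at h1
    rcases mul_eq_zero.1 h1.symm with h2 | h2
    · exfalso
      apply hv0
      have ha : a = 0 := by nlinarith [sq_nonneg a, sq_nonneg b]
      have hb : b = 0 := by nlinarith [sq_nonneg a, sq_nonneg b]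
      rw [ha, hb]; simp
    · exact h2
  · rintro h ⟨hinj, -⟩
    have hl := C.mu_sq_add_inner_sq q (C.psi q (coordField p 0 q)) (C.psi q (coordField p 1 q))
    have h' : C.mu q (C.psi q (coordField p 0 q)) (C.psi q (coordField p 1 q)) = 0 := h
    rw [h'] at hl
    set P := C.psi q (coordField p 0 q) with hP
    set Q := C.psi q (coordField p 1 q) with hQ
    -- equality in the Cauchy–Schwarz inequality
    have hdep : ‖Q‖ ^ 2 • P - (inner ℝ P Q : ℝ) • Q = 0 := by
      rw [← norm_eq_zero, ← sq_eq_zero_iff, @norm_sub_sq_real, norm_smul, norm_smul,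
        real_inner_smul_left, real_inner_smul_right]
      simp only [Real.norm_eq_abs, mul_pow, sq_abs]
      linear_combination -‖Q‖^2 * hl
    rw [hP, hQ, ← map_smul, ← map_smul, ← map_sub] at hdep
    have h2 := (injective_iff_map_eq_zero _).1 hinj _ hdep
    rw [sub_eq_add_neg, ← neg_smul] at h2
    obtain ⟨h3, -⟩ := coordField_independent hq h2
    rw [← hQ] at h3
    have h4 : Q = 0 := by simpa using h3
    have h5 := (injective_iff_map_eq_zero _).1 hinj _ (hQ ▸ h4)
    have h6 := coordField_independent hq (a := 0) (b := 1) (by rw [h5]; simp)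
    exact one_ne_zero h6.2

theorem contMDiffOn_coordField (p : M) (i : Fin 2) :
    ContMDiffOn (𝓡∂ 2) ((𝓡∂ 2).prod 𝓘(ℝ, Plane)) ∞
      (fun x ↦ TotalSpace.mk' Plane (E := (TangentSpace (𝓡∂ 2) : M → Type)) x (coordField p i x))
      (chartAt (EuclideanHalfSpace 2) p).source := by
  rw [(trivializationAt Plane (TangentSpace (𝓡∂ 2)) p).contMDiffOn_section_iff
    (chartAt (EuclideanHalfSpace 2) p).open_source fun q hq ↦ mem_tangent_baseSet hq]
  refine (contMDiffOn_const (c := (EuclideanSpace.single i (1 : ℝ) : Plane))).congr fun q hq ↦ ?_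
  exact congrArg Prod.snd ((trivializationAt Plane (TangentSpace (𝓡∂ 2)) p).apply_mk_symm
    (mem_tangent_baseSet hq) (EuclideanSpace.single i (1 : ℝ)))

theorem contMDiffOn_psi_coordField (p : M) (i : Fin 2) :
    ContMDiffOn (𝓡∂ 2) ((𝓡∂ 2).prod 𝓘(ℝ, Plane)) ∞
      (fun x ↦ TotalSpace.mk' Plane x (C.psi x (coordField p i x)))
      (chartAt (EuclideanHalfSpace 2) p).source :=
  ContMDiffOn.clm_bundle_apply C.smooth_psi.contMDiffOn (contMDiffOn_coordField p i)

theorem contMDiffOn_areaDensity (p : M) :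
    ContMDiffOn (𝓡∂ 2) 𝓘(ℝ, ℝ) ∞ (C.areaDensity p) (chartAt (EuclideanHalfSpace 2) p).source := by
  intro q hq
  have h : ContMDiffWithinAt (𝓡∂ 2) ((𝓡∂ 2).prod 𝓘(ℝ, ℝ)) ∞
      (fun m : M ↦ TotalSpace.mk' ℝ (E := Bundle.Trivial M ℝ) m
        (C.mu m (C.psi m (coordField p 0 m)) (C.psi m (coordField p 1 m))))
      (chartAt (EuclideanHalfSpace 2) p).source q := by
    apply ContMDiffWithinAt.clm_bundle_apply₂ (F₁ := Plane) (F₂ := Plane)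
    · exact C.smooth_mu.contMDiffOn q hq
    · exact C.contMDiffOn_psi_coordField p 0 q hq
    · exact C.contMDiffOn_psi_coordField p 1 q hq
  simp only [contMDiffWithinAt_totalSpace] at h
  exact h.2

/-- The density of the orientation form in the preferred chart at `p`. -/
def _root_.SurfaceOrientation.density (p q : M) : ℝ :=
  o.form q (coordField p 0 q) (coordField p 1 q)

theorem _root_.SurfaceOrientation.continuousOn_density (p : M) :
    ContinuousOn (o.density p) (chartAt (EuclideanHalfSpace 2) p).source := by
  intro q hq
  have h : ContMDiffWithinAt (𝓡∂ 2) ((𝓡∂ 2).prod 𝓘(ℝ, ℝ)) ∞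
      (fun m : M ↦ TotalSpace.mk' ℝ (E := Bundle.Trivial M ℝ) m
        (o.form m (coordField p 0 m) (coordField p 1 m)))
      (chartAt (EuclideanHalfSpace 2) p).source q := by
    apply ContMDiffWithinAt.clm_bundle_apply₂ (F₁ := Plane) (F₂ := Plane)
    · exact o.smooth.contMDiffOn q hq
    · exact contMDiffOn_coordField p 0 q hq
    · exact contMDiffOn_coordField p 1 q hq
  simp only [contMDiffWithinAt_totalSpace] at h
  exact h.2.continuousWithinAt

theorem _root_.SurfaceOrientation.form_combination (a b c d : ℝ) :
    o.form q (a • coordField p 0 q + b • coordField p 1 q)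
      (c • coordField p 0 q + d • coordField p 1 q) = (a * d - b * c) * o.density p q := by
  unfold SurfaceOrientation.density
  have hself : ∀ v, o.form q v v = 0 := fun v ↦ by
    have := o.skew q v v; linarith
  have h10 := o.skew q (coordField p 1 q) (coordField p 0 q)
  simp only [map_add, map_smul, _root_.add_apply, _root_.smul_apply,
    smul_eq_mul, hself, h10]
  ring

theorem _root_.SurfaceOrientation.density_ne_zero
    (hq : q ∈ (chartAt (EuclideanHalfSpace 2) p).source) : o.density p q ≠ 0 := by
  intro h
  obtain ⟨v, w, hvw⟩ := o.nonvanishing q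
  obtain ⟨a, b, rfl⟩ := exists_eq_coordField_combination hq v
  obtain ⟨c, d, rfl⟩ := exists_eq_coordField_combination hq w
  rw [o.form_combination, h, mul_zero] at hvw
  exact hvw rfl

theorem mem_positivePart_iff (hq : q ∈ (chartAt (EuclideanHalfSpace 2) p).source) :
    q ∈ C.positivePart o ↔ 0 < o.density p q * C.areaDensity p q := by
  have hd := o.density_ne_zero hq
  constructor
  · rintro ⟨-, h⟩
    have h1 := h (o.density p q • coordField p 0 q + (0 : ℝ) • coordField p 1 q)
      ((0 : ℝ) • coordField p 0 q + (1 : ℝ) • coordField p 1 q)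
    rw [o.form_combination, C.mu_psi_combination] at h1
    have h2 := h1 (by rw [mul_one, mul_zero, sub_zero]; exact mul_self_pos.2 hd)
    simpa using h2
  · intro h
    refine ⟨fun hs ↦ ?_, fun v w hvw ↦ ?_⟩
    · rw [(C.mem_singularSet_iff hq).1 hs, mul_zero] at h
      exact lt_irrefl _ h
    · obtain ⟨a, b, rfl⟩ := exists_eq_coordField_combination hq v
      obtain ⟨c, d, rfl⟩ := exists_eq_coordField_combination hq w
      rw [o.form_combination] at hvw
      rw [C.mu_psi_combination]
      have := mul_pos hvw h
      have h3 : (a * d - b * c) * o.density p q * (o.density p q * C.areaDensity p q) =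
        (o.density p q * o.density p q) * ((a * d - b * c) * C.areaDensity p q) := by ring
      rw [h3] at this
      exact (pos_iff_pos_of_mul_pos this).1 (mul_self_pos.2 hd)

theorem mem_negativePart_iff (hq : q ∈ (chartAt (EuclideanHalfSpace 2) p).source) :
    q ∈ C.negativePart o ↔ o.density p q * C.areaDensity p q < 0 := by
  have hd := o.density_ne_zero hq
  constructor
  · rintro ⟨-, h⟩
    have h1 := h (o.density p q • coordField p 0 q + (0 : ℝ) • coordField p 1 q)
      ((0 : ℝ) • coordField p 0 q + (1 : ℝ) • coordField p 1 q)
    rw [o.form_combination, C.mu_psi_combination] at h1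
    have h2 := h1 (by rw [mul_one, mul_zero, sub_zero]; exact mul_self_pos.2 hd)
    simpa using h2
  · intro h
    refine ⟨fun hs ↦ ?_, fun v w hvw ↦ ?_⟩
    · rw [(C.mem_singularSet_iff hq).1 hs, mul_zero] at h
      exact lt_irrefl _ h
    · obtain ⟨a, b, rfl⟩ := exists_eq_coordField_combination hq v
      obtain ⟨c, d, rfl⟩ := exists_eq_coordField_combination hq w
      rw [o.form_combination] at hvw
      rw [C.mu_psi_combination]
      have := mul_pos hvw (neg_pos.2 h)
      have h3 : (a * d - b * c) * o.density p q * -(o.density p q * C.areaDensity p q) =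
        (o.density p q * o.density p q) * -((a * d - b * c) * C.areaDensity p q) := by ring
      rw [h3] at this
      exact neg_pos.1 ((pos_iff_pos_of_mul_pos this).1 (mul_self_pos.2 hd))

theorem disjoint_positivePart_negativePart :
    Disjoint (C.positivePart o) (C.negativePart o) := by
  refine disjoint_left.2 fun q h1 h2 ↦ ?_
  rw [C.mem_positivePart_iff o (mem_chart_source _ q)] at h1
  rw [C.mem_negativePart_iff o (mem_chart_source _ q)] at h2
  exact lt_asymm h1 h2

theorem continuousAt_density_mul (q : M) :
    ContinuousAt (fun x ↦ o.density q x * C.areaDensity q x) q := by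
  have hn := (chartAt (EuclideanHalfSpace 2) q).open_source.mem_nhds (mem_chart_source _ q)
  exact ((o.continuousOn_density q).continuousAt hn).mul
    ((C.contMDiffOn_areaDensity q).continuousOn.continuousAt hn)

theorem isOpen_positivePart : IsOpen (C.positivePart o) := by
  rw [isOpen_iff_mem_nhds]
  intro q hq
  have hs := mem_chart_source (EuclideanHalfSpace 2) q
  have h1 := (C.mem_positivePart_iff o hs).1 hq
  filter_upwards [(chartAt (EuclideanHalfSpace 2) q).open_source.mem_nhds hs,
    (C.continuousAt_density_mul o q).eventually_const_lt h1] with x hx1 hx2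
  exact (C.mem_positivePart_iff o hx1).2 hx2

theorem isOpen_negativePart : IsOpen (C.negativePart o) := by
  rw [isOpen_iff_mem_nhds]
  intro q hq
  have hs := mem_chart_source (EuclideanHalfSpace 2) q
  have h1 := (C.mem_negativePart_iff o hs).1 hq
  filter_upwards [(chartAt (EuclideanHalfSpace 2) q).open_source.mem_nhds hs,
    (C.continuousAt_density_mul o q).eventually_lt_const h1] with x hx1 hx2
  exact (C.mem_negativePart_iff o hx1).2 hx2

theorem subset_positivePart_or_negativePart {T : Set M} (hT : IsPreconnected T)
    (hd : Disjoint T C.singularSet) : T ⊆ C.positivePart o ∨ T ⊆ C.negativePart o := by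
  refine hT.subset_or_subset (C.isOpen_positivePart o) (C.isOpen_negativePart o)
    (C.disjoint_positivePart_negativePart o) fun q hq ↦ ?_
  have hs := mem_chart_source (EuclideanHalfSpace 2) q
  have h1 := disjoint_left.1 hd hq
  rw [C.mem_singularSet_iff hs] at h1
  rcases lt_or_gt_of_ne (mul_ne_zero (o.density_ne_zero hs) h1) with h | h
  · exact Or.inr ((C.mem_negativePart_iff o hs).2 h)
  · exact Or.inl ((C.mem_positivePart_iff o hs).2 h)

theorem isClosed_singularSet : IsClosed C.singularSet := by
  rw [← isOpen_compl_iff, isOpen_iff_mem_nhds]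
  intro q hq
  have hs := mem_chart_source (EuclideanHalfSpace 2) q
  have h1 : C.areaDensity q q ≠ 0 := fun h ↦ hq ((C.mem_singularSet_iff hs).2 h)
  have hn := (chartAt (EuclideanHalfSpace 2) q).open_source.mem_nhds hs
  filter_upwards [hn, ((C.contMDiffOn_areaDensity q).continuousOn.continuousAt hn).eventually_ne h1]
    with x hx1 hx2 hx3
  exact hx2 ((C.mem_singularSet_iff hx1).1 hx3)

end CoherentTangentBundle

/-! ### Non-degenerate singular points in a fixed chart -/

namespace CoherentTangentBundle

variable {M : Type*} [TopologicalSpace M]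
    [ChartedSpace (EuclideanHalfSpace 2) M] [IsManifold (𝓡∂ 2) ∞ M]
    {E : M → Type*} [TopologicalSpace (TotalSpace Plane E)]
    [∀ x, NormedAddCommGroup (E x)] [∀ x, InnerProductSpace ℝ (E x)]
    [FiberBundle Plane E] [VectorBundle ℝ Plane E]
    [ContMDiffVectorBundle ∞ Plane E (𝓡∂ 2)]
    [IsContMDiffRiemannianBundle (𝓡∂ 2) ∞ Plane E]
    (C : CoherentTangentBundle M E) {p q : M}

theorem contMDiffAt_areaDensity (hq : q ∈ (chartAt (EuclideanHalfSpace 2) p).source) :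
    ContMDiffAt (𝓡∂ 2) 𝓘(ℝ, ℝ) ∞ (C.areaDensity p) q :=
  (C.contMDiffOn_areaDensity p).contMDiffAt
    ((chartAt (EuclideanHalfSpace 2) p).open_source.mem_nhds hq)

theorem mdifferentiableAt_areaDensity (hq : q ∈ (chartAt (EuclideanHalfSpace 2) p).source) :
    MDifferentiableAt (𝓡∂ 2) 𝓘(ℝ, ℝ) (C.areaDensity p) q :=
  (C.contMDiffAt_areaDensity hq).mdifferentiableAt (by simp)

/-- At a singular point, the differentials of the area densities of two charts are proportional:
the densities differ by the Jacobian of the change of charts. -/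
theorem exists_dAreaDensity_eq (hq : q ∈ (chartAt (EuclideanHalfSpace 2) p).source)
    (hs : q ∈ C.singularSet) : ∃ k : ℝ, ∀ v : TangentSpace (𝓡∂ 2) q,
      C.dAreaDensity q v = k * (show ℝ from mfderiv (𝓡∂ 2) 𝓘(ℝ, ℝ) (C.areaDensity p) q v) := by
  have hqq := mem_chart_source (EuclideanHalfSpace 2) q
  have hsrc := (chartAt (EuclideanHalfSpace 2) p).open_source.mem_nhds hq
  have hsrc' := (chartAt (EuclideanHalfSpace 2) q).open_source.mem_nhds hqq
  let a : Fin 2 → M → Plane := fun i x ↦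
    ((trivializationAt Plane (TangentSpace (𝓡∂ 2)) p) ⟨x, coordField q i x⟩).2
  have ha : ∀ i, ContMDiffAt (𝓡∂ 2) 𝓘(ℝ, Plane) ∞ (a i) q := fun i ↦
    ((trivializationAt Plane (TangentSpace (𝓡∂ 2)) p).contMDiffAt_section_iff
      (mem_tangent_baseSet hq)).1 ((contMDiffOn_coordField q i).contMDiffAt hsrc')
  have ha' : ∀ i j, MDifferentiableAt (𝓡∂ 2) 𝓘(ℝ, ℝ) (fun x ↦ a i x j) q := fun i j ↦
    ((EuclideanSpace.proj (𝕜 := ℝ) (j : Fin 2)).contMDiff.contMDiffAt.comp q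
      (ha i)).mdifferentiableAt (by simp)
  let k : M → ℝ := fun x ↦ a 0 x 0 * a 1 x 1 - a 0 x 1 * a 1 x 0
  have hk : MDifferentiableAt (𝓡∂ 2) 𝓘(ℝ, ℝ) k q :=
    ((ha' 0 0).mul (ha' 1 1)).sub ((ha' 0 1).mul (ha' 1 0))
  have heq : C.areaDensity q =ᶠ[𝓝 q] k * C.areaDensity p := by
    filter_upwards [hsrc] with x hx
    have hc : ∀ i, coordField q i x = a i x 0 • coordField p 0 x + a i x 1 • coordField p 1 x := by
      intro i
      rw [coordField_combination hx]
      have h1 := Trivialization.symmL_continuousLinearMapAt (R := ℝ)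
        (trivializationAt Plane (TangentSpace (𝓡∂ 2)) p) (mem_tangent_baseSet hx) (coordField q i x)
      rw [Trivialization.continuousLinearMapAt_apply,
        Trivialization.linearMapAt_apply, if_pos (mem_tangent_baseSet hx)] at h1
      exact h1.symm
    have h2 := C.mu_psi_combination (p := p) (q := x) (a 0 x 0) (a 0 x 1) (a 1 x 0) (a 1 x 1)
    rw [← hc, ← hc] at h2
    exact h2
  refine ⟨k q, fun v ↦ ?_⟩
  have h3 := (hk.hasMFDerivAt.mul (C.mdifferentiableAt_areaDensity hq).hasMFDerivAt).mfderiv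
  have h4 : C.areaDensity p q = 0 := (C.mem_singularSet_iff hq).1 hs
  unfold dAreaDensity
  have key : ∀ (D₁ D₂ : Plane →L[ℝ] ℝ) (w : Plane),
      (k q • D₁ + (0 : ℝ) • D₂) w = k q * D₁ w := by intro D₁ D₂ w; simp
  rw [heq.mfderiv_eq, h3, h4]
  exact key _ _ v

theorem mfderiv_combination (f : M → ℝ) (u v : ℝ) :
    mfderiv (𝓡∂ 2) 𝓘(ℝ, ℝ) f q (u • coordField p 0 q + v • coordField p 1 q) =
      u * coordDeriv p 0 f q + v * coordDeriv p 1 f q := by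
  rw [map_add, map_smul, map_smul]
  rfl

theorem IsNonDegenerate.coordDeriv_ne_zero (h : C.IsNonDegenerate q)
    (hq : q ∈ (chartAt (EuclideanHalfSpace 2) p).source)
    (h1 : coordDeriv p 1 (C.areaDensity p) q = 0) : coordDeriv p 0 (C.areaDensity p) q ≠ 0 := by
  intro h0
  obtain ⟨hs, v, hv⟩ := h
  obtain ⟨k, hk⟩ := C.exists_dAreaDensity_eq hq hs
  obtain ⟨a, b, rfl⟩ := exists_eq_coordField_combination hq v
  rw [hk, mfderiv_combination, h0, h1] at hv
  simp at hv

/-- A singular curve is tangent to the kernel of the differential of the area density. -/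
theorem mfderiv_areaDensity_velocity {γ : ℝ → M} (hγ : IsRegularArc q γ)
    (hs : γ '' Icc 0 1 ⊆ C.singularSet) {t : ℝ} (ht : t ∈ Icc (0 : ℝ) 1)
    (hp : γ t ∈ (chartAt (EuclideanHalfSpace 2) p).source) :
    mfderiv (𝓡∂ 2) 𝓘(ℝ, ℝ) (C.areaDensity p) (γ t) (velocity γ t) = 0 := by
  have h1 := (C.mdifferentiableAt_areaDensity hp).hasMFDerivAt.comp_hasMFDerivWithinAt t
    ((hγ.contMDiffOn t ht).mdifferentiableWithinAt (by simp)).hasMFDerivWithinAt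
  obtain ⟨D, hD, hD1⟩ : ∃ D : ℝ →L[ℝ] ℝ,
      HasFDerivWithinAt (C.areaDensity p ∘ γ) D (Icc 0 1) t ∧
      D 1 = mfderiv (𝓡∂ 2) 𝓘(ℝ, ℝ) (C.areaDensity p) (γ t) (velocity γ t) :=
    ⟨_, hasMFDerivWithinAt_iff_hasFDerivWithinAt.1 h1, rfl⟩
  have h3 : (C.areaDensity p ∘ γ) =ᶠ[𝓝[Icc 0 1] t] fun _ ↦ 0 := by
    have h4 := hγ.continuousOn t ht
    filter_upwards [self_mem_nhdsWithin,
      h4.preimage_mem_nhdsWithin ((chartAt (EuclideanHalfSpace 2) p).open_source.mem_nhds hp)]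
      with s hs1 hs2
    exact (C.mem_singularSet_iff hs2).1 (hs ⟨s, hs1, rfl⟩)
  have h5 := (hasFDerivWithinAt_const (𝕜 := ℝ) (0 : ℝ) t (Icc 0 1)).congr_of_eventuallyEq h3
    (h3.self_of_nhdsWithin ht)
  rw [← hD1, (uniqueDiffOn_Icc zero_lt_one t ht).eq hD h5]
  rfl

theorem dAreaDensity_velocity {γ : ℝ → M} (hγ : IsRegularArc p γ)
    (hs : γ '' Icc 0 1 ⊆ C.singularSet) {t : ℝ} (ht : t ∈ Icc (0 : ℝ) 1) :
    C.dAreaDensity (γ t) (velocity γ t) = 0 :=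
  C.mfderiv_areaDensity_velocity hγ hs ht (mem_chart_source _ _)

theorem SingularDirectionTransversal.coordDeriv_ne_zero (htr : C.SingularDirectionTransversal p)
    (h : C.IsNonDegenerate p) : coordDeriv p 1 (C.areaDensity p) p ≠ 0 := by
  intro h0
  have hself := coordField_self p 1
  refine htr.2 (coordField p 1 p) ⟨?_, Or.inl ⟨h, h0⟩⟩ ?_
  · intro h1
    have := congrArg (fun v : Plane ↦ v 1) (hself.symm.trans h1)
    have h2 : (EuclideanSpace.single (1 : Fin 2) (1 : ℝ) : Plane) 1 = 1 := by simp
    exact one_ne_zero (h2.symm.trans this)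
  · unfold IsTangentToBoundary
    rw [hself]
    simp

theorem isSingularDirection_velocity {γ : ℝ → M} (hγ : C.IsSingularArc p γ) :
    C.IsSingularDirection p (show Plane from velocity γ 0) := by
  have h0 : (0 : ℝ) ∈ Icc (0 : ℝ) 1 := by simp
  have hne := hγ.1.regular 0 h0
  refine ⟨hne, ?_⟩
  by_cases h : C.IsNonDegenerate p
  · refine Or.inl ⟨h, ?_⟩
    have h1 := C.dAreaDensity_velocity hγ.1 hγ.2 h0
    have h2 : ∀ x, x = p → ∀ v : Plane, C.dAreaDensity x v = 0 → C.dAreaDensity p v = 0 := by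
      rintro _ rfl v hv; exact hv
    exact h2 _ hγ.1.start _ h1
  · exact Or.inr ⟨h, γ, hγ, 1, (one_smul _ _).symm⟩

/-- A singular curve enters the surface transversally to the boundary. -/
theorem IsSingularArc.deriv_chartFst_pos (hp : p ∈ (𝓡∂ 2).boundary M)
    (htr : C.SingularDirectionTransversal p) {γ : ℝ → M}
    (hγ : C.IsSingularArc p γ) : 0 < derivWithin (fun s ↦ chartFst p (γ s)) (Icc 0 1) 0 := by
  have h0 : (0 : ℝ) ∈ Icc (0 : ℝ) 1 := by simp
  have hs : γ 0 ∈ (chartAt (EuclideanHalfSpace 2) p).source := by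
    rw [hγ.1.start]; exact mem_chart_source _ p
  obtain ⟨u, v, hu, hv, huv⟩ := velocity_eq (p := p)
    ((hγ.1.contMDiffOn 0 h0).mdifferentiableWithinAt (by simp)) hs
  rw [hu.derivWithin (uniqueDiffOn_Icc zero_lt_one 0 h0)]
  refine lt_of_le_of_ne ?_ ?_
  · have h2 := hasDerivWithinAt_iff_tendsto_slope.1 hu
    have h3 : 𝓝[Icc (0 : ℝ) 1 \ {0}] 0 = 𝓝[>] 0 := by
      rw [Icc_sdiff_left, nhdsWithin_Ioc_eq_nhdsGT zero_lt_one]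
    rw [h3] at h2
    refine ge_of_tendsto h2 ?_
    have h4 : ∀ᶠ t in 𝓝[>] (0 : ℝ), γ t ∈ (chartAt (EuclideanHalfSpace 2) p).source :=
      hγ.1.tendsto ((chartAt (EuclideanHalfSpace 2) p).open_source.mem_nhds
        (mem_chart_source _ p))
    filter_upwards [h4, self_mem_nhdsWithin] with t ht ht'
    rw [slope_def_field, hγ.1.start, chartFst_self hp]
    exact div_nonneg (by simpa using chartFst_nonneg ht) (by simpa using le_of_lt ht')
  · intro hu0
    refine htr.2 _ (C.isSingularDirection_velocity hγ) ?_
    unfold IsTangentToBoundary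
    have key : ∀ x, x = p → ∀ v' : Plane,
        (v' = (show Plane from u • coordField p 0 x + v • coordField p 1 x)) → v' 0 = 0 := by
      rintro _ rfl v' rfl
      rw [← hu0, zero_smul, zero_add]
      change v * (show Plane from coordField _ 1 _) 0 = 0
      rw [coordField_self]
      simp
    exact key _ hγ.1.start _ huv

end CoherentTangentBundle

/-! ### Sectors between graphs -/

section Graphs

variable {M : Type*} [TopologicalSpace M] [ChartedSpace (EuclideanHalfSpace 2) M]

namespace CoherentTangentBundle

/-- The graphs, completed by the lower and the upper side of the box. -/
def graphBound (m : ℕ) (g : ℕ → ℝ → ℝ) (η : ℝ) (k : ℕ) (x : ℝ) : ℝ :=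
  if k = 0 then -η else if k ≤ m then g k x else η

/-- The region between two consecutive graphs. -/
def graphSector (p : M) (m : ℕ) (g : ℕ → ℝ → ℝ) (δ η : ℝ) (k : ℕ) : Set M :=
  {q | q ∈ chartBox p δ η ∧ 0 < chartFst p q ∧ graphBound m g η k (chartFst p q) < chartSnd p q ∧
    chartSnd p q < graphBound m g η (k + 1) (chartFst p q)}

/-- The graph of `g k` for `1 ≤ k ≤ m`, and the lower and the upper half of the boundary for `k = 0`
and `k = m + 1`. -/
def graphArc (p : M) (m : ℕ) (g : ℕ → ℝ → ℝ) (δ η : ℝ) (k : ℕ) : Set M :=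
  {q | q ∈ chartBox p δ η ∧ (k = 0 → chartFst p q = 0 ∧ chartSnd p q ≤ 0) ∧
    (1 ≤ k → k ≤ m → chartSnd p q = g k (chartFst p q)) ∧
    (m < k → chartFst p q = 0 ∧ 0 ≤ chartSnd p q)}

theorem graphSector_mono {p : M} {m : ℕ} {g : ℕ → ℝ → ℝ} {δ η δ' η' : ℝ} (hδ : δ' ≤ δ)
    (hη : η' ≤ η) (k : ℕ) :
    graphSector p m g δ' η' k ⊆ graphSector p m g δ η k := by
  rintro q ⟨h1, h2, h3, h4⟩
  have hy := abs_lt.1 h1.2.2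
  refine ⟨chartBox_mono hδ hη h1, h2, ?_, ?_⟩
  · revert h3; unfold graphBound
    split_ifs
    · intro; linarith
    · exact id
    · intro; linarith
  · revert h4; unfold graphBound
    rw [if_neg k.succ_ne_zero, if_neg k.succ_ne_zero]
    split_ifs
    · exact id
    · intro; linarith

theorem graphArc_mono {p : M} {m : ℕ} {g : ℕ → ℝ → ℝ} {δ η δ' η' : ℝ} (hδ : δ' ≤ δ)
    (hη : η' ≤ η) (k : ℕ) :
    graphArc p m g δ' η' k ⊆ graphArc p m g δ η k :=
  fun _ hq ↦ ⟨chartBox_mono hδ hη hq.1, hq.2⟩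

end CoherentTangentBundle

end Graphs

namespace CoherentTangentBundle

variable {M : Type*} [TopologicalSpace M]
    [ChartedSpace (EuclideanHalfSpace 2) M] [IsManifold (𝓡∂ 2) ∞ M]
    {E : M → Type*} [TopologicalSpace (TotalSpace Plane E)]
    [∀ x, NormedAddCommGroup (E x)] [∀ x, InnerProductSpace ℝ (E x)]
    [FiberBundle Plane E] [VectorBundle ℝ Plane E]
    [ContMDiffVectorBundle ∞ Plane E (𝓡∂ 2)]
    [IsContMDiffRiemannianBundle (𝓡∂ 2) ∞ Plane E]
    (C : CoherentTangentBundle M E) {p q : M}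

/-- In the preferred chart at the boundary point `p`, the singular set in the box
`[0, δ) × (-η, η)` consists of the graphs of `g 1 < ⋯ < g m` over the first coordinate, which start
at the origin, do not meet again, and are of class `C¹` up to the boundary. -/
structure IsGraphSystem (p : M) (m : ℕ) (g : ℕ → ℝ → ℝ) (δ η : ℝ) : Prop where
  one_le : 1 ≤ m
  pos_left : 0 < δ
  pos_right : 0 < η
  radius : ∃ r, IsChartRadius p r ∧ δ ≤ r ∧ η ≤ r
  contDiffOn : ∀ k, 1 ≤ k → k ≤ m → ContDiffOn ℝ 1 (g k) (Icc 0 δ)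
  zero : ∀ k, 1 ≤ k → k ≤ m → g k 0 = 0
  abs_graph_lt : ∀ k, 1 ≤ k → k ≤ m → ∀ x ∈ Icc 0 δ, |g k x| < η
  lt : ∀ j k, 1 ≤ j → j < k → k ≤ m → ∀ x ∈ Ioc 0 δ, g j x < g k x
  sing : ∀ x ∈ Icc 0 δ, ∀ y, |y| < η →
    (chartPoint p x y ∈ C.singularSet ↔ ∃ k, 1 ≤ k ∧ k ≤ m ∧ y = g k x)

theorem exists_between_consecutive {f : ℕ → ℝ} {y : ℝ} {n : ℕ} (h0 : f 0 < y) (hn : y < f (n + 1))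
    (hne : ∀ k, 1 ≤ k → k ≤ n → y ≠ f k) : ∃ k ≤ n, f k < y ∧ y < f (k + 1) := by
  induction n with
  | zero => exact ⟨0, le_rfl, h0, hn⟩
  | succ n ih =>
    rcases lt_or_gt_of_ne (hne (n + 1) (by omega) le_rfl) with h | h
    · obtain ⟨k, hk, h1⟩ := ih h fun k hk hk' ↦ hne k hk (by omega)
      exact ⟨k, by omega, h1⟩
    · exact ⟨n + 1, le_rfl, h, hn⟩

theorem nonpos_of_mem_closure {X : Type*} [TopologicalSpace X] {R T : Set X} {f : X → ℝ} {x : X}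
    (hf : ContinuousOn f R) (hTR : T ⊆ R) (hT : ∀ y ∈ T, f y ≤ 0) (hx : x ∈ closure T)
    (hxR : x ∈ R) : f x ≤ 0 := by
  have := mem_closure_iff_nhdsWithin_neBot.1 hx
  refine le_of_tendsto (((hf x hxR).mono hTR).tendsto) ?_
  filter_upwards [self_mem_nhdsWithin] with y hy using hT y hy

namespace IsGraphSystem

variable {C} {m : ℕ} {g : ℕ → ℝ → ℝ} {δ η : ℝ}

theorem continuousOn (h : C.IsGraphSystem p m g δ η) (k : ℕ) (h1 : 1 ≤ k) (h2 : k ≤ m) :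
    ContinuousOn (g k) (Icc 0 δ) :=
  (h.contDiffOn k h1 h2).continuousOn

theorem arc (h : C.IsGraphSystem p m g δ η) (hp : p ∈ (𝓡∂ 2).boundary M) {k : ℕ} (h1 : 1 ≤ k)
    (h2 : k ≤ m) : C.IsSingularArc p (fun t ↦ chartPoint p (δ * t) (g k (δ * t))) ∧
    (fun t ↦ chartPoint p (δ * t) (g k (δ * t))) '' Ico 0 1 =
      (fun x ↦ chartPoint p x (g k x)) '' Ico 0 δ := by
  obtain ⟨r, hr, hδ, hη⟩ := h.radius
  have h0 := h.pos_left
  have hmaps : MapsTo (fun t ↦ δ * t) (Icc 0 1) (Icc 0 δ) := fun t ht ↦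
    ⟨mul_nonneg h0.le ht.1, mul_le_of_le_one_right h0.le ht.2⟩
  have hsm : ContDiffOn ℝ 1 (fun t ↦ δ * t) (Icc 0 1) := contDiffOn_const.mul contDiffOn_id
  have hder : ∀ t ∈ Icc (0 : ℝ) 1, derivWithin (fun t ↦ δ * t) (Icc 0 1) t = δ := by
    intro t ht
    have := ((hasDerivWithinAt_id t (Icc (0 : ℝ) 1)).const_mul δ).derivWithin
      (uniqueDiffOn_Icc zero_lt_one t ht)
    simpa using this
  refine ⟨⟨isRegularArc_chartPoint hr hp hsm ((h.contDiffOn k h1 h2).comp hsm hmaps)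
    (fun t ht ↦ ⟨(hmaps ht).1, (hmaps ht).2.trans hδ⟩)
    (fun t ht ↦ (h.abs_graph_lt k h1 h2 _ (hmaps ht)).le.trans hη) (mul_zero δ)
    (by simp only [mul_zero, h.zero k h1 h2])
    (fun t ht ↦ Or.inl (by rw [hder t ht]; exact h0.ne'))
    (fun s _ t _ hst _ ↦ mul_left_cancel₀ h0.ne' hst), ?_⟩, ?_⟩
  · rintro _ ⟨t, ht, rfl⟩
    exact (h.sing _ (hmaps ht) _ (h.abs_graph_lt k h1 h2 _ (hmaps ht))).2 ⟨k, h1, h2, rfl⟩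
  · have himg : (fun t ↦ δ * t) '' Ico 0 1 = Ico 0 δ := by
      rw [image_mul_left_Ico h0, mul_zero, mul_one]
    rw [← himg, image_image]

theorem bound_continuousOn (h : C.IsGraphSystem p m g δ η) (k : ℕ) :
    ContinuousOn (graphBound m g η k) (Icc 0 δ) := by
  unfold graphBound
  by_cases h0 : k = 0
  · simp only [h0, if_true]; exact continuousOn_const
  · by_cases h1 : k ≤ m
    · simp only [h0, h1, if_true, if_false]
      exact h.continuousOn k (by omega) h1
    · simp only [h0, h1, if_false]; exact continuousOn_const

theorem abs_bound_le (h : C.IsGraphSystem p m g δ η) (k : ℕ) {x : ℝ} (hx : x ∈ Icc 0 δ) :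
    |graphBound m g η k x| ≤ η := by
  unfold graphBound
  have := h.pos_right
  split_ifs with h0 h1
  · rw [abs_neg, abs_of_pos this]
  · exact (h.abs_graph_lt k (by omega) h1 x hx).le
  · rw [abs_of_pos this]

theorem bound_lt (h : C.IsGraphSystem p m g δ η) {j k : ℕ} (hjk : j < k) (hk : k ≤ m + 1) {x : ℝ}
    (hx : x ∈ Ioc 0 δ) : graphBound m g η j x < graphBound m g η k x := by
  have hη := h.pos_right
  have hx' : x ∈ Icc 0 δ := Ioc_subset_Icc_self hx
  have hab := fun i hi hi' ↦ abs_lt.1 (h.abs_graph_lt i hi hi' x hx')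
  unfold graphBound
  have hk0 : k ≠ 0 := by omega
  rw [if_neg hk0]
  by_cases hj0 : j = 0
  · rw [if_pos hj0]
    split_ifs with h1
    · exact (hab k (by omega) h1).1
    · linarith
  · rw [if_neg hj0, if_pos (show j ≤ m by omega)]
    split_ifs with h1
    · exact h.lt j k (by omega) hjk h1 x hx
    · exact (hab j (by omega) (by omega)).2

theorem bound_le (h : C.IsGraphSystem p m g δ η) {j k : ℕ} (hjk : j < k) (hk : k ≤ m + 1) {x : ℝ}
    (hx : x ∈ Icc 0 δ) : graphBound m g η j x ≤ graphBound m g η k x := by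
  rcases hx.1.eq_or_lt with h0 | h0
  · have hη := h.pos_right
    unfold graphBound
    rw [← h0]
    split_ifs with a1 a2 a3 a4 a5 a6
    · exact le_rfl
    · rw [h.zero k (by omega) a3]; linarith
    · linarith
    · omega
    · rw [h.zero k (by omega) a6, h.zero j (by omega) a4]
    · rw [h.zero j (by omega) a4]; exact hη.le
    · omega
    · omega
    · exact le_rfl
  · exact (h.bound_lt hjk hk ⟨h0, hx.2⟩).le

theorem continuousOn_bound_chartFst (h : C.IsGraphSystem p m g δ η) (k : ℕ) :
    ContinuousOn (fun q ↦ graphBound m g η k (chartFst p q)) (chartBox p δ η) :=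
  (h.bound_continuousOn k).comp ((continuousOn_chartFst p).mono fun _ hq ↦ hq.1)
    fun _ hq ↦ chartFst_mem_Icc hq

theorem mem_singularSet_iff (h : C.IsGraphSystem p m g δ η) (hq : q ∈ chartBox p δ η) :
    q ∈ C.singularSet ↔ ∃ k, 1 ≤ k ∧ k ≤ m ∧ chartSnd p q = g k (chartFst p q) := by
  rw [← h.sing _ ⟨chartFst_nonneg hq.1, hq.2.1.le⟩ _ hq.2.2, chartPoint_chartFst_chartSnd hq.1]

theorem isOpen_sector (h : C.IsGraphSystem p m g δ η) (k : ℕ) :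
    IsOpen (graphSector p m g δ η k) := by
  have h1 := continuousOn_fst_chartBox.isOpen_inter_preimage
    (isOpen_chartBox (p := p) (δ := δ) (η := η)) (isOpen_Ioi (a := (0 : ℝ)))
  have h2 := ((continuousOn_snd_chartBox (p := p)).sub
    (h.continuousOn_bound_chartFst k)).isOpen_inter_preimage isOpen_chartBox
    (isOpen_Ioi (a := (0 : ℝ)))
  have h3 := ((h.continuousOn_bound_chartFst (k + 1)).sub
    (continuousOn_snd_chartBox (p := p))).isOpen_inter_preimage isOpen_chartBox
    (isOpen_Ioi (a := (0 : ℝ)))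
  convert (h1.inter h2).inter h3 using 1
  ext q
  simp only [graphSector, mem_inter_iff, mem_preimage, mem_Ioi, Pi.sub_apply, sub_pos]
  constructor
  · rintro ⟨a, b, c, d⟩; exact ⟨⟨⟨a, b⟩, a, c⟩, a, d⟩
  · rintro ⟨⟨⟨a, b⟩, -, c⟩, -, d⟩; exact ⟨a, b, c, d⟩

/-- The interpolation between two consecutive graphs, on a closed rectangle. -/
theorem continuousOn_sweep (h : C.IsGraphSystem p m g δ η) (k : ℕ) :
    ContinuousOn (fun z : ℝ × ℝ ↦ chartPoint p z.1 (graphBound m g η k z.1 +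
      z.2 * (graphBound m g η (k + 1) z.1 - graphBound m g η k z.1))) (Icc 0 δ ×ˢ Icc 0 1) := by
  obtain ⟨r, hr, hδ, hη⟩ := h.radius
  have hc : ∀ j, ContinuousOn (fun z : ℝ × ℝ ↦ graphBound m g η j z.1) (Icc 0 δ ×ˢ Icc 0 1) :=
    fun j ↦ (h.bound_continuousOn j).comp continuousOn_fst fun _ hz ↦ hz.1
  refine (continuousOn_chartPoint hr).comp (continuousOn_fst.prodMk
    ((hc k).add (continuousOn_snd.mul ((hc (k + 1)).sub (hc k))))) ?_
  rintro ⟨x, θ⟩ ⟨hx, hθ⟩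
  have h1 := abs_le.1 (h.abs_bound_le k hx)
  have h2 := abs_le.1 (h.abs_bound_le (k + 1) hx)
  simp only [mem_Icc] at hθ
  refine ⟨⟨hx.1, hx.2.trans hδ⟩, ?_, ?_⟩
  · change -r ≤ graphBound m g η k x + θ * (graphBound m g η (k + 1) x - graphBound m g η k x)
    nlinarith
  · change graphBound m g η k x + θ * (graphBound m g η (k + 1) x - graphBound m g η k x) ≤ r
    nlinarith

/-- A sector is the image of an open rectangle under an interpolation between its two graphs. -/
theorem sector_eq_image (h : C.IsGraphSystem p m g δ η) {k : ℕ} (hk : k ≤ m) :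
    graphSector p m g δ η k = (fun z : ℝ × ℝ ↦ chartPoint p z.1 (graphBound m g η k z.1 +
      z.2 * (graphBound m g η (k + 1) z.1 - graphBound m g η k z.1))) '' (Ioo 0 δ ×ˢ Ioo 0 1) := by
  obtain ⟨r, hr, hδ, hη⟩ := h.radius
  ext q
  constructor
  · rintro ⟨hq, h0, h1, h2⟩
    have h3 : 0 < graphBound m g η (k + 1) (chartFst p q) - graphBound m g η k (chartFst p q) := by
      linarith
    refine ⟨(chartFst p q, (chartSnd p q - graphBound m g η k (chartFst p q)) /
      (graphBound m g η (k + 1) (chartFst p q) - graphBound m g η k (chartFst p q))),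
      ⟨⟨h0, hq.2.1⟩, div_pos (by linarith) h3, by rw [div_lt_one h3]; linarith⟩, ?_⟩
    simp only
    rw [div_mul_cancel₀ _ h3.ne', add_sub_cancel]
    exact chartPoint_chartFst_chartSnd hq.1
  · rintro ⟨⟨x, θ⟩, ⟨hx, hθ⟩, rfl⟩
    simp only [mem_Ioo] at hx hθ ⊢
    have hx' : x ∈ Ioc 0 δ := ⟨hx.1, hx.2.le⟩
    have h0 := h.bound_lt (Nat.lt_succ_self k) (by omega) hx'
    have h1 := abs_le.1 (h.abs_bound_le k (Ioc_subset_Icc_self hx'))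
    have h2 := abs_le.1 (h.abs_bound_le (k + 1) (Ioc_subset_Icc_self hx'))
    simp only [Nat.succ_eq_add_one] at h0
    have h3 : graphBound m g η k x < graphBound m g η k x +
        θ * (graphBound m g η (k + 1) x - graphBound m g η k x) := by nlinarith
    have h4 : graphBound m g η k x + θ * (graphBound m g η (k + 1) x - graphBound m g η k x) <
        graphBound m g η (k + 1) x := by nlinarith
    have h5 : |graphBound m g η k x +
        θ * (graphBound m g η (k + 1) x - graphBound m g η k x)| < η :=
      _root_.abs_lt.2 ⟨by linarith, by linarith⟩
    refine ⟨chartPoint_mem_chartBox hr hδ hη hx.1.le hx.2 h5, ?_⟩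
    rw [hr.chartFst_chartPoint hx.1.le (hx.2.le.trans hδ) (h5.le.trans hη),
      hr.chartSnd_chartPoint hx.1.le (hx.2.le.trans hδ) (h5.le.trans hη)]
    exact ⟨hx.1, h3, h4⟩

theorem mem_closure_sector_iff (h : C.IsGraphSystem p m g δ η) {k : ℕ} (hk : k ≤ m)
    (hq : q ∈ chartBox p δ η) : q ∈ closure (graphSector p m g δ η k) ↔
      graphBound m g η k (chartFst p q) ≤ chartSnd p q ∧
      chartSnd p q ≤ graphBound m g η (k + 1) (chartFst p q) := by
  constructor
  · intro hc
    have hsub : graphSector p m g δ η k ⊆ chartBox p δ η := fun q hq ↦ hq.1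
    have h2 := continuousOn_snd_chartBox (p := p) (δ := δ) (η := η)
    have h3 := nonpos_of_mem_closure ((h.continuousOn_bound_chartFst k).sub h2) hsub
      (fun y hy ↦ sub_nonpos.2 hy.2.2.1.le) hc hq
    have h4 := nonpos_of_mem_closure (h2.sub (h.continuousOn_bound_chartFst (k + 1))) hsub
      (fun y hy ↦ sub_nonpos.2 hy.2.2.2.le) hc hq
    exact ⟨sub_nonpos.1 h3, sub_nonpos.1 h4⟩
  · rintro ⟨h1, h2⟩
    obtain ⟨θ, hθ, hy⟩ : ∃ θ ∈ Icc (0 : ℝ) 1, chartSnd p q = graphBound m g η k (chartFst p q) +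
        θ * (graphBound m g η (k + 1) (chartFst p q) - graphBound m g η k (chartFst p q)) := by
      rcases (h1.trans h2).eq_or_lt with h3 | h3
      · exact ⟨0, by simp, by linarith⟩
      · have h4 : 0 < graphBound m g η (k + 1) (chartFst p q) -
            graphBound m g η k (chartFst p q) := by linarith
        refine ⟨(chartSnd p q - graphBound m g η k (chartFst p q)) /
          (graphBound m g η (k + 1) (chartFst p q) - graphBound m g η k (chartFst p q)),
          ⟨div_nonneg (by linarith) h4.le, by rw [div_le_one h4]; linarith⟩, ?_⟩
        rw [div_mul_cancel₀ _ h4.ne', add_sub_cancel]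
    have hmem : (chartFst p q, θ) ∈ closure (Ioo (0 : ℝ) δ ×ˢ Ioo (0 : ℝ) 1) := by
      rw [closure_prod_eq, closure_Ioo h.pos_left.ne, closure_Ioo zero_ne_one]
      exact ⟨chartFst_mem_Icc hq, hθ⟩
    have hcont := ((h.continuousOn_sweep k) (chartFst p q, θ) ⟨chartFst_mem_Icc hq, hθ⟩).mono
      (prod_mono Ioo_subset_Icc_self Ioo_subset_Icc_self)
    have h5 := hcont.mem_closure_image hmem
    simp only at h5
    rw [← h.sector_eq_image hk, ← hy, chartPoint_chartFst_chartSnd hq.1] at h5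
    exact h5

theorem isConnected_sector (h : C.IsGraphSystem p m g δ η) {k : ℕ} (hk : k ≤ m) :
    IsConnected (graphSector p m g δ η k) := by
  rw [h.sector_eq_image hk]
  refine ⟨(Nonempty.prod (nonempty_Ioo.2 h.pos_left) (nonempty_Ioo.2 zero_lt_one)).image _, ?_⟩
  exact (isPreconnected_Ioo.prod isPreconnected_Ioo).image _ ((h.continuousOn_sweep k).mono
    (prod_mono Ioo_subset_Icc_self Ioo_subset_Icc_self))

/-- The part of the closure of a sector outside the sector consists of its two bounding arcs. -/
theorem mem_arc_union_iff (h : C.IsGraphSystem p m g δ η) {k : ℕ} (hk : k ≤ m)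
    (hq : q ∈ chartBox p δ η) :
    q ∈ graphArc p m g δ η k ∪ graphArc p m g δ η (k + 1) ↔
      (graphBound m g η k (chartFst p q) ≤ chartSnd p q ∧
      chartSnd p q ≤ graphBound m g η (k + 1) (chartFst p q)) ∧ q ∉ graphSector p m g δ η k := by
  have hm := h.one_le
  have hx := chartFst_mem_Icc hq
  have hy := abs_lt.1 hq.2.2
  have hle := h.bound_le (Nat.lt_succ_self k) (by omega) hx
  have hb0 : graphBound m g η 0 (chartFst p q) = -η := if_pos rfl
  have hb1 : graphBound m g η (m + 1) (chartFst p q) = η := by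
    unfold graphBound; rw [if_neg (by omega), if_neg (by omega)]
  have hbk : ∀ j, 1 ≤ j → j ≤ m → graphBound m g η j (chartFst p q) = g j (chartFst p q) := by
    intro j h1 h2; unfold graphBound; rw [if_neg (by omega), if_pos h2]
  constructor
  · rintro (⟨-, h1, h2, h3⟩ | ⟨-, h1, h2, h3⟩)
    · rcases Nat.eq_zero_or_pos k with h0 | h0
      · obtain ⟨hx0, hy0⟩ := h1 h0
        subst h0
        refine ⟨⟨by rw [hb0]; exact hy.1.le, ?_⟩, fun hS ↦ hS.2.1.ne' hx0⟩
        rw [hbk _ le_rfl hm, hx0, h.zero _ le_rfl hm]; exact hy0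
      · have e := h2 h0 hk
        rw [← hbk k h0 hk] at e
        exact ⟨⟨e.symm.le, e.trans_le hle⟩, fun hS ↦ hS.2.2.1.ne' e⟩
    · rcases hk.eq_or_lt with h0 | h0
      · obtain ⟨hx0, hy0⟩ := h3 (by omega)
        subst h0
        refine ⟨⟨?_, by rw [hb1]; exact hy.2.le⟩, fun hS ↦ hS.2.1.ne' hx0⟩
        rw [hbk _ hm le_rfl, hx0, h.zero _ hm le_rfl]; exact hy0
      · have e := h2 (by omega) (by omega)
        rw [← hbk (k + 1) (by omega) (by omega)] at e
        exact ⟨⟨hle.trans e.symm.le, e.le⟩, fun hS ↦ hS.2.2.2.ne e⟩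
  · rintro ⟨⟨h1, h2⟩, h3⟩
    have hcase : chartFst p q = 0 ∨ chartSnd p q = graphBound m g η k (chartFst p q) ∨
        chartSnd p q = graphBound m g η (k + 1) (chartFst p q) := by
      by_contra hcon
      push Not at hcon
      exact h3 ⟨hq, lt_of_le_of_ne hx.1 (Ne.symm hcon.1), lt_of_le_of_ne h1 (Ne.symm hcon.2.1),
        lt_of_le_of_ne h2 hcon.2.2⟩
    rcases Nat.eq_zero_or_pos k with h0 | h0
    · subst h0
      rw [hb0] at hcase
      rw [zero_add, hbk 1 le_rfl hm] at hcase h2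
      rcases hcase with e | e | e
      · left
        rw [e, h.zero 1 le_rfl hm] at h2
        exact ⟨hq, fun _ ↦ ⟨e, h2⟩, fun h' ↦ by omega, fun h' ↦ by omega⟩
      · linarith
      · right
        exact ⟨hq, fun h' ↦ by omega, fun _ _ ↦ e, fun h' ↦ by omega⟩
    · rw [hbk k h0 hk] at hcase h1
      rcases hk.eq_or_lt with hkm | hkm
      · subst hkm
        rw [hb1] at hcase
        rcases hcase with e | e | e
        · right
          rw [e, h.zero k h0 hk] at h1
          exact ⟨hq, fun h' ↦ by omega, fun _ h' ↦ by omega, fun _ ↦ ⟨e, h1⟩⟩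
        · left
          exact ⟨hq, fun h' ↦ by omega, fun _ _ ↦ e, fun h' ↦ by omega⟩
        · linarith
      · rw [hbk (k + 1) (by omega) (by omega)] at hcase h2
        rcases hcase with e | e | e
        · left
          refine ⟨hq, fun h' ↦ by omega, fun _ _ ↦ ?_, fun h' ↦ by omega⟩
          rw [e, h.zero k h0 hk] at h1 ⊢
          rw [e, h.zero _ (by omega) (by omega)] at h2
          exact le_antisymm h2 h1
        · left
          exact ⟨hq, fun h' ↦ by omega, fun _ _ ↦ e, fun h' ↦ by omega⟩
        · right
          exact ⟨hq, fun h' ↦ by omega, fun _ _ ↦ e, fun h' ↦ by omega⟩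

theorem exists_mem_arc (h : C.IsGraphSystem p m g δ η) (hq : q ∈ chartBox p δ η)
    (hs : q ∈ C.singularSet ∪ (𝓡∂ 2).boundary M) : ∃ k ≤ m + 1, q ∈ graphArc p m g δ η k := by
  rcases hs with hs | hs
  · obtain ⟨k, h1, h2, h3⟩ := (h.mem_singularSet_iff hq).1 hs
    exact ⟨k, by omega, hq, fun h' ↦ by omega, fun _ _ ↦ h3, fun h' ↦ by omega⟩
  · rw [mem_boundary_iff hq.1] at hs
    rcases le_total (chartSnd p q) 0 with h1 | h1
    · exact ⟨0, by omega, hq, fun _ ↦ ⟨hs, h1⟩, fun h' ↦ by omega, fun h' ↦ by omega⟩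
    · exact ⟨m + 1, by omega, hq, fun h' ↦ by omega, fun _ h' ↦ by omega, fun _ ↦ ⟨hs, h1⟩⟩

theorem diff_eq (h : C.IsGraphSystem p m g δ η) (q : M) :
    q ∈ chartBox p δ η \ (C.singularSet ∪ (𝓡∂ 2).boundary M) ↔
      ∃ k ≤ m, q ∈ graphSector p m g δ η k := by
  have hbk : ∀ j, 1 ≤ j → j ≤ m → graphBound m g η j (chartFst p q) = g j (chartFst p q) := by
    intro j h1 h2; unfold graphBound; rw [if_neg (by omega), if_pos h2]
  constructor
  · rintro ⟨hq, hs⟩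
    have hx := chartFst_mem_Icc hq
    have hy := abs_lt.1 hq.2.2
    have hx0 : 0 < chartFst p q := by
      refine lt_of_le_of_ne hx.1 fun h0 ↦ hs (Or.inr ?_)
      rw [mem_boundary_iff hq.1]; exact h0.symm
    obtain ⟨k, hk, h1, h2⟩ := exists_between_consecutive
      (f := fun k ↦ graphBound m g η k (chartFst p q)) (y := chartSnd p q) (n := m)
      (by simpa [graphBound] using hy.1) (by simpa [graphBound] using hy.2) (by
        intro k h1 h2 h3
        refine hs (Or.inl ((h.mem_singularSet_iff hq).2 ⟨k, h1, h2, ?_⟩))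
        rw [h3, hbk k h1 h2])
    exact ⟨k, hk, hq, hx0, h1, h2⟩
  · rintro ⟨k, hk, hq, hx0, h1, h2⟩
    refine ⟨hq, ?_⟩
    have hx : chartFst p q ∈ Ioc 0 δ := ⟨hx0, hq.2.1.le⟩
    rintro (hs | hs)
    · obtain ⟨j, hj1, hj2, hj3⟩ := (h.mem_singularSet_iff hq).1 hs
      rw [← hbk j hj1 hj2] at hj3
      rcases lt_trichotomy j k with hjk | hjk | hjk
      · have := h.bound_lt hjk (by omega) hx
        linarith
      · subst hjk; linarith
      · rcases (Nat.succ_le_of_lt hjk).eq_or_lt with hjk' | hjk'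
        · rw [Nat.succ_eq_add_one] at hjk'
          rw [hjk'] at h2; linarith
        · have := h.bound_lt hjk' (by omega) hx
          simp only [Nat.succ_eq_add_one] at this
          linarith
    · rw [mem_boundary_iff hq.1] at hs
      exact hx0.ne' hs

theorem self_mem_arc (h : C.IsGraphSystem p m g δ η) (hp : p ∈ (𝓡∂ 2).boundary M) (k : ℕ) :
    p ∈ graphArc p m g δ η k := by
  refine ⟨mem_chartBox_self hp h.pos_left h.pos_right, fun _ ↦ ⟨chartFst_self hp, ?_⟩,
    fun h1 h2 ↦ ?_, fun _ ↦ ⟨chartFst_self hp, ?_⟩⟩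
  · rw [chartSnd_self]
  · rw [chartSnd_self, chartFst_self hp, h.zero k h1 h2]
  · rw [chartSnd_self]

theorem arc_inter (h : C.IsGraphSystem p m g δ η) (hp : p ∈ (𝓡∂ 2).boundary M) {j k : ℕ}
    (hjk : j < k) (hk : k ≤ m + 1) : graphArc p m g δ η j ∩ graphArc p m g δ η k = {p} := by
  refine Subset.antisymm ?_ (singleton_subset_iff.2 ⟨h.self_mem_arc hp j, h.self_mem_arc hp k⟩)
  rintro q ⟨⟨hq, a1, a2, a3⟩, -, b1, b2, b3⟩
  refine eq_of_chart_eq_zero hp hq ?_ ?_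
  · by_cases hj : j = 0
    · exact (a1 hj).1
    by_cases hkm : k ≤ m
    · have e1 := a2 (by omega) (by omega)
      have e2 := b2 (by omega) hkm
      by_contra hne
      have := h.lt j k (by omega) hjk hkm (chartFst p q)
        ⟨lt_of_le_of_ne (chartFst_mem_Icc hq).1 (Ne.symm hne), (chartFst_mem_Icc hq).2⟩
      linarith
    · exact (b3 (by omega)).1
  · by_cases hj : j = 0
    · by_cases hkm : k ≤ m
      · rw [b2 (by omega) hkm, (a1 hj).1, h.zero k (by omega) hkm]
      · exact le_antisymm (a1 hj).2 (b3 (by omega)).2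
    · by_cases hkm : k ≤ m
      · have e1 := a2 (by omega) (by omega)
        have e2 := b2 (by omega) hkm
        have hx0 : chartFst p q = 0 := by
          by_contra hne
          have := h.lt j k (by omega) hjk hkm (chartFst p q)
            ⟨lt_of_le_of_ne (chartFst_mem_Icc hq).1 (Ne.symm hne), (chartFst_mem_Icc hq).2⟩
          linarith
        rw [e1, hx0, h.zero j (by omega) (by omega)]
      · rw [a2 (by omega) (by omega), (b3 (by omega)).1, h.zero j (by omega) (by omega)]

/-- The arcs are closed in the box. -/
theorem mem_arc_of_mem_closure (h : C.IsGraphSystem p m g δ η) {k : ℕ}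
    (hq : q ∈ chartBox p δ η) (hc : q ∈ closure (graphArc p m g δ η k)) :
    q ∈ graphArc p m g δ η k := by
  have hsub : graphArc p m g δ η k ⊆ chartBox p δ η := fun q hq ↦ hq.1
  have h1 := continuousOn_fst_chartBox (p := p) (δ := δ) (η := η)
  have h2 := continuousOn_snd_chartBox (p := p) (δ := δ) (η := η)
  refine ⟨hq, fun h0 ↦ ⟨le_antisymm ?_ (chartFst_mem_Icc hq).1, ?_⟩, fun h0 h0' ↦ ?_,
    fun h0 ↦ ⟨le_antisymm ?_ (chartFst_mem_Icc hq).1, ?_⟩⟩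
  · exact nonpos_of_mem_closure h1 hsub (fun y hy ↦ (hy.2.1 h0).1.le) hc hq
  · exact nonpos_of_mem_closure h2 hsub (fun y hy ↦ (hy.2.1 h0).2) hc hq
  · have hbk : ∀ x, graphBound m g η k x = g k x := by
      intro x; unfold graphBound; rw [if_neg (by omega), if_pos h0']
    have h3 := h.continuousOn_bound_chartFst k
    have h4 := nonpos_of_mem_closure (h2.sub h3) hsub
      (fun y hy ↦ by simp only [Pi.sub_apply, hbk, hy.2.2.1 h0 h0']; simp) hc hq
    have h5 := nonpos_of_mem_closure (h3.sub h2) hsub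
      (fun y hy ↦ by simp only [Pi.sub_apply, hbk, hy.2.2.1 h0 h0']; simp) hc hq
    simp only [Pi.sub_apply, hbk] at h4 h5
    linarith
  · exact nonpos_of_mem_closure h1 hsub (fun y hy ↦ (hy.2.2.2 h0).1.le) hc hq
  · have := nonpos_of_mem_closure h2.neg hsub (fun y hy ↦ by
      simpa using (hy.2.2.2 h0).2) hc hq
    simpa using this

/-- Near `p`, a curve in `Σ ∪ ∂M` emanating from `p` stays in one of the arcs, by connectedness. -/
theorem exists_germ (h : C.IsGraphSystem p m g δ η) (hp : p ∈ (𝓡∂ 2).boundary M) {γ : ℝ → M}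
    (hγ : C.IsSingularArc p γ ∨ IsBoundaryArc p γ) :
    ∃ k ≤ m + 1, ∀ᶠ t in 𝓝[>] (0 : ℝ), γ t ∈ graphArc p m g δ η k := by
  have hreg : IsRegularArc p γ := hγ.elim And.left And.left
  have hsub : ∀ t ∈ Icc (0 : ℝ) 1, γ t ∈ C.singularSet ∪ (𝓡∂ 2).boundary M := fun t ht ↦
    hγ.elim (fun h ↦ Or.inl (h.2 ⟨t, ht, rfl⟩)) (fun h ↦ Or.inr (h.2 ⟨t, ht, rfl⟩))
  have hev : ∀ᶠ t in 𝓝[>] (0 : ℝ), t < 1 ∧ γ t ∈ chartBox p δ η := by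
    filter_upwards [Ioo_mem_nhdsGT (zero_lt_one' ℝ),
      hreg.tendsto (isOpen_chartBox.mem_nhds (mem_chartBox_self hp h.pos_left h.pos_right))]
      with t ht1 ht2 using ⟨ht1.2, ht2⟩
  obtain ⟨ε, hε, hεA⟩ := mem_nhdsGT_iff_exists_Ioo_subset.1 hev
  have hε' : (0 : ℝ) < ε := hε
  have hT : IsPreconnected (γ '' Ioo 0 ε) := isPreconnected_Ioo.image _
    (hreg.continuousOn.mono fun t ht ↦ ⟨ht.1.le, (hεA ht).1.le⟩)
  have hTA : ∀ q ∈ γ '' Ioo 0 ε, q ∈ chartBox p δ η ∧ q ≠ p ∧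
      ∃ k ≤ m + 1, q ∈ graphArc p m g δ η k := by
    rintro _ ⟨t, ht, rfl⟩
    exact ⟨(hεA ht).2, hreg.ne ht.1 (hεA ht).1.le,
      h.exists_mem_arc (hεA ht).2 (hsub t ⟨ht.1.le, (hεA ht).1.le⟩)⟩
  have hmid : γ (ε / 2) ∈ γ '' Ioo 0 ε := ⟨ε / 2, ⟨by linarith, by linarith⟩, rfl⟩
  obtain ⟨-, hne, k, hk, hkA⟩ := hTA _ hmid
  refine ⟨k, hk, ?_⟩
  have hdisj : ∀ q ∈ γ '' Ioo 0 ε, ∀ i ≤ m + 1, ∀ j ≤ m + 1, i ≠ j →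
      q ∈ closure (graphArc p m g δ η i) → q ∈ closure (graphArc p m g δ η j) → False := by
    intro q hq i hi j hj hij h1 h2
    obtain ⟨a1, a2, -⟩ := hTA q hq
    have h3 : q ∈ graphArc p m g δ η i ∩ graphArc p m g δ η j :=
      ⟨h.mem_arc_of_mem_closure a1 h1, h.mem_arc_of_mem_closure a1 h2⟩
    rcases lt_or_gt_of_ne hij with h4 | h4
    · rw [h.arc_inter hp h4 hj] at h3; exact a2 h3
    · rw [inter_comm, h.arc_inter hp h4 hi] at h3; exact a2 h3
  have hcl : IsClosed (⋃ j ∈ {j | j ≤ m + 1 ∧ j ≠ k}, closure (graphArc p m g δ η j)) :=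
    ((finite_Iic (m + 1)).subset fun j hj ↦ hj.1).isClosed_biUnion fun j _ ↦ isClosed_closure
  have hcov : γ '' Ioo 0 ε ⊆ closure (graphArc p m g δ η k) ∪
      ⋃ j ∈ {j | j ≤ m + 1 ∧ j ≠ k}, closure (graphArc p m g δ η j) := by
    intro q hq
    obtain ⟨-, -, j, hj, hj'⟩ := hTA q hq
    by_cases hjk : j = k
    · left; rw [← hjk]; exact subset_closure hj'
    · right; exact mem_iUnion₂.2 ⟨j, ⟨hj, hjk⟩, subset_closure hj'⟩
  have hemp : γ '' Ioo 0 ε ∩ (closure (graphArc p m g δ η k) ∩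
      ⋃ j ∈ {j | j ≤ m + 1 ∧ j ≠ k}, closure (graphArc p m g δ η j)) = ∅ := by
    rw [eq_empty_iff_forall_notMem]
    rintro q ⟨hq, hqk, hqj⟩
    obtain ⟨j, hj, hj'⟩ := mem_iUnion₂.1 hqj
    exact hdisj q hq k hk j hj.1 (Ne.symm hj.2) hqk hj'
  rcases isPreconnected_iff_subset_of_disjoint_closed.1 hT
    _ _ isClosed_closure hcl hcov hemp with h1 | h1
  · filter_upwards [Ioo_mem_nhdsGT hε'] with t ht
    have ht' : γ t ∈ γ '' Ioo 0 ε := ⟨t, ht, rfl⟩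
    exact h.mem_arc_of_mem_closure (hTA _ ht').1 (h1 ht')
  · exfalso
    obtain ⟨j, hj, hj'⟩ := mem_iUnion₂.1 (h1 hmid)
    exact hdisj _ hmid k hk j hj.1 (Ne.symm hj.2) (subset_closure hkA) hj'

/-- The two halves `c = η` and `c = -η` of the boundary in the box are arcs emanating from `p`. -/
theorem isBoundaryArc_half (h : C.IsGraphSystem p m g δ η) (hp : p ∈ (𝓡∂ 2).boundary M) {c : ℝ}
    (hc : |c| = η) : IsBoundaryArc p (fun t ↦ chartPoint p 0 (c * t)) ∧
      (fun t ↦ chartPoint p 0 (c * t)) '' Ico 0 1 =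
        {q | q ∈ chartBox p δ η ∧ chartFst p q = 0 ∧ 0 ≤ c * chartSnd p q} := by
  obtain ⟨r, hr, hδ, hη⟩ := h.radius
  have hη0 := h.pos_right
  have hc0 : c ≠ 0 := by rintro rfl; rw [abs_zero] at hc; exact hη0.ne hc
  have hle : ∀ t ∈ Icc (0 : ℝ) 1, |c * t| ≤ r := by
    intro t ht
    rw [abs_mul, hc, abs_of_nonneg ht.1]
    nlinarith [ht.1, ht.2]
  have hder : ∀ t ∈ Icc (0 : ℝ) 1, derivWithin (fun t ↦ c * t) (Icc 0 1) t = c := by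
    intro t ht
    have := ((hasDerivWithinAt_id t (Icc (0 : ℝ) 1)).const_mul c).derivWithin
      (uniqueDiffOn_Icc zero_lt_one t ht)
    simpa using this
  refine ⟨⟨isRegularArc_chartPoint (f := fun _ ↦ 0) (g := fun t ↦ c * t) hr hp contDiffOn_const
    (contDiffOn_const.mul contDiffOn_id) (fun t ht ↦ ⟨le_rfl, hr.1.le⟩) hle rfl (mul_zero c)
    (fun t ht ↦ Or.inr (by rw [hder t ht]; exact hc0))
    (fun s hs t ht _ hst ↦ mul_left_cancel₀ hc0 hst), ?_⟩, ?_⟩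
  · rintro _ ⟨t, ht, rfl⟩
    rw [mem_boundary_iff (hr.mem_source le_rfl hr.1.le (hle t ht)),
      hr.chartFst_chartPoint le_rfl hr.1.le (hle t ht)]
  · ext q
    constructor
    · rintro ⟨t, ht, rfl⟩
      have ht' := Ico_subset_Icc_self ht
      refine ⟨chartPoint_mem_chartBox hr hδ hη le_rfl h.pos_left ?_,
        hr.chartFst_chartPoint le_rfl hr.1.le (hle t ht'), ?_⟩
      · rw [abs_mul, hc, abs_of_nonneg ht.1]
        nlinarith [ht.1, ht.2]
      · rw [hr.chartSnd_chartPoint le_rfl hr.1.le (hle t ht'), ← mul_assoc]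
        exact mul_nonneg (mul_self_nonneg c) ht.1
    · rintro ⟨h1, h2, h3⟩
      refine ⟨chartSnd p q / c, ⟨?_, ?_⟩, ?_⟩
      · have : chartSnd p q / c = c * chartSnd p q / (c * c) := by field_simp
        rw [this]
        exact div_nonneg h3 (mul_self_nonneg c)
      · refine lt_of_le_of_lt (le_abs_self _) ?_
        rw [abs_div, hc, div_lt_one hη0]
        exact h1.2.2
      · simp only
        rw [mul_div_cancel₀ _ hc0, ← h2]
        exact chartPoint_chartFst_chartSnd h1.1

/-- A graph system cuts its box into the regions between consecutive graphs. -/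
theorem isSectorDecomposition (h : C.IsGraphSystem p m g δ η) (hp : p ∈ (𝓡∂ 2).boundary M) :
    C.IsSectorDecomposition p m (chartBox p δ η) (graphSector p m g δ η) (graphArc p m g δ η) where
  isOpen := isOpen_chartBox
  mem := mem_chartBox_self hp h.pos_left h.pos_right
  one_le := h.one_le
  diff_eq := h.diff_eq
  sector_isOpen := fun k _ ↦ h.isOpen_sector k
  sector_isConnected := fun k hk ↦ h.isConnected_sector hk
  frontier_inter := by
    intro k hk
    ext q
    rw [frontier, (h.isOpen_sector k).interior_eq]
    constructor
    · rintro ⟨⟨h1, h2⟩, hq⟩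
      exact (h.mem_arc_union_iff hk hq).2 ⟨(h.mem_closure_sector_iff hk hq).1 h1, h2⟩
    · intro h1
      have hq : q ∈ chartBox p δ η := h1.elim And.left And.left
      obtain ⟨h2, h3⟩ := (h.mem_arc_union_iff hk hq).1 h1
      exact ⟨⟨(h.mem_closure_sector_iff hk hq).2 h2, h3⟩, hq⟩
  inter := by
    intro j k hj hk hjk
    rcases lt_or_gt_of_ne hjk with h1 | h1
    · exact h.arc_inter hp h1 hk
    · rw [inter_comm]; exact h.arc_inter hp h1 hj
  arc := by
    intro k hk
    have hη := h.pos_right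
    by_cases h0 : k = 0
    · obtain ⟨h1, h2⟩ := h.isBoundaryArc_half hp (c := -η) (by rw [abs_neg, abs_of_pos hη])
      refine ⟨_, h1.1, ?_, fun h' ↦ by omega, fun _ ↦ h1⟩
      rw [h2]
      ext q
      constructor
      · rintro ⟨a, b, c⟩
        exact ⟨a, fun _ ↦ ⟨b, by nlinarith⟩, fun _ ↦ by omega, fun _ ↦ by omega⟩
      · rintro ⟨a, b, -⟩
        exact ⟨a, (b h0).1, by nlinarith [(b h0).2]⟩
    by_cases hkm : k ≤ m
    · obtain ⟨h1, h2⟩ := h.arc hp (by omega) hkm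
      refine ⟨_, h1.1, ?_, fun _ _ ↦ h1, fun h' ↦ by omega⟩
      rw [h2]
      obtain ⟨r, hr, hδ, hηr⟩ := h.radius
      ext q
      constructor
      · rintro ⟨x, hx, rfl⟩
        have hx' := Ico_subset_Icc_self hx
        have hlt := h.abs_graph_lt k (by omega) hkm x hx'
        refine ⟨chartPoint_mem_chartBox hr hδ hηr hx.1 hx.2 hlt, fun _ ↦ by omega, fun _ _ ↦ ?_,
          fun _ ↦ by omega⟩
        rw [hr.chartSnd_chartPoint hx.1 (hx'.2.trans hδ) (hlt.le.trans hηr),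
          hr.chartFst_chartPoint hx.1 (hx'.2.trans hδ) (hlt.le.trans hηr)]
      · rintro ⟨a, -, b, -⟩
        refine ⟨chartFst p q, ⟨(chartFst_mem_Icc a).1, a.2.1⟩, ?_⟩
        simp only
        rw [← b (by omega) hkm, chartPoint_chartFst_chartSnd a.1]
    · obtain ⟨h1, h2⟩ := h.isBoundaryArc_half hp (c := η) (abs_of_pos hη)
      refine ⟨_, h1.1, ?_, fun _ _ ↦ by omega, fun _ ↦ h1⟩
      rw [h2]
      ext q
      constructor
      · rintro ⟨a, b, c⟩
        exact ⟨a, fun _ ↦ by omega, fun _ _ ↦ by omega, fun _ ↦ ⟨b, nonneg_of_mul_nonneg_right c hη⟩⟩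
      · rintro ⟨a, -, -, b⟩
        exact ⟨a, (b (by omega)).1, mul_nonneg hη.le (b (by omega)).2⟩
  germ := fun γ hγ ↦ h.exists_germ hp hγ

theorem exists_smaller (h : C.IsGraphSystem p m g δ η) (hp : p ∈ (𝓡∂ 2).boundary M) {V : Set M}
    (hV : V ∈ 𝓝 p) : ∃ δ' ≤ δ, ∃ η' ≤ η, C.IsGraphSystem p m g δ' η' ∧ chartBox p δ' η' ⊆ V := by
  obtain ⟨r, hr, hrV⟩ := exists_isChartRadius hp hV
  obtain ⟨R, hR, hδ, hη⟩ := h.radius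
  have hη' : 0 < min η r := lt_min h.pos_right hr.1
  have h1 : ∀ k ∈ Finset.Icc 1 m, ∀ᶠ x in 𝓝[≥] (0 : ℝ), |g k x| < min η r := by
    intro k hk
    rw [Finset.mem_Icc] at hk
    have h2 := (h.continuousOn k hk.1 hk.2).abs 0 ⟨le_rfl, h.pos_left.le⟩
    have h3 : Tendsto (fun x ↦ |g k x|) (𝓝[≥] 0) (𝓝 0) := by
      have h4 := h2.tendsto
      rw [h.zero k hk.1 hk.2, abs_zero, nhdsWithin_Icc_eq_nhdsGE h.pos_left] at h4
      exact h4
    exact h3.eventually_lt_const hη'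
  have h2 : ∀ᶠ x in 𝓝[≥] (0 : ℝ), ∀ k ∈ Finset.Icc 1 m, |g k x| < min η r :=
    (Finset.eventually_all _).2 h1
  obtain ⟨u, hu, hu'⟩ := mem_nhdsGE_iff_exists_Icc_subset.1 h2
  have hu0 : (0 : ℝ) < u := hu
  have hδ'δ : min (min δ r) u ≤ δ := (min_le_left _ _).trans (min_le_left _ _)
  have hδ'r : min (min δ r) u ≤ r := (min_le_left _ _).trans (min_le_right _ _)
  have hsub : Icc 0 (min (min δ r) u) ⊆ Icc 0 δ := Icc_subset_Icc_right hδ'δ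
  refine ⟨min (min δ r) u, hδ'δ, min η r, min_le_left _ _, ?_,
    chartBox_subset hrV hδ'r (min_le_right _ _)⟩
  exact
    { one_le := h.one_le
      pos_left := lt_min (lt_min h.pos_left hr.1) hu0
      pos_right := hη'
      radius := ⟨R, hR, hδ'δ.trans hδ, (min_le_left _ _).trans hη⟩
      contDiffOn := fun k h1 h2 ↦ (h.contDiffOn k h1 h2).mono hsub
      zero := h.zero
      abs_graph_lt := fun k h1 h2 x hx ↦ hu' ⟨hx.1, hx.2.trans (min_le_right _ _)⟩ k
        (Finset.mem_Icc.2 ⟨h1, h2⟩)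
      lt := fun j k h1 h2 h3 x hx ↦ h.lt j k h1 h2 h3 x ⟨hx.1, hx.2.trans hδ'δ⟩
      sing := fun x hx y hy ↦ h.sing x ⟨hx.1, hx.2.trans hδ'δ⟩ y (hy.trans_le (min_le_left _ _)) }

end IsGraphSystem

end CoherentTangentBundle

/-! ### Initial vectors of arcs -/

section ArcCoordinates

variable {M : Type*} [TopologicalSpace M] [ChartedSpace (EuclideanHalfSpace 2) M]
  [IsManifold (𝓡∂ 2) ∞ M] {p : M} {γ : ℝ → M}

/-- The velocity of an arc emanating from `p`, in the preferred chart at `p`: near the start its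
components `u` and `v` are the derivatives of the coordinates, and they are continuous and do not
both vanish at the start. -/
theorem IsRegularArc.exists_velocity (h : IsRegularArc p γ) :
    ∃ u v : ℝ → ℝ, Tendsto u (𝓝[>] 0) (𝓝 (u 0)) ∧ Tendsto v (𝓝[>] 0) (𝓝 (v 0)) ∧
      HasDerivWithinAt (fun s ↦ chartFst p (γ s)) (u 0) (Icc 0 1) 0 ∧
      HasDerivWithinAt (fun s ↦ chartSnd p (γ s)) (v 0) (Icc 0 1) 0 ∧
      (∀ᶠ t in 𝓝[>] (0 : ℝ), t ∈ Ioo (0 : ℝ) 1 ∧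
        γ t ∈ (chartAt (EuclideanHalfSpace 2) p).source ∧
        HasDerivAt (fun s ↦ chartFst p (γ s)) (u t) t ∧
        HasDerivAt (fun s ↦ chartSnd p (γ s)) (v t) t ∧
        velocity γ t = u t • CoherentTangentBundle.coordField p 0 (γ t) +
          v t • CoherentTangentBundle.coordField p 1 (γ t)) ∧ (u 0 ≠ 0 ∨ v 0 ≠ 0) := by
  have h0 : (0 : ℝ) ∈ Icc (0 : ℝ) 1 := by simp
  have hsrc : γ 0 ∈ (chartAt (EuclideanHalfSpace 2) p).source := by
    rw [h.start]; exact mem_chart_source _ p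
  have hev : ∀ᶠ t in 𝓝[Icc (0 : ℝ) 1] 0, γ t ∈ (chartAt (EuclideanHalfSpace 2) p).source :=
    (h.continuousOn 0 h0).preimage_mem_nhdsWithin
      ((chartAt (EuclideanHalfSpace 2) p).open_source.mem_nhds hsrc)
  have hle : 𝓝[>] (0 : ℝ) ≤ 𝓝[Icc (0 : ℝ) 1] 0 := by
    rw [← nhdsWithin_Ioc_eq_nhdsGT (zero_lt_one' ℝ)]
    exact nhdsWithin_mono _ Ioc_subset_Icc_self
  have hcd : ContDiffWithinAt ℝ 1 (fun t ↦ extChartAt (𝓡∂ 2) p (γ t)) (Icc 0 1) 0 := by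
    rw [← contMDiffWithinAt_iff_contDiffWithinAt]
    exact (contMDiffAt_extChartAt' hsrc).comp_contMDiffWithinAt 0 (h.contMDiffOn 0 h0)
  have hX : ContDiffWithinAt ℝ 1 (fun t ↦ chartFst p (γ t)) (Icc 0 1) 0 :=
    (EuclideanSpace.proj (𝕜 := ℝ) (0 : Fin 2)).contDiff.comp_contDiffWithinAt hcd
  have hY : ContDiffWithinAt ℝ 1 (fun t ↦ chartSnd p (γ t)) (Icc 0 1) 0 :=
    ((EuclideanSpace.proj (𝕜 := ℝ) (1 : Fin 2)).contDiff.comp_contDiffWithinAt hcd).sub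
      contDiffWithinAt_const
  have hlim : ∀ f : ℝ → ℝ, ContDiffWithinAt ℝ 1 f (Icc 0 1) 0 →
      Tendsto (derivWithin f (Icc 0 1)) (𝓝[>] 0) (𝓝 (derivWithin f (Icc 0 1) 0)) := by
    intro f hf
    have h1 := (hf.fderivWithin_right (m := 0) (uniqueDiffOn_Icc zero_lt_one) (by simp)
      h0).continuousWithinAt
    exact (((ContinuousLinearMap.apply ℝ ℝ (1 : ℝ)).continuous.tendsto _).comp h1).mono_left hle
  have hd : ∀ t ∈ Icc (0 : ℝ) 1, γ t ∈ (chartAt (EuclideanHalfSpace 2) p).source →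
      HasDerivWithinAt (fun s ↦ chartFst p (γ s))
        (derivWithin (fun s ↦ chartFst p (γ s)) (Icc 0 1) t) (Icc 0 1) t ∧
      HasDerivWithinAt (fun s ↦ chartSnd p (γ s))
        (derivWithin (fun s ↦ chartSnd p (γ s)) (Icc 0 1) t) (Icc 0 1) t ∧
      velocity γ t =
        derivWithin (fun s ↦ chartFst p (γ s)) (Icc 0 1) t •
          CoherentTangentBundle.coordField p 0 (γ t) +
        derivWithin (fun s ↦ chartSnd p (γ s)) (Icc 0 1) t •
          CoherentTangentBundle.coordField p 1 (γ t) := by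
    intro t ht hs
    obtain ⟨u, v, hu, hv, huv⟩ := velocity_eq (p := p)
      ((h.contMDiffOn t ht).mdifferentiableWithinAt (by simp)) hs
    rw [hu.derivWithin (uniqueDiffOn_Icc zero_lt_one t ht),
      hv.derivWithin (uniqueDiffOn_Icc zero_lt_one t ht)]
    exact ⟨hu, hv, huv⟩
  obtain ⟨a1, a2, a3⟩ := hd 0 h0 hsrc
  refine ⟨_, _, hlim _ hX, hlim _ hY, a1, a2, ?_, ?_⟩
  · filter_upwards [hle hev, Ioo_mem_nhdsGT (zero_lt_one' ℝ)] with t ht1 ht2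
    obtain ⟨b1, b2, b3⟩ := hd t (Ioo_subset_Icc_self ht2) ht1
    have hn := Icc_mem_nhds ht2.1 ht2.2
    exact ⟨ht2, ht1, b1.hasDerivAt hn, b2.hasDerivAt hn, b3⟩
  · by_contra! hcon
    refine h.regular 0 h0 ?_
    rw [a3, hcon.1, hcon.2, zero_smul, zero_smul, add_zero]

end ArcCoordinates

section TotalSpace

variable {M : Type*} [TopologicalSpace M] {E : M → Type*} [TopologicalSpace (TotalSpace Plane E)]
  [∀ x, NormedAddCommGroup (E x)] [∀ x, InnerProductSpace ℝ (E x)]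
  [FiberBundle Plane E] [VectorBundle ℝ Plane E] {p : M}

theorem tendsto_totalSpace_combination {α : Type*} {l : Filter α} {γ : α → M}
    {V W : ∀ t, E (γ t)} {v w : E p} {a b : α → ℝ} {a₀ b₀ : ℝ}
    (ha : Tendsto a l (𝓝 a₀)) (hb : Tendsto b l (𝓝 b₀))
    (hV : Tendsto (fun t ↦ TotalSpace.mk' Plane (γ t) (V t)) l (𝓝 (TotalSpace.mk' Plane p v)))
    (hW : Tendsto (fun t ↦ TotalSpace.mk' Plane (γ t) (W t)) l (𝓝 (TotalSpace.mk' Plane p w))) :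
    Tendsto (fun t ↦ TotalSpace.mk' Plane (γ t) (a t • V t + b t • W t)) l
      (𝓝 (TotalSpace.mk' Plane p (a₀ • v + b₀ • w))) := by
  have hp := FiberBundle.mem_baseSet_trivializationAt' (F := Plane) (E := E) p
  have hs : ∀ v : E p, TotalSpace.mk' Plane p v ∈ (trivializationAt Plane E p).source := fun v ↦
    (trivializationAt Plane E p).mem_source.2 hp
  have h1 := ((trivializationAt Plane E p).tendsto_nhds_iff (hs v)).1 hV
  have h2 := ((trivializationAt Plane E p).tendsto_nhds_iff (hs w)).1 hW
  refine ((trivializationAt Plane E p).tendsto_nhds_iff (hs _)).2 ⟨h1.1, ?_⟩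
  have hlin : ∀ x ∈ (trivializationAt Plane E p).baseSet, ∀ (c d : ℝ) (y z : E x),
      (trivializationAt Plane E p (TotalSpace.mk' Plane x (c • y + d • z))).2 =
        c • (trivializationAt Plane E p (TotalSpace.mk' Plane x y)).2 +
        d • (trivializationAt Plane E p (TotalSpace.mk' Plane x z)).2 := by
    intro x hx c d y z
    have := (trivializationAt Plane E p).linear ℝ hx
    exact (this.map_add _ _).trans (congrArg₂ _ (this.map_smul _ _) (this.map_smul _ _))
  have h3 := (ha.smul h1.2).add (hb.smul h2.2)
  rw [← hlin p hp] at h3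
  refine h3.congr' ?_
  have h4 : Tendsto γ l (𝓝 p) := h1.1
  filter_upwards [h4 ((trivializationAt Plane E p).open_baseSet.mem_nhds hp)] with t ht
  exact (hlin _ ht _ _ _ _).symm

theorem tendsto_totalSpace_norm [IsContinuousRiemannianBundle Plane E] {α : Type*} {l : Filter α}
    {γ : α → M} {V : ∀ t, E (γ t)} {v : E p}
    (hV : Tendsto (fun t ↦ TotalSpace.mk' Plane (γ t) (V t)) l (𝓝 (TotalSpace.mk' Plane p v))) :
    Tendsto (fun t ↦ ‖V t‖) l (𝓝 ‖v‖) := by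
  have h1 : Continuous fun x : TotalSpace Plane E ↦ (inner ℝ x.2 x.2 : ℝ) :=
    continuous_iff_continuousAt.2 fun x ↦ ContinuousAt.inner_bundle (F := Plane) (b := TotalSpace.proj)
      (v := fun x : TotalSpace Plane E ↦ x.2) (w := fun x ↦ x.2) continuousAt_id continuousAt_id
  have h2 := (h1.sqrt.tendsto (TotalSpace.mk' Plane p v)).comp hV
  simp only [Function.comp_def, real_inner_self_eq_norm_sq, Real.sqrt_sq (norm_nonneg _)] at h2
  exact h2

end TotalSpace

namespace CoherentTangentBundle

variable {M : Type*} [TopologicalSpace M]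
    [ChartedSpace (EuclideanHalfSpace 2) M] [IsManifold (𝓡∂ 2) ∞ M]
    {E : M → Type*} [TopologicalSpace (TotalSpace Plane E)]
    [∀ x, NormedAddCommGroup (E x)] [∀ x, InnerProductSpace ℝ (E x)]
    [FiberBundle Plane E] [VectorBundle ℝ Plane E]
    [ContMDiffVectorBundle ∞ Plane E (𝓡∂ 2)]
    [IsContMDiffRiemannianBundle (𝓡∂ 2) ∞ Plane E]
    (C : CoherentTangentBundle M E) {p q : M}

theorem isContinuousRiemannianBundle (_ : CoherentTangentBundle M E) :
    IsContinuousRiemannianBundle Plane E := by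
  obtain ⟨g, hg, hgi⟩ := IsContMDiffRiemannianBundle.exists_contMDiff (IB := 𝓡∂ 2) (n := ∞)
    (F := Plane) (E := E)
  exact ⟨g, hg.continuous, hgi⟩

/-- If `ψ(γ')` is a positive multiple of a field `W` with a non-zero limit, then the initial vector
of `γ` is this limit, normalized. -/
theorem isInitialVector_of_tendsto {γ : ℝ → M} {c : ℝ → ℝ} {W : ∀ t, E (γ t)} {w : E p}
    (hW : ∀ᶠ t in 𝓝[>] (0 : ℝ), 0 < c t ∧ C.psi (γ t) (velocity γ t) = c t • W t)
    (hlim : Tendsto (fun t ↦ TotalSpace.mk' Plane (γ t) (W t)) (𝓝[>] 0)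
      (𝓝 (TotalSpace.mk' Plane p w)))
    (hw : w ≠ 0) : C.IsInitialVector p γ (‖w‖⁻¹ • w) := by
  have := C.isContinuousRiemannianBundle
  have hn := tendsto_totalSpace_norm hlim
  have hn0 := norm_ne_zero_iff.2 hw
  constructor
  · have h1 := tendsto_totalSpace_combination (hn.inv₀ hn0) (tendsto_const_nhds (x := (0 : ℝ)))
      hlim hlim
    simp only [zero_smul, add_zero] at h1
    refine h1.congr' ?_
    filter_upwards [hW] with t ht
    rw [ht.2, norm_smul, Real.norm_of_nonneg ht.1.le, smul_smul, mul_inv, mul_right_comm,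
      inv_mul_cancel₀ ht.1.ne', one_mul]
  · filter_upwards [hW, hn.eventually_ne hn0] with t ht1 ht2
    rw [ht1.2]
    exact smul_ne_zero ht1.1.ne' (norm_ne_zero_iff.1 ht2)

/-- The images of the coordinate fields are continuous along an arc, at its start. -/
theorem tendsto_psi_coordField {γ : ℝ → M} (hγ : IsRegularArc p γ) (i : Fin 2) :
    Tendsto (fun t ↦ TotalSpace.mk' Plane (γ t) (C.psi (γ t) (coordField p i (γ t)))) (𝓝[>] 0)
      (𝓝 (TotalSpace.mk' Plane p (C.psi p (coordField p i p)))) := by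
  have h1 := (C.contMDiffOn_psi_coordField p i).continuousOn.continuousAt
    ((chartAt (EuclideanHalfSpace 2) p).open_source.mem_nhds (mem_chart_source _ p))
  exact h1.tendsto.comp hγ.tendsto

end CoherentTangentBundle

/-! ### The null direction along the singular set -/

theorem eventually_nhds_of_eventually_nhdsGT {a : ℝ} {P : ℝ → Prop} (h : ∀ᶠ t in 𝓝[>] a, P t) :
    ∀ᶠ t in 𝓝[>] a, ∀ᶠ s in 𝓝 t, P s := by
  filter_upwards [eventually_eventually_nhdsWithin.2 h, self_mem_nhdsWithin] with t ht hta
  rwa [isOpen_Ioi.nhdsWithin_eq hta] at ht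

namespace CoherentTangentBundle

variable {M : Type*} [TopologicalSpace M]
    [ChartedSpace (EuclideanHalfSpace 2) M] [IsManifold (𝓡∂ 2) ∞ M]
    {E : M → Type*} [TopologicalSpace (TotalSpace Plane E)]
    [∀ x, NormedAddCommGroup (E x)] [∀ x, InnerProductSpace ℝ (E x)]
    [FiberBundle Plane E] [VectorBundle ℝ Plane E]
    [ContMDiffVectorBundle ∞ Plane E (𝓡∂ 2)]
    [IsContMDiffRiemannianBundle (𝓡∂ 2) ∞ Plane E]
    (C : CoherentTangentBundle M E) {p q : M} {γ : ℝ → M}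

theorem coordField_ne_zero (hq : q ∈ (chartAt (EuclideanHalfSpace 2) p).source) (i : Fin 2) :
    coordField p i q ≠ 0 := by
  intro h
  fin_cases i
  · refine one_ne_zero (coordField_independent (a := 1) (b := 0) hq ?_).1
    rw [zero_smul, add_zero, one_smul]; exact h
  · refine one_ne_zero (coordField_independent (a := 0) (b := 1) hq ?_).2
    rw [zero_smul, zero_add, one_smul]; exact h

theorem NullDirectionTransversal.psi_coordField_ne_zero (h : C.NullDirectionTransversal p) :
    C.psi p (coordField p 1 p) ≠ 0 := by
  intro h0
  refine h _ ⟨coordField_ne_zero (mem_chart_source _ p) 1, h0⟩ ?_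
  unfold IsTangentToBoundary
  rw [coordField_self]
  simp

/-- The coefficient `A` such that `∂₀ - A ∂₁` spans the null direction at the singular points where
`ψ(∂₁) ≠ 0`. -/
def nullSlope (p q : M) : ℝ :=
  inner ℝ (C.psi q (coordField p 0 q)) (C.psi q (coordField p 1 q)) /
    inner ℝ (C.psi q (coordField p 1 q)) (C.psi q (coordField p 1 q))

theorem contMDiffAt_nullSlope (hq : q ∈ (chartAt (EuclideanHalfSpace 2) p).source)
    (hT : C.psi q (coordField p 1 q) ≠ 0) :
    ContMDiffAt (𝓡∂ 2) 𝓘(ℝ, ℝ) ∞ (C.nullSlope p) q := by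
  have h := fun i ↦ (C.contMDiffOn_psi_coordField p i).contMDiffAt
    ((chartAt (EuclideanHalfSpace 2) p).open_source.mem_nhds hq)
  exact ((h 0).inner_bundle (h 1)).div₀ ((h 1).inner_bundle (h 1)) (inner_self_ne_zero.2 hT)

/-- At a singular point the fields `ψ(∂₀)` and `ψ(∂₁)` are parallel, which is the case of equality in
the Cauchy–Schwarz inequality. -/
theorem psi_coordField_zero_eq (hq : q ∈ (chartAt (EuclideanHalfSpace 2) p).source)
    (hs : q ∈ C.singularSet) (hT : C.psi q (coordField p 1 q) ≠ 0) :
    C.psi q (coordField p 0 q) = C.nullSlope p q • C.psi q (coordField p 1 q) := by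
  have h1 := C.mu_sq_add_inner_sq q (C.psi q (coordField p 0 q)) (C.psi q (coordField p 1 q))
  have h2 : C.mu q (C.psi q (coordField p 0 q)) (C.psi q (coordField p 1 q)) = 0 :=
    (C.mem_singularSet_iff hq).1 hs
  rw [h2] at h1
  rw [← sub_eq_zero, ← norm_eq_zero, ← sq_eq_zero_iff, norm_sub_sq_real, norm_smul,
    real_inner_smul_right, mul_pow, Real.norm_eq_abs, sq_abs]
  unfold nullSlope
  rw [real_inner_self_eq_norm_sq]
  have hn : ‖C.psi q (coordField p 1 q)‖ ≠ 0 := norm_ne_zero_iff.2 hT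
  field_simp
  linarith

theorem psi_combination (hq : q ∈ (chartAt (EuclideanHalfSpace 2) p).source)
    (hs : q ∈ C.singularSet) (hT : C.psi q (coordField p 1 q) ≠ 0) (u v : ℝ) :
    C.psi q (u • coordField p 0 q + v • coordField p 1 q) =
      (u * C.nullSlope p q + v) • C.psi q (coordField p 1 q) := by
  rw [map_add, map_smul, map_smul, C.psi_coordField_zero_eq hq hs hT, smul_smul, ← add_smul]

/-- The derivative of the area density of the chart at `p` in the null direction `∂₀ - A ∂₁`. -/
def nullDeriv (p q : M) : ℝ :=
  coordDeriv p 0 (C.areaDensity p) q - C.nullSlope p q * coordDeriv p 1 (C.areaDensity p) q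

/-- Otherwise the null vector `∂₀ - A ∂₁` would be a singular direction. -/
theorem IsA2.nullDeriv_ne_zero (h : C.IsA2 q)
    (hq : q ∈ (chartAt (EuclideanHalfSpace 2) p).source)
    (hT : C.psi q (coordField p 1 q) ≠ 0) : C.nullDeriv p q ≠ 0 := by
  intro h0
  have hne : (1 : ℝ) • coordField p 0 q + (-C.nullSlope p q) • coordField p 1 q ≠ 0 := fun h1 ↦
    one_ne_zero (coordField_independent hq h1).1
  refine h.2 _ ⟨hne, Or.inl ⟨h.1, ?_⟩⟩ ⟨hne, ?_⟩
  · obtain ⟨k, hk⟩ := C.exists_dAreaDensity_eq hq h.1.1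
    rw [hk, mfderiv_combination]
    unfold nullDeriv at h0
    have : (1 : ℝ) * coordDeriv p 0 (C.areaDensity p) q +
      -C.nullSlope p q * coordDeriv p 1 (C.areaDensity p) q = 0 := by linarith
    rw [this, mul_zero]
  · rw [C.psi_combination hq h.1.1 hT, one_mul, add_neg_cancel, zero_smul]

theorem continuousAt_nullDeriv (hq : q ∈ (chartAt (EuclideanHalfSpace 2) p).source)
    (hT : C.psi q (coordField p 1 q) ≠ 0) : ContinuousAt (C.nullDeriv p) q := by
  have h := fun i ↦ continuousAt_coordDeriv hq i ((C.contMDiffAt_areaDensity hq).of_le (by simp))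
  exact (h 0).sub ((C.contMDiffAt_nullSlope hq hT).continuousAt.mul (h 1))

theorem eventually_psi_coordField_ne_zero (hT : C.psi p (coordField p 1 p) ≠ 0) :
    ∀ᶠ q in 𝓝 p, C.psi q (coordField p 1 q) ≠ 0 := by
  have hp := mem_chart_source (EuclideanHalfSpace 2) p
  have := C.isContinuousRiemannianBundle
  have h1 := tendsto_totalSpace_norm ((C.contMDiffOn_psi_coordField p 1).continuousOn.continuousAt
    ((chartAt (EuclideanHalfSpace 2) p).open_source.mem_nhds hp)).tendsto
  filter_upwards [h1.eventually_ne (norm_ne_zero_iff.2 hT)] with q hq using norm_ne_zero_iff.1 hq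

/-- Near an `A₂`-point or a peak, the null direction is transversal to the singular set at all
singular points other than `p`. -/
theorem eventually_nullDeriv_ne_zero (hA : C.IsA2 p ∨ C.IsPeak p)
    (hT : C.psi p (coordField p 1 p) ≠ 0) :
    ∀ᶠ q in 𝓝 p, q ∈ C.singularSet → q ≠ p → C.nullDeriv p q ≠ 0 := by
  have hp := mem_chart_source (EuclideanHalfSpace 2) p
  rcases hA with h | ⟨-, -, U, hU, hpU, hA, -⟩
  · filter_upwards [(C.continuousAt_nullDeriv hp hT).eventually_ne
      (IsA2.nullDeriv_ne_zero C h hp hT)] with q hq _ _ using hq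
  · filter_upwards [hU.mem_nhds hpU, C.eventually_psi_coordField_ne_zero hT,
      (chartAt (EuclideanHalfSpace 2) p).open_source.mem_nhds hp] with q h1 h2 h3 h4 h5
    exact IsA2.nullDeriv_ne_zero C (hA q ⟨h4, h1⟩ h5) h3 h2

/-- If `ψ(γ')` is a multiple of `ψ(∂₁)` of constant sign `s`, then the initial vector is `ψ(∂₁)` up
to normalization and the sign `s`. -/
theorem isInitialVector_of_psi_velocity_eq (hT : C.psi p (coordField p 1 p) ≠ 0)
    (hγ : IsRegularArc p γ) {b : ℝ → ℝ} {s : ℝ} (hs : s = 1 ∨ s = -1)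
    (hb : ∀ᶠ t in 𝓝[>] (0 : ℝ), 0 < s * b t ∧
      C.psi (γ t) (velocity γ t) = b t • C.psi (γ t) (coordField p 1 (γ t))) :
    C.IsInitialVector p γ
      (s • ‖C.psi p (coordField p 1 p)‖⁻¹ • C.psi p (coordField p 1 p)) := by
  have hs2 : s * s = 1 := by rcases hs with rfl | rfl <;> norm_num
  have hs0 : s ≠ 0 := fun h ↦ by rw [h, mul_zero] at hs2; exact zero_ne_one hs2
  have hsn : ‖s‖ = 1 := by rcases hs with rfl | rfl <;> simp
  have h1 := tendsto_totalSpace_combination (tendsto_const_nhds (x := s))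
    (tendsto_const_nhds (x := (0 : ℝ))) (C.tendsto_psi_coordField hγ 1)
    (C.tendsto_psi_coordField hγ 1)
  simp only [zero_smul, add_zero] at h1
  have h2 := C.isInitialVector_of_tendsto (c := fun t ↦ s * b t)
    (W := fun t ↦ s • C.psi (γ t) (coordField p 1 (γ t))) ?_ h1 (smul_ne_zero hs0 hT)
  · rwa [norm_smul, hsn, one_mul, smul_comm] at h2
  · filter_upwards [hb] with t ht
    refine ⟨ht.1, ?_⟩
    rw [ht.2, smul_smul, mul_right_comm, hs2, one_mul]

/-- An arc along which the first coordinate vanishes moves in the direction `±∂₁`. -/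
theorem exists_velocity_of_chartFst_eq_zero (hp : p ∈ (𝓡∂ 2).boundary M) (hγ : IsRegularArc p γ)
    (h : ∀ᶠ t in 𝓝[>] (0 : ℝ), chartFst p (γ t) = 0) :
    ∃ v : ℝ → ℝ, Tendsto v (𝓝[>] 0) (𝓝 (v 0)) ∧ v 0 ≠ 0 ∧
      Tendsto (fun t ↦ t⁻¹ * chartSnd p (γ t)) (𝓝[>] 0) (𝓝 (v 0)) ∧
      ∀ᶠ t in 𝓝[>] (0 : ℝ), C.psi (γ t) (velocity γ t) =
        v t • C.psi (γ t) (coordField p 1 (γ t)) := by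
  obtain ⟨u, v, -, hv, hu0, hv0, hev, hne⟩ := hγ.exists_velocity
  have hle : 𝓝[Icc (0 : ℝ) 1 \ {0}] 0 = 𝓝[>] 0 := by
    rw [Icc_sdiff_left, nhdsWithin_Ioc_eq_nhdsGT zero_lt_one]
  have hsX := hasDerivWithinAt_iff_tendsto_slope.1 hu0
  have hsY := hasDerivWithinAt_iff_tendsto_slope.1 hv0
  rw [hle] at hsX hsY
  have hu : u 0 = 0 := by
    refine tendsto_nhds_unique hsX (tendsto_const_nhds.congr' ?_)
    filter_upwards [h] with t ht
    rw [slope_def_field, hγ.start, ht, chartFst_self hp, sub_self, zero_div]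
  refine ⟨v, hv, hne.resolve_left (fun h' ↦ h' hu), hsY.congr' ?_, ?_⟩
  · filter_upwards with t
    rw [slope_def_field, hγ.start, chartSnd_self, sub_zero, sub_zero, div_eq_inv_mul]
  · filter_upwards [eventually_nhds_of_eventually_nhdsGT h, hev] with t ht1 ht2
    have h1 : u t = 0 := ht2.2.2.1.unique
      ((hasDerivAt_const t (0 : ℝ)).congr_of_eventuallyEq ht1)
    rw [ht2.2.2.2.2, h1, zero_smul, zero_add, map_smul]

/-- The two halves of the boundary have opposite initial vectors if `ψ(∂₁)` does not vanish at `p`. -/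
theorem isInitialVector_of_chartFst_eq_zero (hp : p ∈ (𝓡∂ 2).boundary M)
    (hT : C.psi p (coordField p 1 p) ≠ 0) (hγ : IsRegularArc p γ) {s : ℝ} (hs : s = 1 ∨ s = -1)
    (h : ∀ᶠ t in 𝓝[>] (0 : ℝ), chartFst p (γ t) = 0 ∧ 0 ≤ s * chartSnd p (γ t)) :
    C.IsInitialVector p γ
      (s • ‖C.psi p (coordField p 1 p)‖⁻¹ • C.psi p (coordField p 1 p)) := by
  obtain ⟨v, hv, hv0, hY, hev⟩ := C.exists_velocity_of_chartFst_eq_zero hp hγ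
    (h.mono fun _ ↦ And.left)
  have hs0 : s ≠ 0 := by rcases hs with rfl | rfl <;> norm_num
  have h1 : 0 ≤ s * v 0 := by
    refine ge_of_tendsto (hY.const_mul s) ?_
    filter_upwards [h, self_mem_nhdsWithin] with t ht ht'
    have ht0 : (0 : ℝ) < t := ht'
    rw [mul_left_comm]
    exact mul_nonneg (inv_nonneg.2 ht0.le) ht.2
  have h2 : 0 < s * v 0 := lt_of_le_of_ne h1 (mul_ne_zero hs0 hv0).symm
  refine C.isInitialVector_of_psi_velocity_eq hT hγ hs (b := v) ?_
  filter_upwards [(hv.const_mul s).eventually_const_lt h2, hev] with t a b using ⟨a, b⟩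

end CoherentTangentBundle

/-! ### The angle sums when the null direction is transversal to the boundary -/

namespace CoherentTangentBundle

variable {M : Type*} [TopologicalSpace M]
    [ChartedSpace (EuclideanHalfSpace 2) M] [IsManifold (𝓡∂ 2) ∞ M]
    {E : M → Type*} [TopologicalSpace (TotalSpace Plane E)]
    [∀ x, NormedAddCommGroup (E x)] [∀ x, InnerProductSpace ℝ (E x)]
    [FiberBundle Plane E] [VectorBundle ℝ Plane E]
    [ContMDiffVectorBundle ∞ Plane E (𝓡∂ 2)]
    [IsContMDiffRiemannianBundle (𝓡∂ 2) ∞ Plane E]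
    (C : CoherentTangentBundle M E) (o : SurfaceOrientation M) {p q : M} {γ : ℝ → M}

/-- The velocity of a singular curve in coordinates; it enters the surface transversally to the
boundary. -/
theorem IsSingularArc.exists_velocity (hp : p ∈ (𝓡∂ 2).boundary M)
    (htr : C.SingularDirectionTransversal p) (hγ : C.IsSingularArc p γ) :
    ∃ u v : ℝ → ℝ, Tendsto u (𝓝[>] 0) (𝓝 (u 0)) ∧ Tendsto v (𝓝[>] 0) (𝓝 (v 0)) ∧ 0 < u 0 ∧
      ∀ᶠ t in 𝓝[>] (0 : ℝ), t ∈ Ioo (0 : ℝ) 1 ∧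
        γ t ∈ (chartAt (EuclideanHalfSpace 2) p).source ∧
        HasDerivAt (fun s ↦ chartFst p (γ s)) (u t) t ∧
        HasDerivAt (fun s ↦ chartSnd p (γ s)) (v t) t ∧
        velocity γ t = u t • coordField p 0 (γ t) + v t • coordField p 1 (γ t) := by
  obtain ⟨u, v, hu, hv, hu0, hv0, hev, -⟩ := hγ.1.exists_velocity
  have h := IsSingularArc.deriv_chartFst_pos C hp htr hγ
  rw [hu0.derivWithin (uniqueDiffOn_Icc zero_lt_one 0 (by simp))] at h
  exact ⟨u, v, hu, hv, h, hev⟩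

theorem IsSingularArc.not_eventually_chartFst_eq_zero (hp : p ∈ (𝓡∂ 2).boundary M)
    (htr : C.SingularDirectionTransversal p) (hγ : C.IsSingularArc p γ)
    (h : ∀ᶠ t in 𝓝[>] (0 : ℝ), chartFst p (γ t) = 0) : False := by
  obtain ⟨u, v, hu, -, hu0, hev⟩ := IsSingularArc.exists_velocity C hp htr hγ
  obtain ⟨t, h1, h2, h3⟩ := ((eventually_nhds_of_eventually_nhdsGT h).and
    (hev.and (hu.eventually_const_lt hu0))).exists
  have h4 : u t = 0 := h2.2.2.1.unique ((hasDerivAt_const t (0 : ℝ)).congr_of_eventuallyEq h1)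
  exact h3.ne' h4

namespace IsGraphSystem

variable {C} {m : ℕ} {g : ℕ → ℝ → ℝ} {δ η : ℝ}

theorem chartFst_pos (h : C.IsGraphSystem p m g δ η) (hp : p ∈ (𝓡∂ 2).boundary M) {k : ℕ}
    (h1 : 1 ≤ k) (h2 : k ≤ m) (hq : q ∈ graphArc p m g δ η k) (hqp : q ≠ p) :
    chartFst p q ∈ Ioo 0 δ := by
  refine ⟨lt_of_le_of_ne (chartFst_nonneg hq.1.1) fun h0 ↦ hqp ?_, hq.1.2.1⟩
  refine eq_of_chart_eq_zero hp hq.1 h0.symm ?_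
  rw [hq.2.2.1 h1 h2, ← h0, h.zero k h1 h2]

theorem hasDerivAt (h : C.IsGraphSystem p m g δ η) {k : ℕ} (h1 : 1 ≤ k) (h2 : k ≤ m) {x : ℝ}
    (hx : x ∈ Ioo 0 δ) : HasDerivAt (g k) (deriv (g k) x) x :=
  (((h.contDiffOn k h1 h2).differentiableOn (by simp)).differentiableAt
    (Icc_mem_nhds hx.1 hx.2)).hasDerivAt

theorem continuousOn_deriv (h : C.IsGraphSystem p m g δ η) {k : ℕ} (h1 : 1 ≤ k) (h2 : k ≤ m) :
    ContinuousOn (deriv (g k)) (Ioo 0 δ) :=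
  ((h.contDiffOn k h1 h2).mono Ioo_subset_Icc_self).continuousOn_deriv_of_isOpen isOpen_Ioo (by simp)

/-- A singular curve emanating from `p` follows one of the graphs. -/
theorem one_le_and_le_of_germ (hp : p ∈ (𝓡∂ 2).boundary M)
    (htr : C.SingularDirectionTransversal p) (hγ : C.IsSingularArc p γ) {k : ℕ}
    (hk : ∀ᶠ t in 𝓝[>] (0 : ℝ), γ t ∈ graphArc p m g δ η k) : 1 ≤ k ∧ k ≤ m := by
  by_contra hcon
  refine IsSingularArc.not_eventually_chartFst_eq_zero C hp htr hγ ?_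
  filter_upwards [hk] with t ht
  by_cases h0 : k = 0
  · exact (ht.2.1 h0).1
  · exact (ht.2.2.2 (by omega)).1

theorem not_isBoundaryArc (h : C.IsGraphSystem p m g δ η) (hp : p ∈ (𝓡∂ 2).boundary M)
    (hγ : IsBoundaryArc p γ) {k : ℕ} (h1 : 1 ≤ k) (h2 : k ≤ m)
    (hk : ∀ᶠ t in 𝓝[>] (0 : ℝ), γ t ∈ graphArc p m g δ η k) : False := by
  obtain ⟨t, a1, a2, a3⟩ := (hk.and (hγ.1.eventually_ne.and
    (Ioo_mem_nhdsGT (zero_lt_one' ℝ)))).exists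
  have h3 := (mem_boundary_iff a1.1.1).1 (hγ.2 ⟨t, Ioo_subset_Icc_self a3, rfl⟩)
  exact (h.chartFst_pos hp h1 h2 a1 a2).1.ne' h3

/-- `ψ` of the velocity `∂₀ + g' ∂₁` of a graph is the multiple `graphSlope` of `ψ(∂₁)`. -/
def _root_.CoherentTangentBundle.graphSlope (C : CoherentTangentBundle M E) (p : M) (f : ℝ → ℝ)
    (x : ℝ) : ℝ :=
  deriv f x + C.nullSlope p (chartPoint p x (f x))

/-- A box around `p` in which `ψ(∂₁)` does not vanish, the coefficient `nullSlope` of the null direction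
is Lipschitz in the second coordinate with constant `K`, and the null direction is transversal to the
singular set except possibly at `p`. -/
structure _root_.CoherentTangentBundle.IsTransversalBox (C : CoherentTangentBundle M E) (p : M)
    (K δ η : ℝ) : Prop where
  psi_ne_zero : ∀ q ∈ chartBox p δ η, C.psi q (coordField p 1 q) ≠ 0
  abs_coordDeriv_le : ∀ q ∈ chartBox p δ η, |coordDeriv p 1 (C.nullSlope p) q| ≤ K
  nullDeriv_ne_zero : ∀ q ∈ chartBox p δ η, q ∈ C.singularSet → q ≠ p → C.nullDeriv p q ≠ 0

theorem chartPoint_mem (h : C.IsGraphSystem p m g δ η) {x y : ℝ} (hx : x ∈ Ioo 0 δ)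
    (hy : |y| < η) : chartPoint p x y ∈ chartBox p δ η ∧ chartFst p (chartPoint p x y) = x ∧
      chartSnd p (chartPoint p x y) = y := by
  obtain ⟨r, hr, hδ, hη⟩ := h.radius
  exact ⟨chartPoint_mem_chartBox hr hδ hη hx.1.le hx.2 hy,
    hr.chartFst_chartPoint hx.1.le (hx.2.le.trans hδ) (hy.le.trans hη),
    hr.chartSnd_chartPoint hx.1.le (hx.2.le.trans hδ) (hy.le.trans hη)⟩

/-- If `graphSlope` vanished, the velocity of the graph, which annihilates the differential of the area
density, would be the null direction, contrary to the transversality of the two at `A₂`-points. -/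
theorem graphSlope_ne_zero (h : C.IsGraphSystem p m g δ η) (hp : p ∈ (𝓡∂ 2).boundary M) {K : ℝ}
    (hb : C.IsTransversalBox p K δ η) {k : ℕ} (h1 : 1 ≤ k) (h2 : k ≤ m) {x : ℝ}
    (hx : x ∈ Ioo 0 δ) : C.graphSlope p (g k) x ≠ 0 := by
  intro h0
  have hδ := h.pos_left
  obtain ⟨r, hr, hδr, hηr⟩ := h.radius
  have hg := fun y hy ↦ h.abs_graph_lt k h1 h2 y hy
  obtain ⟨a1, a2, a3⟩ := h.chartPoint_mem hx (hg x (Ioo_subset_Icc_self hx))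
  have hσ := (h.arc hp h1 h2).1
  have hx1 : δ * (x / δ) = x := mul_div_cancel₀ _ hδ.ne'
  have ht : x / δ ∈ Ioo (0 : ℝ) 1 := ⟨div_pos hx.1 hδ, (div_lt_one hδ).2 hx.2⟩
  have ht' := Ioo_subset_Icc_self ht
  have hpt : chartPoint p (δ * (x / δ)) (g k (δ * (x / δ))) = chartPoint p x (g k x) := by rw [hx1]
  have hsrc : chartPoint p (δ * (x / δ)) (g k (δ * (x / δ))) ∈
      (chartAt (EuclideanHalfSpace 2) p).source := by rw [hpt]; exact a1.1
  have hmd := C.mfderiv_areaDensity_velocity hσ.1 hσ.2 ht' hsrc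
  obtain ⟨u, v, hu, hv, huv⟩ := velocity_eq (p := p)
    ((hσ.1.contMDiffOn _ ht').mdifferentiableWithinAt (by simp)) hsrc
  have hn := Icc_mem_nhds ht.1 ht.2
  have hmaps : ∀ t ∈ Icc (0 : ℝ) 1, δ * t ∈ Icc 0 δ := fun t ht ↦
    ⟨mul_nonneg hδ.le ht.1, mul_le_of_le_one_right hδ.le ht.2⟩
  have hmul : HasDerivAt (fun t ↦ δ * t) δ (x / δ) := by
    simpa using (hasDerivAt_id (x / δ)).const_mul δ
  have hu' : u = δ := by
    refine (hu.hasDerivAt hn).unique (hmul.congr_of_eventuallyEq ?_)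
    filter_upwards [hn] with t ht
    exact hr.chartFst_chartPoint (hmaps t ht).1 ((hmaps t ht).2.trans hδr)
      ((hg _ (hmaps t ht)).le.trans hηr)
  have hv' : v = deriv (g k) x * δ := by
    have h3 := h.hasDerivAt h1 h2 hx
    refine (hv.hasDerivAt hn).unique ((h3.comp_of_eq _ hmul hx1.symm).congr_of_eventuallyEq ?_)
    filter_upwards [hn] with t ht
    exact hr.chartSnd_chartPoint (hmaps t ht).1 ((hmaps t ht).2.trans hδr)
      ((hg _ (hmaps t ht)).le.trans hηr)
  rw [huv, mfderiv_combination, hpt, hu', hv'] at hmd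
  have hne : chartPoint p x (g k x) ≠ p := by
    intro h4
    rw [h4, chartFst_self hp] at a2
    exact hx.1.ne a2
  have hs := (h.sing x (Ioo_subset_Icc_self hx) _ (hg x (Ioo_subset_Icc_self hx))).2
    ⟨k, h1, h2, rfl⟩
  refine hb.nullDeriv_ne_zero _ a1 hs hne ?_
  unfold nullDeriv
  unfold graphSlope at h0
  have h5 : deriv (g k) x = -C.nullSlope p (chartPoint p x (g k x)) := by linarith
  rw [h5] at hmd
  have h6 : δ * (coordDeriv p 0 (C.areaDensity p) (chartPoint p x (g k x)) -
    C.nullSlope p (chartPoint p x (g k x)) *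
      coordDeriv p 1 (C.areaDensity p) (chartPoint p x (g k x))) = 0 := by
    refine Eq.trans ?_ hmd
    ring
  exact (mul_eq_zero.1 h6).resolve_left hδ.ne'

theorem continuousOn_graphSlope (h : C.IsGraphSystem p m g δ η) {K : ℝ}
    (hb : C.IsTransversalBox p K δ η) {k : ℕ} (h1 : 1 ≤ k) (h2 : k ≤ m) :
    ContinuousOn (C.graphSlope p (g k)) (Ioo 0 δ) := by
  obtain ⟨r, hr, hδr, hηr⟩ := h.radius
  refine (h.continuousOn_deriv h1 h2).add ?_
  have hg := fun y hy ↦ h.abs_graph_lt k h1 h2 y hy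
  have h3 : ContinuousOn (C.nullSlope p) (chartBox p δ η) := fun q hq ↦
    (C.contMDiffAt_nullSlope hq.1 (hb.psi_ne_zero q hq)).continuousAt.continuousWithinAt
  refine h3.comp ((continuousOn_chartPoint hr).comp
    (continuousOn_id.prodMk ((h.continuousOn k h1 h2).mono Ioo_subset_Icc_self)) ?_) ?_
  · intro x hx
    exact ⟨⟨hx.1.le, hx.2.le.trans hδr⟩, abs_le.1 ((hg x (Ioo_subset_Icc_self hx)).le.trans hηr)⟩
  · exact fun x hx ↦ (h.chartPoint_mem hx (hg x (Ioo_subset_Icc_self hx))).1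

theorem graphSlope_pos_or_neg (h : C.IsGraphSystem p m g δ η) (hp : p ∈ (𝓡∂ 2).boundary M) {K : ℝ}
    (hb : C.IsTransversalBox p K δ η) {k : ℕ} (h1 : 1 ≤ k) (h2 : k ≤ m) :
    (∀ x ∈ Ioo 0 δ, 0 < C.graphSlope p (g k) x) ∨ ∀ x ∈ Ioo 0 δ, C.graphSlope p (g k) x < 0 := by
  have h3 := (isPreconnected_Ioo (a := (0 : ℝ)) (b := δ)).image _ (h.continuousOn_graphSlope hb h1 h2)
  have h4 : ∀ y ∈ C.graphSlope p (g k) '' Ioo 0 δ, y ≠ 0 := by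
    rintro _ ⟨x, hx, rfl⟩
    exact h.graphSlope_ne_zero hp hb h1 h2 hx
  rcases h3.subset_or_subset isOpen_Ioi isOpen_Iio
    (disjoint_left.2 fun y (a : (0 : ℝ) < y) (b : y < 0) ↦ lt_asymm a b)
    (fun y hy ↦ ((h4 y hy).lt_or_gt.symm : 0 < y ∨ y < 0)) with h5 | h5
  · exact Or.inl fun x hx ↦ h5 ⟨x, hx, rfl⟩
  · exact Or.inr fun x hx ↦ h5 ⟨x, hx, rfl⟩

/-- The initial vectors of the singular curves turn monotonically: if the slope of the lower of two
graphs were positive and that of the upper one negative, their distance `f` would satisfy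
`f' ≤ K f` and `f 0 = 0`. -/
theorem not_graphSlope_pos_neg (h : C.IsGraphSystem p m g δ η) {K : ℝ}
    (hb : C.IsTransversalBox p K δ η) {j k : ℕ} (h1 : 1 ≤ j) (hjk : j < k) (h2 : k ≤ m)
    (hj : ∀ x ∈ Ioo 0 δ, 0 < C.graphSlope p (g j) x)
    (hk : ∀ x ∈ Ioo 0 δ, C.graphSlope p (g k) x < 0) : False := by
  have hδ := h.pos_left
  obtain ⟨r, hr, hδr, hηr⟩ := h.radius
  have hf : ∀ x ∈ Ioo 0 δ, HasDerivAt (fun x ↦ Real.exp (-K * x) * (g k x - g j x))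
      (Real.exp (-K * x) * (deriv (g k) x - deriv (g j) x - K * (g k x - g j x))) x := by
    intro x hx
    have a1 : HasDerivAt (fun x ↦ Real.exp (-K * x)) (Real.exp (-K * x) * -K) x := by
      have := ((hasDerivAt_id x).const_mul (-K)).exp
      simpa using this
    have a2 := a1.mul ((h.hasDerivAt (by omega) h2 hx).sub (h.hasDerivAt h1 (by omega) hx))
    refine a2.congr_deriv ?_
    simp only [Pi.sub_apply]
    ring
  have hcont : ContinuousOn (fun x ↦ Real.exp (-K * x) * (g k x - g j x)) (Icc 0 δ) :=
    (Real.continuous_exp.comp (continuous_const.mul continuous_id)).continuousOn.mul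
      ((h.continuousOn k (by omega) h2).sub (h.continuousOn j h1 (by omega)))
  have hanti : AntitoneOn (fun x ↦ Real.exp (-K * x) * (g k x - g j x)) (Icc 0 δ) := by
    refine antitoneOn_of_deriv_nonpos (convex_Icc 0 δ) hcont ?_ ?_
    · rw [interior_Icc]
      exact fun x hx ↦ (hf x hx).differentiableAt.differentiableWithinAt
    · rw [interior_Icc]
      intro x hx
      rw [(hf x hx).deriv]
      refine mul_nonpos_of_nonneg_of_nonpos (Real.exp_pos _).le ?_
      have hgj := h.abs_graph_lt j h1 (by omega) x (Ioo_subset_Icc_self hx)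
      have hgk := h.abs_graph_lt k (by omega) h2 x (Ioo_subset_Icc_self hx)
      have hlt := h.lt j k h1 hjk h2 x (Ioo_subset_Ioc_self hx)
      have hlip := (convex_Ioo (-η) η).norm_image_sub_le_of_norm_hasDerivWithin_le
        (f := fun y ↦ C.nullSlope p (chartPoint p x y))
        (f' := fun y ↦ coordDeriv p 1 (C.nullSlope p) (chartPoint p x y)) (C := K)
        (fun y hy ↦ by
          have hy' := abs_lt.2 hy
          obtain ⟨b1, -, -⟩ := h.chartPoint_mem hx hy'
          exact (hasDerivAt_chartPoint_right hr hx.1.le (hx.2.le.trans hδr) (hy'.le.trans hηr)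
            ((C.contMDiffAt_nullSlope b1.1 (hb.psi_ne_zero _ b1)).mdifferentiableAt
              (by simp))).hasDerivWithinAt)
        (fun y hy ↦ hb.abs_coordDeriv_le _ (h.chartPoint_mem hx (abs_lt.2 hy)).1)
        (abs_lt.1 hgj) (abs_lt.1 hgk)
      rw [Real.norm_eq_abs, Real.norm_eq_abs, abs_of_pos (sub_pos.2 hlt)] at hlip
      have b2 := (abs_le.1 hlip).1
      have b3 := hj x hx
      have b4 := hk x hx
      unfold graphSlope at b3 b4
      linarith
  have h3 := hanti ⟨le_rfl, hδ.le⟩ ⟨hδ.le, le_rfl⟩ hδ.le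
  simp only [h.zero k (by omega) h2, h.zero j h1 (by omega), sub_self, mul_zero] at h3
  have h4 := mul_pos (Real.exp_pos (-K * δ)) (sub_pos.2 (h.lt j k h1 hjk h2 δ ⟨hδ, le_rfl⟩))
  linarith

/-- The initial vector of a singular curve following a graph is given by the sign of its slope. -/
theorem isInitialVector_of_germ (h : C.IsGraphSystem p m g δ η) (hp : p ∈ (𝓡∂ 2).boundary M)
    (htr : C.SingularDirectionTransversal p) {K : ℝ} (hb : C.IsTransversalBox p K δ η)
    (hγ : C.IsSingularArc p γ) {k : ℕ} (h1 : 1 ≤ k) (h2 : k ≤ m)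
    (hk : ∀ᶠ t in 𝓝[>] (0 : ℝ), γ t ∈ graphArc p m g δ η k) {s : ℝ} (hs : s = 1 ∨ s = -1)
    (hsk : ∀ x ∈ Ioo 0 δ, 0 < s * C.graphSlope p (g k) x) :
    C.IsInitialVector p γ
      (s • ‖C.psi p (coordField p 1 p)‖⁻¹ • C.psi p (coordField p 1 p)) := by
  obtain ⟨u, v, hu, -, hu0, hev⟩ := IsSingularArc.exists_velocity C hp htr hγ
  refine C.isInitialVector_of_psi_velocity_eq
    (hb.psi_ne_zero _ (mem_chartBox_self hp h.pos_left h.pos_right)) hγ.1 hs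
    (b := fun t ↦ u t * C.graphSlope p (g k) (chartFst p (γ t))) ?_
  filter_upwards [eventually_nhds_of_eventually_nhdsGT hk, hev, hu.eventually_const_lt hu0,
    hγ.1.eventually_ne] with t a1 a2 a3 a4
  have a5 := a1.self_of_nhds
  have hx := h.chartFst_pos hp h1 h2 a5 a4
  have hv : v t = deriv (g k) (chartFst p (γ t)) * u t := by
    refine a2.2.2.2.1.unique (((h.hasDerivAt h1 h2 hx).comp t a2.2.2.1).congr_of_eventuallyEq ?_)
    filter_upwards [a1] with y hy using hy.2.2.1 h1 h2
  constructor
  · rw [mul_left_comm]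
    exact mul_pos a3 (hsk _ hx)
  · rw [a2.2.2.2.2, C.psi_combination a2.2.1 (hγ.2 ⟨t, Ioo_subset_Icc_self a2.1, rfl⟩)
      (hb.psi_ne_zero _ a5.1), hv]
    unfold graphSlope
    rw [← a5.2.2.1 h1 h2, chartPoint_chartFst_chartSnd a2.2.1]
    congr 1
    ring

open Classical in
/-- The angle sums in terms of the initial vectors of the arcs of a graph system. -/
theorem hasAngleSums [T2Space M] (h : C.IsGraphSystem p m g δ η) (hp : p ∈ (𝓡∂ 2).boundary M)
    (Ψ : ℕ → E p)
    (hΨ : ∀ k ≤ m + 1, ∀ γ, C.IsSingularArc p γ ∨ IsBoundaryArc p γ →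
      (∀ᶠ t in 𝓝[>] (0 : ℝ), γ t ∈ graphArc p m g δ η k) → C.IsInitialVector p γ (Ψ k)) :
    C.HasAngleSums o p
      (∑ k ∈ Finset.range (m + 1), if graphSector p m g δ η k ⊆ C.positivePart o then
        Real.arccos (inner ℝ (Ψ k) (Ψ (k + 1))) else 0)
      (∑ k ∈ Finset.range (m + 1), if graphSector p m g δ η k ⊆ C.negativePart o then
        Real.arccos (inner ℝ (Ψ k) (Ψ (k + 1))) else 0) := by
  refine C.hasAngleSums_of_sectorDecomposition o (h.isSectorDecomposition hp) (fun V hV ↦ ?_)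
    (fun T ↦ C.subset_positivePart_or_negativePart o) (C.disjoint_positivePart_negativePart o) Ψ hΨ
  obtain ⟨δ', hδ, η', hη, h', hsub⟩ := h.exists_smaller hp hV
  exact ⟨_, hsub, _, _, h'.isSectorDecomposition hp, fun k _ ↦ graphSector_mono hδ hη k,
    fun k _ ↦ graphArc_mono hδ hη k⟩

end IsGraphSystem

/-- The bound `K` is an upper bound for the derivative of `nullSlope` near `p`. -/
theorem exists_isTransversalBox (hA : C.IsA2 p ∨ C.IsPeak p)
    (hT : C.psi p (coordField p 1 p) ≠ 0) :
    ∃ V ∈ 𝓝 p, ∃ K, ∀ δ η, chartBox p δ η ⊆ V → C.IsTransversalBox p K δ η := by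
  have hps := mem_chart_source (EuclideanHalfSpace 2) p
  have h1 : ∀ᶠ q in 𝓝 p, |coordDeriv p 1 (C.nullSlope p) q| <
      |coordDeriv p 1 (C.nullSlope p) p| + 1 :=
    (continuousAt_coordDeriv hps 1 ((C.contMDiffAt_nullSlope hps hT).of_le
      (by simp))).abs.eventually_lt_const (lt_add_one _)
  refine ⟨_, (C.eventually_psi_coordField_ne_zero hT).and
    (h1.and (C.eventually_nullDeriv_ne_zero hA hT)), _, fun δ η hV ↦ ⟨fun q hq ↦ (hV hq).1,
    fun q hq ↦ (hV hq).2.1.le, fun q hq ↦ (hV hq).2.2⟩⟩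

theorem exists_threshold {m : ℕ} {P : ℕ → Prop} (h0 : ¬ P 0) (hm : P (m + 1))
    (hmono : ∀ j k, j < k → k ≤ m + 1 → P j → P k) : ∃ l ≤ m, ∀ k ≤ m + 1, P k ↔ l < k := by
  classical
  have hex : ∃ k, P k := ⟨_, hm⟩
  have h1 : Nat.find hex ≠ 0 := fun h ↦ h0 (h ▸ Nat.find_spec hex)
  have h2 : Nat.find hex ≤ m + 1 := Nat.find_min' hex hm
  refine ⟨Nat.find hex - 1, by omega, fun k hk ↦ ⟨fun h ↦ ?_, fun h ↦ ?_⟩⟩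
  · have := Nat.find_min' hex h
    omega
  · rcases eq_or_lt_of_le (show Nat.find hex ≤ k by omega) with h3 | h3
    · rw [← h3]; exact Nat.find_spec hex
    · exact hmono _ _ h3 hk (Nat.find_spec hex)

/-- If the null direction is transversal to the boundary, then the initial vectors of all arcs are
`±e` for one unit vector `e`. They are `-e` for the arcs up to some number and `e` for the others,
so that exactly one sector has the angle `π` and all others have the angle `0`. -/
theorem IsGraphSystem.exists_hasAngleSums_of_nullDirectionTransversal [T2Space M] {m : ℕ}
    {g : ℕ → ℝ → ℝ} {δ η : ℝ} (h : C.IsGraphSystem p m g δ η) (hp : p ∈ (𝓡∂ 2).boundary M)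
    (htr : C.SingularDirectionTransversal p) (hA : C.IsA2 p ∨ C.IsPeak p)
    (hnull : C.NullDirectionTransversal p) :
    ∃ a b, C.HasAngleSums o p a b ∧ (a = Real.pi ∧ b = 0 ∨ a = 0 ∧ b = Real.pi) := by
  classical
  have hT := NullDirectionTransversal.psi_coordField_ne_zero C hnull
  obtain ⟨V, hV, K, hK⟩ := C.exists_isTransversalBox hA hT
  obtain ⟨δ', -, η', -, h', hsub⟩ := h.exists_smaller hp hV
  have hb := hK _ _ hsub
  clear hsub hK hV h
  set e : E p := ‖C.psi p (coordField p 1 p)‖⁻¹ • C.psi p (coordField p 1 p) with he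
  have hee : inner ℝ e e = (1 : ℝ) := by
    rw [real_inner_self_eq_norm_sq, he, norm_smul, norm_inv, norm_norm,
      inv_mul_cancel₀ (norm_ne_zero_iff.2 hT), one_pow]
  -- the arcs with initial vector `e`
  let P : ℕ → Prop := fun k ↦ m < k ∨ 1 ≤ k ∧ ∀ x ∈ Ioo 0 δ', 0 < C.graphSlope p (g k) x
  obtain ⟨l, hl, hP⟩ := exists_threshold (m := m) (P := P) (by simp [P]) (by simp [P]) (by
    intro j k hjk hk hj
    by_cases hkm : m < k
    · exact Or.inl hkm
    rcases hj with hj | ⟨hj1, hj⟩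
    · omega
    rcases h'.graphSlope_pos_or_neg hp hb (show 1 ≤ k by omega) (by omega) with h1 | h1
    · exact Or.inr ⟨by omega, h1⟩
    · exact (h'.not_graphSlope_pos_neg hb hj1 hjk (by omega) hj h1).elim)
  let s : ℕ → ℝ := fun k ↦ if l < k then 1 else -1
  have hs : ∀ k, s k = 1 ∨ s k = -1 := fun k ↦ by
    by_cases hk : l < k
    · exact Or.inl (if_pos hk)
    · exact Or.inr (if_neg hk)
  have hΨ : ∀ k ≤ m + 1, ∀ γ, C.IsSingularArc p γ ∨ IsBoundaryArc p γ →
      (∀ᶠ t in 𝓝[>] (0 : ℝ), γ t ∈ graphArc p m g δ' η' k) → C.IsInitialVector p γ (s k • e) := by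
    intro k hk γ hγ hgerm
    rcases hγ with hγ | hγ
    · obtain ⟨h1, h2⟩ := IsGraphSystem.one_le_and_le_of_germ hp htr hγ hgerm
      refine h'.isInitialVector_of_germ hp htr hb hγ h1 h2 hgerm (hs k) fun x hx ↦ ?_
      by_cases hlk : l < k
      · have h3 := (hP k hk).2 hlk
        simp only [s, if_pos hlk, one_mul]
        exact (h3.resolve_left (by omega)).2 x hx
      · simp only [s, if_neg hlk]
        rcases h'.graphSlope_pos_or_neg hp hb h1 h2 with h3 | h3
        · exact (hlk ((hP k hk).1 (Or.inr ⟨h1, h3⟩))).elim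
        · have := h3 x hx
          linarith
    · by_cases h0 : k = 0
      · refine C.isInitialVector_of_chartFst_eq_zero hp hT hγ.1 (hs k) (hgerm.mono fun t ht ↦ ?_)
        have h1 := ht.2.1 h0
        refine ⟨h1.1, ?_⟩
        simp only [s, h0, if_neg (Nat.not_lt_zero l)]
        linarith [h1.2]
      by_cases h2 : k ≤ m
      · exact (h'.not_isBoundaryArc hp hγ (by omega) h2 hgerm).elim
      · refine C.isInitialVector_of_chartFst_eq_zero hp hT hγ.1 (hs k) (hgerm.mono fun t ht ↦ ?_)
        have h1 := ht.2.2.2 (by omega)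
        refine ⟨h1.1, ?_⟩
        simp only [s, if_pos (show l < k by omega), one_mul]
        exact h1.2
  have hang : ∀ k, Real.arccos (inner ℝ (s k • e) (s (k + 1) • e)) =
      if k = l then Real.pi else 0 := by
    intro k
    rw [real_inner_smul_left, real_inner_smul_right, hee, mul_one]
    rcases lt_trichotomy k l with h1 | h1 | h1
    · simp only [s, if_neg (show ¬ l < k by omega), if_neg (show ¬ l < k + 1 by omega),
        if_neg h1.ne]
      norm_num
    · simp only [s, h1, if_neg (lt_irrefl l), if_pos (show l < l + 1 by omega), if_true]
      norm_num
    · simp only [s, if_pos h1, if_pos (show l < k + 1 by omega), if_neg h1.ne']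
      norm_num
  have hsum := h'.hasAngleSums o hp (fun k ↦ s k • e) hΨ
  simp only [hang] at hsum
  have hsingle : ∀ T : Set M, (∑ k ∈ Finset.range (m + 1),
      if graphSector p m g δ' η' k ⊆ T then if k = l then Real.pi else 0 else 0) =
      if graphSector p m g δ' η' l ⊆ T then Real.pi else 0 := by
    intro T
    rw [Finset.sum_eq_single_of_mem l (Finset.mem_range.2 (by omega))]
    · rw [if_pos rfl]
    · intro k _ hkl
      rw [if_neg hkl, ite_self]
  rw [hsingle, hsingle] at hsum
  refine ⟨_, _, hsum, ?_⟩
  have hdec := h'.isSectorDecomposition hp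
  have hconn := hdec.sector_isConnected l hl
  have hdisj : Disjoint (graphSector p m g δ' η' l) C.singularSet := disjoint_left.2 fun q hq hqs ↦
    ((hdec.diff_eq q).2 ⟨l, hl, hq⟩).2 (Or.inl hqs)
  obtain ⟨x, hx⟩ := hconn.nonempty
  have hpn : x ∈ C.positivePart o → x ∉ C.negativePart o := fun h1 ↦
    disjoint_left.1 (C.disjoint_positivePart_negativePart o) h1
  rcases C.subset_positivePart_or_negativePart o hconn.isPreconnected hdisj with h1 | h1
  · left
    exact ⟨if_pos h1, if_neg fun h2 ↦ hpn (h1 hx) (h2 hx)⟩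
  · right
    exact ⟨if_neg fun h2 ↦ hpn (h2 hx) (h1 hx), if_pos h1⟩

end CoherentTangentBundle

/-! ### The singular curve through a non-degenerate point as a graph -/

section ImplicitGraph

open CoherentTangentBundle

variable {M : Type*} [TopologicalSpace M] [ChartedSpace (EuclideanHalfSpace 2) M]
  [IsManifold (𝓡∂ 2) ∞ M] {p : M} {r : ℝ}

/-- Implicit differentiation up to the boundary: a continuous graph in the zero set of `f` has the
slope `-∂₀f / ∂₁f`. -/
theorem hasDerivWithinAt_of_implicit {f : M → ℝ} {g : ℝ → ℝ} {s : Set ℝ} {x₀ : ℝ}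
    (hr : IsChartRadius p r) (hs : s ⊆ Icc 0 r) (hx₀ : x₀ ∈ s) (hgr : ∀ x ∈ s, |g x| ≤ r)
    (hf : MDifferentiableAt (𝓡∂ 2) 𝓘(ℝ, ℝ) f (chartPoint p x₀ (g x₀)))
    (hg : ContinuousWithinAt g s x₀) (h0 : ∀ x ∈ s, f (chartPoint p x (g x)) = 0)
    (h1 : coordDeriv p 1 f (chartPoint p x₀ (g x₀)) ≠ 0) :
    HasDerivWithinAt g (-(coordDeriv p 0 f (chartPoint p x₀ (g x₀)) /
      coordDeriv p 1 f (chartPoint p x₀ (g x₀)))) s x₀ := by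
  have hsrc := hr.mem_source (hs hx₀).1 (hs hx₀).2 (hgr x₀ hx₀)
  obtain ⟨D, hD, hDi⟩ := hasFDerivWithinAt_comp_extChartAt_symm hsrc hf
  rw [hr.extChartAt_chartPoint (hs hx₀).1 (hs hx₀).2 (hgr x₀ hx₀)] at hD
  set a := coordDeriv p 0 f (chartPoint p x₀ (g x₀)) with ha
  set b := coordDeriv p 1 f (chartPoint p x₀ (g x₀)) with hb
  set c := extChartAt (𝓡∂ 2) p p 1 with hc
  have hb0 : 0 < |b| := abs_pos.2 h1
  -- the graph as a curve in the chart
  have hcurve : Tendsto (fun x ↦ (!₂[x, c + g x] : Plane)) (𝓝[s] x₀)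
      (𝓝[range (𝓡∂ 2)] !₂[x₀, c + g x₀]) := by
    refine tendsto_nhdsWithin_iff.2 ⟨?_, ?_⟩
    · exact ((continuous_planeMk c).tendsto (x₀, g x₀)).comp
        ((tendsto_nhdsWithin_of_tendsto_nhds tendsto_id).prodMk_nhds hg)
    · filter_upwards [self_mem_nhdsWithin] with x hx
      rw [range_modelWithCornersEuclideanHalfSpace]
      exact (hs hx).1
  have hdiff : ∀ x, (!₂[x, c + g x] : Plane) - !₂[x₀, c + g x₀] =
      (x - x₀) • EuclideanSpace.single 0 (1 : ℝ) + (g x - g x₀) • EuclideanSpace.single 1 (1 : ℝ) := by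
    intro x
    rw [← planeMk_eq]
    ext i; fin_cases i <;> simp
  have hlo := (hasFDerivWithinAt_iff_isLittleO.1 hD).comp_tendsto hcurve
  rw [hasDerivWithinAt_iff_isLittleO, Asymptotics.isLittleO_iff]
  intro ε hε
  -- with `e` the error, `|b| |e| ≤ ε' (|Δx| + |Δg|) ≤ ε' (B |Δx| + |e|)`
  set B : ℝ := 1 + |a / b| with hB
  have hB0 : 1 ≤ B := by rw [hB]; linarith [abs_nonneg (a / b)]
  have hε' : 0 < min (|b| / 2) (ε * |b| / (2 * B)) := by positivity
  filter_upwards [(Asymptotics.isLittleO_iff.1 hlo) hε', self_mem_nhdsWithin] with x hx hxs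
  have e0 : f (chartPoint p x (g x)) = 0 := h0 x hxs
  have e1 : f (chartPoint p x₀ (g x₀)) = 0 := h0 x₀ hx₀
  simp only [Function.comp_apply, hdiff, map_add, map_smul, hDi] at hx
  change ‖f (chartPoint p x (g x)) - f (chartPoint p x₀ (g x₀)) -
    ((x - x₀) • a + (g x - g x₀) • b)‖ ≤ _ at hx
  rw [e0, e1, sub_self, zero_sub, norm_neg, smul_eq_mul, smul_eq_mul] at hx
  rw [Real.norm_eq_abs, smul_eq_mul, Real.norm_eq_abs]
  have hn : ‖(x - x₀) • (EuclideanSpace.single 0 (1 : ℝ) : Plane) +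
      (g x - g x₀) • (EuclideanSpace.single 1 (1 : ℝ) : Plane)‖ ≤ |x - x₀| + |g x - g x₀| := by
    refine (norm_add_le _ _).trans (le_of_eq ?_)
    rw [norm_smul, norm_smul]
    simp
  set e := g x - g x₀ - (x - x₀) * -(a / b) with he
  have h2 : (x - x₀) * a + (g x - g x₀) * b = b * e := by
    rw [he]; field_simp; ring
  have h3 : |g x - g x₀| ≤ |e| + |a / b| * |x - x₀| := by
    have : g x - g x₀ = e + -(a / b) * (x - x₀) := by rw [he]; ring
    rw [this]
    refine (abs_add_le _ _).trans ?_
    rw [abs_mul, abs_neg]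
  rw [h2, Real.norm_eq_abs, abs_mul] at hx
  have h4 : |b| * |e| ≤ min (|b| / 2) (ε * |b| / (2 * B)) * (B * |x - x₀| + |e|) := by
    refine hx.trans (mul_le_mul_of_nonneg_left (hn.trans ?_) hε'.le)
    rw [hB]; linarith
  have h5 : |b| * |e| ≤ ε * |b| / (2 * B) * (B * |x - x₀|) + |b| / 2 * |e| := by
    refine h4.trans ?_
    rw [mul_add]
    exact add_le_add (mul_le_mul_of_nonneg_right (min_le_right _ _) (by positivity))
      (mul_le_mul_of_nonneg_right (min_le_left _ _) (abs_nonneg _))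
  have h6 : ε * |b| / (2 * B) * (B * |x - x₀|) = |b| / 2 * (ε * |x - x₀|) := by
    field_simp
  rw [h6] at h5
  have h7 : |b| / 2 * |e| ≤ |b| / 2 * (ε * |x - x₀|) := by linarith
  exact le_of_mul_le_mul_left h7 (by positivity)

theorem contDiffOn_of_implicit {f : M → ℝ} {g : ℝ → ℝ} {δ : ℝ} (hδ : 0 < δ)
    (hr : IsChartRadius p r) (hδr : δ ≤ r) (hgr : ∀ x ∈ Icc 0 δ, |g x| ≤ r)
    (hf : ∀ q ∈ (chartAt (EuclideanHalfSpace 2) p).source, ContMDiffAt (𝓡∂ 2) 𝓘(ℝ, ℝ) 1 f q)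
    (hg : ContinuousOn g (Icc 0 δ)) (h0 : ∀ x ∈ Icc 0 δ, f (chartPoint p x (g x)) = 0)
    (h1 : ∀ x ∈ Icc 0 δ, coordDeriv p 1 f (chartPoint p x (g x)) ≠ 0) :
    ContDiffOn ℝ 1 g (Icc 0 δ) := by
  have hs : Icc 0 δ ⊆ Icc 0 r := Icc_subset_Icc_right hδr
  have hsrc := fun x (hx : x ∈ Icc 0 δ) ↦ hr.mem_source (hs hx).1 (hs hx).2 (hgr x hx)
  have hd := fun x (hx : x ∈ Icc 0 δ) ↦ hasDerivWithinAt_of_implicit hr hs hx hgr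
    ((hf _ (hsrc x hx)).mdifferentiableAt (by simp)) (hg x hx) h0 (h1 x hx)
  refine (contDiffOn_one_iff_derivWithin (uniqueDiffOn_Icc hδ)).2
    ⟨fun x hx ↦ (hd x hx).differentiableWithinAt, ?_⟩
  have hcont : ∀ i, ContinuousOn (fun x ↦ coordDeriv p i f (chartPoint p x (g x))) (Icc 0 δ) := by
    intro i
    have h2 : ContinuousOn (coordDeriv p i f) (chartAt (EuclideanHalfSpace 2) p).source :=
      fun q hq ↦ (continuousAt_coordDeriv hq i (hf q hq)).continuousWithinAt
    refine h2.comp ((continuousOn_chartPoint hr).comp (continuousOn_id.prodMk hg) ?_) hsrc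
    exact fun x hx ↦ ⟨hs hx, abs_le.1 (hgr x hx)⟩
  refine (((hcont 0).div (hcont 1) h1).neg).congr fun x hx ↦ ?_
  exact (hd x hx).derivWithin (uniqueDiffOn_Icc hδ x hx)

end ImplicitGraph

/-- The zero set of a continuous function which is strictly increasing in the second variable, and
changes sign, is a continuous graph. -/
theorem exists_continuousOn_implicit {F : ℝ → ℝ → ℝ} {δ r : ℝ} (hr : 0 < r)
    (hx : ∀ y ∈ Icc (-r) r, ContinuousOn (fun x ↦ F x y) (Icc 0 δ))
    (hy : ∀ x ∈ Icc 0 δ, ContinuousOn (F x) (Icc (-r) r))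
    (hmono : ∀ x ∈ Icc 0 δ, StrictMonoOn (F x) (Icc (-r) r))
    (hneg : ∀ x ∈ Icc 0 δ, F x (-r) < 0) (hpos : ∀ x ∈ Icc 0 δ, 0 < F x r) :
    ∃ g : ℝ → ℝ, ContinuousOn g (Icc 0 δ) ∧ ∀ x ∈ Icc 0 δ, |g x| < r ∧
      ∀ y ∈ Icc (-r) r, (F x y = 0 ↔ y = g x) ∧ (F x y < 0 ↔ y < g x) ∧ (0 < F x y ↔ g x < y) := by
  have hex : ∀ x, ∃ y, x ∈ Icc 0 δ → y ∈ Icc (-r) r ∧ F x y = 0 := by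
    intro x
    by_cases hx : x ∈ Icc 0 δ
    · obtain ⟨y, hy, hy0⟩ := intermediate_value_Icc (by linarith) (hy x hx)
        ⟨(hneg x hx).le, (hpos x hx).le⟩
      exact ⟨y, fun _ ↦ ⟨hy, hy0⟩⟩
    · exact ⟨0, fun h ↦ (hx h).elim⟩
  choose g hg using hex
  have hlt : ∀ x ∈ Icc 0 δ, ∀ y ∈ Icc (-r) r, (F x y < 0 ↔ y < g x) ∧ (0 < F x y ↔ g x < y) := by
    intro x hx y hy
    have h1 := (hmono x hx).lt_iff_lt hy (hg x hx).1
    have h2 := (hmono x hx).lt_iff_lt (hg x hx).1 hy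
    rw [(hg x hx).2] at h1 h2
    exact ⟨h1, h2⟩
  have hbd : ∀ x ∈ Icc 0 δ, -r < g x ∧ g x < r := fun x hx ↦
    ⟨((hlt x hx (-r) ⟨le_rfl, by linarith⟩).1).1 (hneg x hx),
      ((hlt x hx r ⟨by linarith, le_rfl⟩).2).1 (hpos x hx)⟩
  refine ⟨g, fun x hx' ↦ ?_, fun x hx' ↦ ⟨abs_lt.2 (hbd x hx'), fun y hy ↦ ⟨?_, hlt x hx' y hy⟩⟩⟩
  · refine tendsto_order.2 ⟨fun c hc ↦ ?_, fun c hc ↦ ?_⟩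
    · have h1 : max c (-r) ∈ Icc (-r) r := ⟨le_max_right _ _, max_le (hc.le.trans (hbd x hx').2.le)
        (by linarith)⟩
      have h2 := ((hlt x hx' _ h1).1).2 (max_lt hc (hbd x hx').1)
      filter_upwards [(hx _ h1 x hx').eventually_lt_const h2, self_mem_nhdsWithin] with z hz hz'
      exact (le_max_left _ _).trans_lt (((hlt z hz' _ h1).1).1 hz)
    · have h1 : min c r ∈ Icc (-r) r := ⟨le_min ((hbd x hx').1.le.trans hc.le)
        (by linarith), min_le_right _ _⟩
      have h2 := ((hlt x hx' _ h1).2).2 (lt_min hc (hbd x hx').2)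
      filter_upwards [(hx _ h1 x hx').eventually_const_lt h2, self_mem_nhdsWithin] with z hz hz'
      exact (((hlt z hz' _ h1).2).1 hz).trans_le (min_le_left _ _)
  · constructor
    · intro h
      rcases lt_trichotomy y (g x) with h1 | h1 | h1
      · exact absurd h (((hlt x hx' y hy).1).2 h1).ne
      · exact h1
      · exact absurd h (((hlt x hx' y hy).2).2 h1).ne'
    · rintro rfl; exact (hg x hx').2

namespace CoherentTangentBundle

variable {M : Type*} [TopologicalSpace M]
    [ChartedSpace (EuclideanHalfSpace 2) M] [IsManifold (𝓡∂ 2) ∞ M]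
    {E : M → Type*} [TopologicalSpace (TotalSpace Plane E)]
    [∀ x, NormedAddCommGroup (E x)] [∀ x, InnerProductSpace ℝ (E x)]
    [FiberBundle Plane E] [VectorBundle ℝ Plane E]
    [ContMDiffVectorBundle ∞ Plane E (𝓡∂ 2)]
    [IsContMDiffRiemannianBundle (𝓡∂ 2) ∞ Plane E]
    (C : CoherentTangentBundle M E) {p : M}

/-- Near a non-degenerate singular point at which the singular direction is transversal to the
boundary, the singular set is a single graph, and the area density changes sign across it. -/
theorem exists_isGraphSystem_of_isNonDegenerate (hp : p ∈ (𝓡∂ 2).boundary M)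
    (htr : C.SingularDirectionTransversal p) (hnd : C.IsNonDegenerate p) :
    ∃ g δ η, C.IsGraphSystem p 1 (fun _ ↦ g) δ η ∧ ∃ a : ℝ, ∀ x ∈ Icc 0 δ, ∀ y, |y| < η →
      (y < g x → a * C.areaDensity p (chartPoint p x y) < 0) ∧
      (g x < y → 0 < a * C.areaDensity p (chartPoint p x y)) := by
  have hps := mem_chart_source (EuclideanHalfSpace 2) p
  set a := coordDeriv p 1 (C.areaDensity p) p with ha
  have ha0 : a ≠ 0 := SingularDirectionTransversal.coordDeriv_ne_zero C htr hnd
  have hcd : ∀ q ∈ (chartAt (EuclideanHalfSpace 2) p).source,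
      ContMDiffAt (𝓡∂ 2) 𝓘(ℝ, ℝ) 1 (C.areaDensity p) q := fun q hq ↦
    (C.contMDiffAt_areaDensity hq).of_le (by simp)
  have hV : ∀ᶠ q in 𝓝 p, q ∈ (chartAt (EuclideanHalfSpace 2) p).source ∧
      0 < a * coordDeriv p 1 (C.areaDensity p) q := by
    have h1 := ((continuousAt_coordDeriv hps 1 (hcd p hps)).const_mul a).eventually_const_lt
      (mul_self_pos.2 ha0)
    filter_upwards [(chartAt (EuclideanHalfSpace 2) p).open_source.mem_nhds hps, h1]
      with q b1 b2 using ⟨b1, b2⟩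
  obtain ⟨r, hr, hrV⟩ := exists_isChartRadius hp hV
  have hr0 := hr.1
  obtain ⟨F, hF⟩ : ∃ F : ℝ → ℝ → ℝ, ∀ x y, F x y = a * C.areaDensity p (chartPoint p x y) :=
    ⟨_, fun _ _ ↦ rfl⟩
  have hLc : ContinuousOn (fun z : ℝ × ℝ ↦ C.areaDensity p (chartPoint p z.1 z.2))
      (Icc 0 r ×ˢ Icc (-r) r) := by
    refine (C.contMDiffOn_areaDensity p).continuousOn.comp (continuousOn_chartPoint hr) ?_
    intro z hz
    exact (hrV z.1 z.2 hz.1.1 hz.1.2 (abs_le.2 hz.2)).1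
  have hFc : ContinuousOn (fun z : ℝ × ℝ ↦ F z.1 z.2) (Icc 0 r ×ˢ Icc (-r) r) :=
    (continuousOn_const.mul hLc).congr fun z _ ↦ hF z.1 z.2
  have hFx : ∀ y ∈ Icc (-r) r, ContinuousOn (fun x ↦ F x y) (Icc 0 r) := fun y hy ↦
    hFc.comp (continuousOn_id.prodMk continuousOn_const) fun x hx ↦ ⟨hx, hy⟩
  have hFy : ∀ x ∈ Icc 0 r, ContinuousOn (F x) (Icc (-r) r) := fun x hx ↦
    hFc.comp (continuousOn_const.prodMk continuousOn_id) fun y hy ↦ ⟨hx, hy⟩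
  have hFm : ∀ x ∈ Icc 0 r, StrictMonoOn (F x) (Icc (-r) r) := by
    intro x hx
    have hd : ∀ y, |y| ≤ r →
        HasDerivAt (F x) (a * coordDeriv p 1 (C.areaDensity p) (chartPoint p x y)) y := by
      intro y hy
      rw [funext (hF x)]
      exact (hasDerivAt_chartPoint_right hr hx.1 hx.2 hy (C.mdifferentiableAt_areaDensity
        (hrV x y hx.1 hx.2 hy).1)).const_mul a
    refine strictMonoOn_of_deriv_pos (convex_Icc _ _) (hFy x hx) fun y hy ↦ ?_
    rw [interior_Icc] at hy
    have hy' : |y| ≤ r := (abs_lt.2 hy).le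
    rw [(hd y hy').deriv]
    exact (hrV x y hx.1 hx.2 hy').2
  have h0 : F 0 0 = 0 := by
    rw [hF, chartPoint_zero hp, (C.mem_singularSet_iff hps).1 hnd.1, mul_zero]
  have h0r : (0 : ℝ) ∈ Icc 0 r := ⟨le_rfl, hr0.le⟩
  have h0' : (0 : ℝ) ∈ Icc (-r) r := ⟨by linarith, hr0.le⟩
  have hl : -r ∈ Icc (-r) r := ⟨le_rfl, by linarith⟩
  have hu : r ∈ Icc (-r) r := ⟨by linarith, le_rfl⟩
  have hneg0 : F 0 (-r) < 0 := (hFm 0 h0r hl h0' (by linarith)).trans_eq h0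
  have hpos0 : 0 < F 0 r := h0.symm.trans_lt (hFm 0 h0r h0' hu hr0)
  have hev : ∀ᶠ x in 𝓝[≥] (0 : ℝ), F x (-r) < 0 ∧ 0 < F x r := by
    rw [← nhdsWithin_Icc_eq_nhdsGE hr0]
    exact ((hFx _ hl 0 h0r).eventually_lt_const hneg0).and
      ((hFx _ hu 0 h0r).eventually_const_lt hpos0)
  obtain ⟨d, hd, hd'⟩ := mem_nhdsGE_iff_exists_Icc_subset.1 hev
  have hd0 : (0 : ℝ) < d := hd
  have hsub : Icc 0 (min d r) ⊆ Icc 0 r := Icc_subset_Icc_right (min_le_right _ _)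
  have hsub' : Icc 0 (min d r) ⊆ Icc 0 d := Icc_subset_Icc_right (min_le_left _ _)
  obtain ⟨g, hgc, hg⟩ := exists_continuousOn_implicit hr0 (δ := min d r)
    (fun y hy ↦ (hFx y hy).mono hsub) (fun x hx ↦ hFy x (hsub hx)) (fun x hx ↦ hFm x (hsub hx))
    (fun x hx ↦ (hd' (hsub' hx)).1) (fun x hx ↦ (hd' (hsub' hx)).2)
  have hδ : 0 < min d r := lt_min hd0 hr0
  have hzero : ∀ x ∈ Icc 0 (min d r), ∀ y, |y| ≤ r →
      (C.areaDensity p (chartPoint p x y) = 0 ↔ y = g x) := by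
    intro x hx y hy
    rw [← ((hg x hx).2 y (abs_le.1 hy)).1]
    rw [hF, mul_eq_zero_iff_left ha0]
  have hg0 : g 0 = 0 := (((hg 0 ⟨le_rfl, hδ.le⟩).2 0 h0').1.1 h0).symm
  refine ⟨g, min d r, r, ⟨le_rfl, hδ, hr0, ⟨r, hr, min_le_right _ _, le_rfl⟩, fun _ _ _ ↦ ?_,
    fun _ _ _ ↦ hg0, fun _ _ _ x hx ↦ (hg x hx).1, fun j k h1 h2 h3 ↦ by omega, ?_⟩, a, ?_⟩
  · refine contDiffOn_of_implicit hδ hr (min_le_right _ _) (fun x hx ↦ (hg x hx).1.le) hcd hgc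
      (fun x hx ↦ (hzero x hx _ (hg x hx).1.le).2 rfl) fun x hx h ↦ ?_
    have := (hrV x (g x) (hsub hx).1 (hsub hx).2 (hg x hx).1.le).2
    rw [h, mul_zero] at this
    exact lt_irrefl _ this
  · intro x hx y hy
    rw [C.mem_singularSet_iff (hrV x y (hsub hx).1 (hsub hx).2 hy.le).1, hzero x hx y hy.le]
    exact ⟨fun h ↦ ⟨1, le_rfl, le_rfl, h⟩, fun ⟨_, _, _, h⟩ ↦ h⟩
  · intro x hx y hy
    obtain ⟨-, b1, b2⟩ := (hg x hx).2 y (abs_le.1 hy.le)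
    rw [hF] at b1 b2
    exact ⟨b1.2, b2.2⟩

end CoherentTangentBundle

/-! ### The angle sums when the null direction is tangent to the boundary -/

namespace CoherentTangentBundle

variable {M : Type*} [TopologicalSpace M]
    [ChartedSpace (EuclideanHalfSpace 2) M] [IsManifold (𝓡∂ 2) ∞ M]
    {E : M → Type*} [TopologicalSpace (TotalSpace Plane E)]
    [∀ x, NormedAddCommGroup (E x)] [∀ x, InnerProductSpace ℝ (E x)]
    [FiberBundle Plane E] [VectorBundle ℝ Plane E]
    [ContMDiffVectorBundle ∞ Plane E (𝓡∂ 2)]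
    [IsContMDiffRiemannianBundle (𝓡∂ 2) ∞ Plane E]
    (C : CoherentTangentBundle M E) (o : SurfaceOrientation M) {p : M} {γ : ℝ → M}

theorem NullDirectionTangent.psi_coordField (h : C.NullDirectionTangent p)
    (hs : p ∈ C.singularSet) :
    C.psi p (coordField p 1 p) = 0 ∧ C.psi p (coordField p 0 p) ≠ 0 := by
  have hps := mem_chart_source (EuclideanHalfSpace 2) p
  constructor
  · obtain ⟨v, hv⟩ := C.mem_singularSet_iff_exists_isNullVector.1 hs
    have ht := h v hv
    obtain ⟨a, b, rfl⟩ := exists_eq_coordField_combination hps v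
    have ha : a = 0 := by
      have key : ∀ e₀ e₁ : Plane, e₀ = EuclideanSpace.single 0 1 → e₁ = EuclideanSpace.single 1 1 →
          (a • e₀ + b • e₁) 0 = 0 → a = 0 := by
        rintro _ _ rfl rfl h'
        simpa using h'
      exact key _ _ (coordField_self p 0) (coordField_self p 1) ht
    obtain ⟨h1, h2⟩ := hv
    rw [ha, zero_smul, zero_add] at h1 h2
    rw [map_smul] at h2
    refine (smul_eq_zero.1 h2).resolve_left fun hb ↦ h1 ?_
    rw [hb, zero_smul]
  · intro h0
    have ht := h _ ⟨coordField_ne_zero hps 0, h0⟩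
    unfold IsTangentToBoundary at ht
    rw [coordField_self] at ht
    simp at ht

/-- If `ψ(∂₁)` vanishes at `p`, it has a derivative along the boundary there, and this derivative
does not vanish if the area density has a non-zero derivative. -/
theorem exists_tendsto_inv_smul_psi (hp : p ∈ (𝓡∂ 2).boundary M)
    (hT : C.psi p (coordField p 1 p) = 0) (hL : coordDeriv p 1 (C.areaDensity p) p ≠ 0)
    (hs : p ∈ C.singularSet) :
    ∃ w : E p, w ≠ 0 ∧ Tendsto (fun y : ℝ ↦ TotalSpace.mk' Plane (chartPoint p 0 y)
      (y⁻¹ • C.psi (chartPoint p 0 y) (coordField p 1 (chartPoint p 0 y)))) (𝓝[≠] 0)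
      (𝓝 (TotalSpace.mk' Plane p w)) := by
  have := C.isContinuousRiemannianBundle
  have hps := mem_chart_source (EuclideanHalfSpace 2) p
  have hsn := (chartAt (EuclideanHalfSpace 2) p).open_source.mem_nhds hps
  obtain ⟨r, hr, -⟩ := exists_isChartRadius hp univ_mem
  have hr0 := hr.1
  have hpt := chartPoint_zero hp
  have hb := FiberBundle.mem_baseSet_trivializationAt' (F := Plane) (E := E) p
  have hlim := (tendsto_chartPoint_zero hp).mono_left (nhdsWithin_le_nhds (s := {0}ᶜ))
  -- the derivative of `ψ(∂₁)` in a trivialization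
  let f : M → Plane := fun q ↦
    (trivializationAt Plane E p (TotalSpace.mk' Plane q (C.psi q (coordField p 1 q)))).2
  have hlin : ∀ q ∈ (trivializationAt Plane E p).baseSet, ∀ (c : ℝ) (v : E q),
      (trivializationAt Plane E p (TotalSpace.mk' Plane q (c • v))).2 =
        c • (trivializationAt Plane E p (TotalSpace.mk' Plane q v)).2 := fun q hq c v ↦
    ((trivializationAt Plane E p).linear ℝ hq).map_smul c v
  have hf : ContMDiffAt (𝓡∂ 2) 𝓘(ℝ, Plane) ∞ f p :=
    ((trivializationAt Plane E p).contMDiffAt_section_iff hb).1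
      ((C.contMDiffOn_psi_coordField p 1).contMDiffAt hsn)
  have hf0 : f p = 0 := by
    have h1 := hlin p hb 0 (C.psi p (coordField p 1 p))
    rw [zero_smul, zero_smul] at h1
    simp only [f, hT]
    exact h1
  have hder := hasDerivAt_chartPoint_right (f := f) hr le_rfl hr0.le (by rw [abs_zero]; exact hr0.le)
    (by rw [hpt]; exact hf.mdifferentiableAt (by simp))
  have hslope := hasDerivAt_iff_tendsto_slope.1 hder
  obtain ⟨w, hw⟩ : ∃ w : E p, (trivializationAt Plane E p (TotalSpace.mk' Plane p w)).2 =
      coordDeriv p 1 f (chartPoint p 0 0) :=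
    ((trivializationAt Plane E p).linearEquivAt ℝ p hb).surjective _
  have hmain : Tendsto (fun y : ℝ ↦ TotalSpace.mk' Plane (chartPoint p 0 y)
      (y⁻¹ • C.psi (chartPoint p 0 y) (coordField p 1 (chartPoint p 0 y)))) (𝓝[≠] 0)
      (𝓝 (TotalSpace.mk' Plane p w)) := by
    refine ((trivializationAt Plane E p).tendsto_nhds_iff
      ((trivializationAt Plane E p).mem_source.2 hb)).2 ⟨hlim, ?_⟩
    rw [hw]
    refine hslope.congr' ?_
    filter_upwards [hlim ((trivializationAt Plane E p).open_baseSet.mem_nhds hb)] with y hy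
    have h1 : f (chartPoint p 0 0) = 0 := by rw [hpt, hf0]
    rw [slope_def_module, h1, sub_zero, sub_zero]
    exact (hlin _ hy _ _).symm
  refine ⟨w, fun hw0 ↦ hL ?_, hmain⟩
  -- `|λ| ≤ |ψ(∂₀)| |ψ(∂₁)|`, divided by `|y|`
  have h1 := tendsto_totalSpace_norm hmain
  have h2 := tendsto_totalSpace_norm
    (((C.contMDiffOn_psi_coordField p 0).continuousOn.continuousAt hsn).tendsto.comp hlim)
  have h3 := (hasDerivAt_iff_tendsto_slope.1 (hasDerivAt_chartPoint_right (f := C.areaDensity p) hr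
    le_rfl hr0.le (by rw [abs_zero]; exact hr0.le)
    (by rw [hpt]; exact C.mdifferentiableAt_areaDensity hps))).abs
  rw [hpt] at h3
  have h4 := le_of_tendsto_of_tendsto' h3 (h2.mul h1) fun y ↦ ?_
  · rw [hw0, norm_zero, mul_zero] at h4
    exact abs_eq_zero.1 (le_antisymm h4 (abs_nonneg _))
  · have h5 : C.areaDensity p (chartPoint p 0 0) = 0 := by
      rw [hpt]; exact (C.mem_singularSet_iff hps).1 hs
    rw [slope_def_field, h5, sub_zero, sub_zero, abs_div, norm_smul, norm_inv, Real.norm_eq_abs,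
      div_eq_inv_mul, mul_left_comm]
    exact mul_le_mul_of_nonneg_left (C.abs_mu_le _ _ _) (by positivity)

/-- If `ψ(∂₁)` vanishes at `p`, both halves of the boundary have the same initial vector, since
`ψ(∂₁)` changes its direction at `p`. -/
theorem isInitialVector_of_tendsto_inv_smul (hp : p ∈ (𝓡∂ 2).boundary M) (hγ : IsRegularArc p γ)
    (h : ∀ᶠ t in 𝓝[>] (0 : ℝ), chartFst p (γ t) = 0) {w : E p} (hw : w ≠ 0)
    (hlim : Tendsto (fun y : ℝ ↦ TotalSpace.mk' Plane (chartPoint p 0 y)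
      (y⁻¹ • C.psi (chartPoint p 0 y) (coordField p 1 (chartPoint p 0 y)))) (𝓝[≠] 0)
      (𝓝 (TotalSpace.mk' Plane p w))) : C.IsInitialVector p γ (‖w‖⁻¹ • w) := by
  have hps := mem_chart_source (EuclideanHalfSpace 2) p
  obtain ⟨v, hv, hv0, hY, hev⟩ := C.exists_velocity_of_chartFst_eq_zero hp hγ h
  have hsrc : ∀ᶠ t in 𝓝[>] (0 : ℝ), γ t ∈ (chartAt (EuclideanHalfSpace 2) p).source :=
    hγ.tendsto ((chartAt (EuclideanHalfSpace 2) p).open_source.mem_nhds hps)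
  have hpt : ∀ᶠ t in 𝓝[>] (0 : ℝ), chartPoint p 0 (chartSnd p (γ t)) = γ t := by
    filter_upwards [h, hsrc] with t ht hts
    rw [← ht]
    exact chartPoint_chartFst_chartSnd hts
  have hY0 : Tendsto (fun t ↦ chartSnd p (γ t)) (𝓝[>] 0) (𝓝[≠] 0) := by
    refine tendsto_nhdsWithin_iff.2 ⟨?_, ?_⟩
    · have h1 := ((continuousOn_chartSnd p).continuousAt
        ((chartAt (EuclideanHalfSpace 2) p).open_source.mem_nhds hps)).tendsto.comp hγ.tendsto
      rwa [chartSnd_self] at h1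
    · filter_upwards [hpt, hγ.eventually_ne] with t ht1 ht2 h0
      rw [mem_singleton_iff] at h0
      rw [h0, chartPoint_zero hp] at ht1
      exact ht2 ht1.symm
  have hprod : ∀ᶠ t in 𝓝[>] (0 : ℝ), 0 < v t * chartSnd p (γ t) := by
    have h1 := (hv.mul hY).eventually_const_lt (mul_self_pos.2 hv0)
    filter_upwards [h1, self_mem_nhdsWithin] with t ht ht'
    have ht0 : (0 : ℝ) < t := ht'
    have h2 := mul_pos ht0 ht
    rwa [mul_left_comm, mul_inv_cancel_left₀ ht0.ne'] at h2
  have key : ∀ q q' : M, q = q' → ∀ c : ℝ,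
      TotalSpace.mk' Plane q (c • C.psi q (coordField p 1 q)) =
        TotalSpace.mk' Plane q' (c • C.psi q' (coordField p 1 q')) := by
    rintro q _ rfl c; rfl
  refine C.isInitialVector_of_tendsto (c := fun t ↦ v t * chartSnd p (γ t))
    (W := fun t ↦ (chartSnd p (γ t))⁻¹ • C.psi (γ t) (coordField p 1 (γ t))) ?_
    ((hlim.comp hY0).congr' ?_) hw
  · filter_upwards [hprod, hev] with t ht1 ht2
    refine ⟨ht1, ?_⟩
    have h0 : chartSnd p (γ t) ≠ 0 := fun h0 ↦ by rw [h0, mul_zero] at ht1; exact lt_irrefl _ ht1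
    rw [ht2, smul_smul, mul_assoc, mul_inv_cancel₀ h0, mul_one]
  · filter_upwards [hpt] with t ht
    exact key _ _ ht _

/-- If `ψ(∂₁)` vanishes at `p`, all singular curves have the initial vector given by `ψ(∂₀)`. -/
theorem IsSingularArc.isInitialVector (hp : p ∈ (𝓡∂ 2).boundary M)
    (htr : C.SingularDirectionTransversal p) (hγ : C.IsSingularArc p γ)
    (hT : C.psi p (coordField p 1 p) = 0) (hP : C.psi p (coordField p 0 p) ≠ 0) :
    C.IsInitialVector p γ
      (‖C.psi p (coordField p 0 p)‖⁻¹ • C.psi p (coordField p 0 p)) := by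
  obtain ⟨u, v, hu, hv, hu0, hev⟩ := IsSingularArc.exists_velocity C hp htr hγ
  have h1 := tendsto_totalSpace_combination (tendsto_const_nhds (x := (1 : ℝ)))
    (hv.div hu hu0.ne') (C.tendsto_psi_coordField hγ.1 0) (C.tendsto_psi_coordField hγ.1 1)
  rw [hT, smul_zero, add_zero, one_smul] at h1
  refine C.isInitialVector_of_tendsto (c := u) ?_ h1 hP
  filter_upwards [hev, hu.eventually_const_lt hu0] with t ht1 ht2
  refine ⟨ht2, ?_⟩
  rw [ht1.2.2.2.2, map_add, map_smul, map_smul, smul_add, one_smul, smul_smul, Pi.div_apply,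
    mul_div_cancel₀ _ ht2.ne']

/-- If the null direction is tangent to the boundary at a non-degenerate point, the two sectors have
the same angle and opposite signs. -/
theorem exists_hasAngleSums_of_nullDirectionTangent [T2Space M] (hp : p ∈ (𝓡∂ 2).boundary M)
    (htr : C.SingularDirectionTransversal p) (hnd : C.IsNonDegenerate p)
    (hnull : C.NullDirectionTangent p) : ∃ a, C.HasAngleSums o p a a := by
  classical
  have hps := mem_chart_source (EuclideanHalfSpace 2) p
  obtain ⟨hT, hP⟩ := NullDirectionTangent.psi_coordField C hnull hnd.1
  obtain ⟨w, hw, hlim⟩ := C.exists_tendsto_inv_smul_psi hp hT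
    (SingularDirectionTransversal.coordDeriv_ne_zero C htr hnd) hnd.1
  obtain ⟨g, δ₀, η₀, h₀, a, ha⟩ := C.exists_isGraphSystem_of_isNonDegenerate hp htr hnd
  have hd0 := o.density_ne_zero hps
  have hV : ∀ᶠ q in 𝓝 p, 0 < o.density p p * o.density p q :=
    (((o.continuousOn_density p).continuousAt
      ((chartAt (EuclideanHalfSpace 2) p).open_source.mem_nhds hps)).const_mul
        (o.density p p)).eventually_const_lt (mul_self_pos.2 hd0)
  obtain ⟨δ, hδ, η, hη, h, hsub⟩ := h₀.exists_smaller hp hV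
  have hdec := h.isSectorDecomposition hp
  obtain ⟨x₀, hx₀⟩ := (hdec.sector_isConnected 0 (by omega)).nonempty
  obtain ⟨x₁, hx₁⟩ := (hdec.sector_isConnected 1 le_rfl).nonempty
  let Ψ : ℕ → E p := fun k ↦
    if k = 1 then ‖C.psi p (coordField p 0 p)‖⁻¹ • C.psi p (coordField p 0 p) else ‖w‖⁻¹ • w
  have hΨ : ∀ k ≤ 1 + 1, ∀ γ, C.IsSingularArc p γ ∨ IsBoundaryArc p γ →
      (∀ᶠ t in 𝓝[>] (0 : ℝ), γ t ∈ graphArc p 1 (fun _ ↦ g) δ η k) →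
      C.IsInitialVector p γ (Ψ k) := by
    intro k hk γ hγ hgerm
    rcases hγ with hγ | hγ
    · obtain ⟨h1, h2⟩ := IsGraphSystem.one_le_and_le_of_germ hp htr hγ hgerm
      simp only [Ψ, if_pos (show k = 1 by omega)]
      exact IsSingularArc.isInitialVector C hp htr hγ hT hP
    · have hk1 : k ≠ 1 := by
        rintro rfl
        exact h.not_isBoundaryArc hp hγ le_rfl le_rfl hgerm
      simp only [Ψ, if_neg hk1]
      refine C.isInitialVector_of_tendsto_inv_smul hp hγ.1 (hgerm.mono fun t ht ↦ ?_) hw hlim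
      by_cases h0 : k = 0
      · exact (ht.2.1 h0).1
      · exact (ht.2.2.2 (by omega)).1
  have hsum := h.hasAngleSums o hp Ψ hΨ
  simp only [Finset.sum_range_succ, Finset.sum_range_zero, zero_add] at hsum
  have hang : Real.arccos (inner ℝ (Ψ 1) (Ψ (1 + 1))) = Real.arccos (inner ℝ (Ψ 0) (Ψ 1)) := by
    rw [real_inner_comm]
    rfl
  rw [hang] at hsum
  have hL : ∀ q ∈ chartBox p δ η,
      (chartSnd p q < g (chartFst p q) → a * C.areaDensity p q < 0) ∧
      (g (chartFst p q) < chartSnd p q → 0 < a * C.areaDensity p q) := by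
    intro q hq
    have h1 := ha (chartFst p q) ⟨chartFst_nonneg hq.1, (hq.2.1.le.trans hδ)⟩ (chartSnd p q)
      (hq.2.2.trans_le hη)
    rwa [chartPoint_chartFst_chartSnd hq.1] at h1
  have hS0 : ∀ q ∈ graphSector p 1 (fun _ ↦ g) δ η 0, q ∈ chartBox p δ η ∧
      0 < o.density p p * o.density p q ∧ a * C.areaDensity p q < 0 := by
    rintro q ⟨h1, -, -, h2⟩
    exact ⟨h1, hsub h1, (hL q h1).1 (by simpa [graphBound] using h2)⟩
  have hS1 : ∀ q ∈ graphSector p 1 (fun _ ↦ g) δ η 1, q ∈ chartBox p δ η ∧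
      0 < o.density p p * o.density p q ∧ 0 < a * C.areaDensity p q := by
    rintro q ⟨h1, -, h2, -⟩
    exact ⟨h1, hsub h1, (hL q h1).2 (by simpa [graphBound] using h2)⟩
  have ha0 : a ≠ 0 := by
    rintro rfl
    simpa using (hS0 x₀ hx₀).2.2
  have hdisj : ∀ q, q ∈ C.positivePart o → q ∉ C.negativePart o := fun q h1 ↦
    disjoint_left.1 (C.disjoint_positivePart_negativePart o) h1
  -- the sign of `density * areaDensity` is that of `density p p * a` times that of `a * areaDensity`
  have hsq : ∀ d l : ℝ, (o.density p p * a) ^ 2 * (d * l) =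
      (o.density p p * a) * (o.density p p * d) * (a * l) := by intro d l; ring
  have hsq0 : 0 < (o.density p p * a) ^ 2 := by positivity
  rcases lt_or_gt_of_ne (mul_ne_zero hd0 ha0) with hneg | hpos
  · have b0 : graphSector p 1 (fun _ ↦ g) δ η 0 ⊆ C.positivePart o := fun q hq ↦ by
      obtain ⟨h1, h2, h3⟩ := hS0 q hq
      refine (C.mem_positivePart_iff o h1.1).2 (pos_of_mul_pos_right ?_ hsq0.le)
      rw [hsq]
      exact mul_pos_of_neg_of_neg (mul_neg_of_neg_of_pos hneg h2) h3
    have b1 : graphSector p 1 (fun _ ↦ g) δ η 1 ⊆ C.negativePart o := fun q hq ↦ by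
      obtain ⟨h1, h2, h3⟩ := hS1 q hq
      refine (C.mem_negativePart_iff o h1.1).2 (neg_of_mul_neg_right ?_ hsq0.le)
      rw [hsq]
      exact mul_neg_of_neg_of_pos (mul_neg_of_neg_of_pos hneg h2) h3
    rw [if_pos b0, if_neg fun b ↦ hdisj _ (b hx₁) (b1 hx₁), if_neg fun b ↦ hdisj _ (b0 hx₀) (b hx₀),
      if_pos b1, add_zero, zero_add] at hsum
    exact ⟨_, hsum⟩
  · have b0 : graphSector p 1 (fun _ ↦ g) δ η 0 ⊆ C.negativePart o := fun q hq ↦ by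
      obtain ⟨h1, h2, h3⟩ := hS0 q hq
      refine (C.mem_negativePart_iff o h1.1).2 (neg_of_mul_neg_right ?_ hsq0.le)
      rw [hsq]
      exact mul_neg_of_pos_of_neg (mul_pos hpos h2) h3
    have b1 : graphSector p 1 (fun _ ↦ g) δ η 1 ⊆ C.positivePart o := fun q hq ↦ by
      obtain ⟨h1, h2, h3⟩ := hS1 q hq
      refine (C.mem_positivePart_iff o h1.1).2 (pos_of_mul_pos_right ?_ hsq0.le)
      rw [hsq]
      exact mul_pos (mul_pos hpos h2) h3
    rw [if_neg fun b ↦ hdisj _ (b hx₀) (b0 hx₀), if_pos b1, if_pos b0,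
      if_neg fun b ↦ hdisj _ (b1 hx₁) (b hx₁), add_zero, zero_add] at hsum
    exact ⟨_, hsum⟩

end CoherentTangentBundle

/-! ### The singular set near a degenerate peak -/

/-- A plane curve of class `C¹` with increasing first coordinate is the graph of a function of class
`C¹` over a closed interval. -/
theorem exists_graph_of_derivWithin_pos {X Y : ℝ → ℝ} {ε : ℝ} (hε : 0 < ε)
    (hX : ContDiffOn ℝ 1 X (Icc 0 ε)) (hY : ContDiffOn ℝ 1 Y (Icc 0 ε))
    (hpos : ∀ t ∈ Icc 0 ε, 0 < derivWithin X (Icc 0 ε) t) :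
    X 0 < X ε ∧ ∃ g T : ℝ → ℝ, ContDiffOn ℝ 1 g (Icc (X 0) (X ε)) ∧
      (∀ x ∈ Icc (X 0) (X ε), T x ∈ Icc 0 ε ∧ X (T x) = x) ∧
      ∀ t ∈ Icc 0 ε, X t ∈ Icc (X 0) (X ε) ∧ g (X t) = Y t := by
  have h0 : (0 : ℝ) ∈ Icc 0 ε := ⟨le_rfl, hε.le⟩
  have h1 : ε ∈ Icc 0 ε := ⟨hε.le, le_rfl⟩
  have hu := uniqueDiffOn_Icc hε
  have hXd := (contDiffOn_one_iff_derivWithin hu).1 hX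
  have hYd := (contDiffOn_one_iff_derivWithin hu).1 hY
  have hmono : StrictMonoOn X (Icc 0 ε) := by
    refine strictMonoOn_of_deriv_pos (convex_Icc _ _) hX.continuousOn fun t ht ↦ ?_
    rw [interior_Icc] at ht
    rw [← derivWithin_of_mem_nhds (Icc_mem_nhds ht.1 ht.2)]
    exact hpos t (Ioo_subset_Icc_self ht)
  have hlt : X 0 < X ε := hmono h0 h1 hε
  have hXI : ∀ t ∈ Icc 0 ε, X t ∈ Icc (X 0) (X ε) := fun t ht ↦
    ⟨hmono.monotoneOn h0 ht ht.1, hmono.monotoneOn ht h1 ht.2⟩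
  have hex : ∀ x, ∃ t, x ∈ Icc (X 0) (X ε) → t ∈ Icc 0 ε ∧ X t = x := by
    intro x
    by_cases hx : x ∈ Icc (X 0) (X ε)
    · obtain ⟨t, ht, htx⟩ := intermediate_value_Icc hε.le hX.continuousOn hx
      exact ⟨t, fun _ ↦ ⟨ht, htx⟩⟩
    · exact ⟨0, fun h ↦ (hx h).elim⟩
  choose T hT using hex
  have hTX : ∀ t ∈ Icc 0 ε, T (X t) = t := fun t ht ↦
    hmono.injOn (hT _ (hXI t ht)).1 ht (hT _ (hXI t ht)).2
  have hTc : ContinuousOn T (Icc (X 0) (X ε)) := by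
    intro x hx
    obtain ⟨b1, b2⟩ := hT x hx
    refine tendsto_order.2 ⟨fun c hc ↦ ?_, fun c hc ↦ ?_⟩
    · by_cases hc0 : c < 0
      · filter_upwards [self_mem_nhdsWithin] with z hz using hc0.trans_le (hT z hz).1.1
      · have hcI : c ∈ Icc 0 ε := ⟨not_lt.1 hc0, hc.le.trans b1.2⟩
        have h2 := hmono hcI b1 hc
        rw [b2] at h2
        filter_upwards [self_mem_nhdsWithin, mem_nhdsWithin_of_mem_nhds (Ioi_mem_nhds h2)]
          with z hz hz'
        refine (hmono.lt_iff_lt hcI (hT z hz).1).1 ?_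
        rw [(hT z hz).2]; exact hz'
    · by_cases hc0 : ε < c
      · filter_upwards [self_mem_nhdsWithin] with z hz using (hT z hz).1.2.trans_lt hc0
      · have hcI : c ∈ Icc 0 ε := ⟨b1.1.trans hc.le, not_lt.1 hc0⟩
        have h2 := hmono b1 hcI hc
        rw [b2] at h2
        filter_upwards [self_mem_nhdsWithin, mem_nhdsWithin_of_mem_nhds (Iio_mem_nhds h2)]
          with z hz hz'
        refine (hmono.lt_iff_lt (hT z hz).1 hcI).1 ?_
        rw [(hT z hz).2]; exact hz'
  have hder : ∀ x ∈ Icc (X 0) (X ε), HasDerivWithinAt (Y ∘ T)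
      (derivWithin Y (Icc 0 ε) (T x) / derivWithin X (Icc 0 ε) (T x)) (Icc (X 0) (X ε)) x := by
    intro x hx
    obtain ⟨b1, b2⟩ := hT x hx
    have hXs := hasDerivWithinAt_iff_tendsto_slope.1 (hXd.1 _ b1).hasDerivWithinAt
    have hYs := hasDerivWithinAt_iff_tendsto_slope.1 (hYd.1 _ b1).hasDerivWithinAt
    have hlim : Tendsto T (𝓝[Icc (X 0) (X ε) \ {x}] x) (𝓝[Icc 0 ε \ {T x}] T x) := by
      refine tendsto_nhdsWithin_iff.2 ⟨(hTc x hx).mono_left (nhdsWithin_mono _ sdiff_subset), ?_⟩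
      filter_upwards [self_mem_nhdsWithin] with z hz
      refine ⟨(hT z hz.1).1, fun h ↦ hz.2 ?_⟩
      rw [mem_singleton_iff] at h ⊢
      rw [← (hT z hz.1).2, h, b2]
    refine hasDerivWithinAt_iff_tendsto_slope.2
      (((hYs.div hXs (hpos _ b1).ne').comp hlim).congr' ?_)
    filter_upwards [self_mem_nhdsWithin] with z hz
    have hne : T z - T x ≠ 0 := by
      intro h
      refine hz.2 ?_
      rw [mem_singleton_iff, ← (hT z hz.1).2, sub_eq_zero.1 h, b2]
    simp only [Function.comp_apply, Pi.div_apply, slope_def_field, (hT z hz.1).2, b2]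
    rw [div_div_div_cancel_right₀ hne]
  refine ⟨hlt, Y ∘ T, T, ?_, hT, fun t ht ↦ ⟨hXI t ht, congrArg Y (hTX t ht)⟩⟩
  have hmaps : MapsTo T (Icc (X 0) (X ε)) (Icc 0 ε) := fun x hx ↦ (hT x hx).1
  refine (contDiffOn_one_iff_derivWithin (uniqueDiffOn_Icc hlt)).2
    ⟨fun x hx ↦ (hder x hx).differentiableWithinAt, ?_⟩
  refine ((hYd.2.comp hTc hmaps).div (hXd.2.comp hTc hmaps)
    fun x hx ↦ (hpos _ (hmaps hx)).ne').congr fun x hx ↦ ?_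
  exact (hder x hx).derivWithin (uniqueDiffOn_Icc hlt x hx)

namespace CoherentTangentBundle

variable {M : Type*} [TopologicalSpace M]
    [ChartedSpace (EuclideanHalfSpace 2) M] [IsManifold (𝓡∂ 2) ∞ M]
    {E : M → Type*} [TopologicalSpace (TotalSpace Plane E)]
    [∀ x, NormedAddCommGroup (E x)] [∀ x, InnerProductSpace ℝ (E x)]
    [FiberBundle Plane E] [VectorBundle ℝ Plane E]
    [ContMDiffVectorBundle ∞ Plane E (𝓡∂ 2)]
    [IsContMDiffRiemannianBundle (𝓡∂ 2) ∞ Plane E]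
    (C : CoherentTangentBundle M E) {p : M} {γ : ℝ → M}

/-- An initial piece of a singular curve is a graph over the first coordinate, and its tangent lines
are not parallel to the second coordinate axis. -/
theorem IsSingularArc.exists_graph (hp : p ∈ (𝓡∂ 2).boundary M)
    (htr : C.SingularDirectionTransversal p) (hγ : C.IsSingularArc p γ) :
    ∃ d ε : ℝ, 0 < d ∧ 0 < ε ∧ ∃ g : ℝ → ℝ, ContDiffOn ℝ 1 g (Icc 0 d) ∧ g 0 = 0 ∧
      (∀ x ∈ Icc 0 d, chartPoint p x (g x) ∈ C.singularSet ∧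
        (C.IsNonDegenerate (chartPoint p x (g x)) →
          coordDeriv p 1 (C.areaDensity p) (chartPoint p x (g x)) ≠ 0)) ∧
      ∀ t ∈ Icc 0 ε, chartSnd p (γ t) = g (chartFst p (γ t)) := by
  have hev : ∀ᶠ t in 𝓝[≥] (0 : ℝ), t < 1 ∧ γ t ∈ (chartAt (EuclideanHalfSpace 2) p).source := by
    have h1 : γ 0 ∈ (chartAt (EuclideanHalfSpace 2) p).source := by
      rw [hγ.1.start]; exact mem_chart_source _ p
    have h2 := (hγ.1.continuousOn 0 (by simp)).preimage_mem_nhdsWithin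
      ((chartAt (EuclideanHalfSpace 2) p).open_source.mem_nhds h1)
    rw [nhdsWithin_Icc_eq_nhdsGE zero_lt_one] at h2
    filter_upwards [h2, Ico_mem_nhdsGE (zero_lt_one' ℝ)] with t a b using ⟨b.2, a⟩
  obtain ⟨ε₁, hε₁, hsub⟩ := mem_nhdsGE_iff_exists_Icc_subset.1 hev
  have hε₁0 : (0 : ℝ) < ε₁ := hε₁
  have hI : Icc 0 ε₁ ⊆ Icc 0 1 := fun t ht ↦ ⟨ht.1, (hsub ht).1.le⟩
  obtain ⟨hX, hY⟩ := contDiffOn_chart_comp (p := p) (hγ.1.contMDiffOn.mono hI)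
    fun t ht ↦ (hsub ht).2
  have h01 : (0 : ℝ) ∈ Icc 0 ε₁ := ⟨le_rfl, hε₁0.le⟩
  have hXd := (contDiffOn_one_iff_derivWithin (uniqueDiffOn_Icc hε₁0)).1 hX
  have hd0 : 0 < derivWithin (fun s ↦ chartFst p (γ s)) (Icc 0 ε₁) 0 := by
    have h1 := IsSingularArc.deriv_chartFst_pos C hp htr hγ
    rwa [derivWithin_subset hI (uniqueDiffOn_Icc hε₁0 0 h01)
      (differentiableWithinAt_of_derivWithin_ne_zero h1.ne')]
  have hev2 := (hXd.2 0 h01).eventually_const_lt hd0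
  rw [nhdsWithin_Icc_eq_nhdsGE hε₁0] at hev2
  obtain ⟨ε₂, hε₂, hsub2⟩ := mem_nhdsGE_iff_exists_Icc_subset.1 hev2
  have hε₂0 : (0 : ℝ) < ε₂ := hε₂
  have hε0 : 0 < min ε₁ ε₂ := lt_min hε₁0 hε₂0
  have hII : Icc 0 (min ε₁ ε₂) ⊆ Icc 0 ε₁ := Icc_subset_Icc_right (min_le_left _ _)
  have hpos : ∀ t ∈ Icc 0 (min ε₁ ε₂),
      0 < derivWithin (fun s ↦ chartFst p (γ s)) (Icc 0 (min ε₁ ε₂)) t := by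
    intro t ht
    rw [derivWithin_subset hII (uniqueDiffOn_Icc hε0 t ht) (hXd.1 t (hII ht))]
    exact hsub2 ⟨ht.1, ht.2.trans (min_le_right _ _)⟩
  obtain ⟨hlt, g, T, hg, hT, hgX⟩ := exists_graph_of_derivWithin_pos hε0 (hX.mono hII)
    (hY.mono hII) hpos
  have hX0 : chartFst p (γ 0) = 0 := by rw [hγ.1.start, chartFst_self hp]
  rw [hX0] at hlt hg hT hgX
  refine ⟨_, _, hlt, hε0, g, hg, ?_, fun x hx ↦ ?_, fun t ht ↦ (hgX t ht).2.symm⟩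
  · have h1 := (hgX 0 ⟨le_rfl, hε0.le⟩).2
    rwa [hX0, hγ.1.start, chartSnd_self] at h1
  · obtain ⟨ht, htx⟩ := hT x hx
    have ht1 := hI (hII ht)
    have hts := (hsub (hII ht)).2
    have hpt : chartPoint p x (g x) = γ (T x) := by
      have h1 := (hgX _ ht).2
      rw [htx] at h1
      rw [h1]
      nth_rewrite 1 [← htx]
      exact chartPoint_chartFst_chartSnd hts
    rw [hpt]
    refine ⟨hγ.2 ⟨_, ht1, rfl⟩, fun hnd h1 ↦ ?_⟩
    obtain ⟨u, v, hu, -, huv⟩ := velocity_eq (p := p)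
      ((hγ.1.contMDiffOn _ ht1).mdifferentiableWithinAt (by simp)) hts
    have hu0 : 0 < u := by
      rw [← (hu.mono (hII.trans hI)).derivWithin (uniqueDiffOn_Icc hε0 _ ht)]
      exact hpos _ ht
    have hmd := C.mfderiv_areaDensity_velocity hγ.1 hγ.2 ht1 hts
    rw [huv, mfderiv_combination, h1] at hmd
    have key : ∀ a : ℝ, u * a + v * 0 = 0 → a = 0 := fun a ha ↦ by
      rw [mul_zero, add_zero] at ha
      exact (mul_eq_zero.1 ha).resolve_left hu0.ne'
    exact IsNonDegenerate.coordDeriv_ne_zero C hnd hts h1 (key _ hmd)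

/-- Two graphs in the singular set which meet at a point agree near this point if the area density
has a non-zero derivative in the second coordinate, hence agree altogether if this holds
everywhere. -/
theorem eqOn_graph {g₁ g₂ : ℝ → ℝ} {d r : ℝ} (hr : IsChartRadius p r) (hdr : d ≤ r)
    (h₁ : ContinuousOn g₁ (Ioc 0 d)) (h₂ : ContinuousOn g₂ (Ioc 0 d))
    (hr₁ : ∀ x ∈ Ioc 0 d, |g₁ x| ≤ r) (hr₂ : ∀ x ∈ Ioc 0 d, |g₂ x| ≤ r)
    (hs₁ : ∀ x ∈ Ioc 0 d, chartPoint p x (g₁ x) ∈ C.singularSet)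
    (hs₂ : ∀ x ∈ Ioc 0 d, chartPoint p x (g₂ x) ∈ C.singularSet)
    (hL : ∀ x ∈ Ioc 0 d, coordDeriv p 1 (C.areaDensity p) (chartPoint p x (g₁ x)) ≠ 0)
    {x₀ : ℝ} (hx₀ : x₀ ∈ Ioc 0 d) (h₀ : g₁ x₀ = g₂ x₀) : EqOn g₁ g₂ (Ioc 0 d) := by
  have hpre : PreconnectedSpace (Ioc 0 d) := isPreconnected_iff_preconnectedSpace.1 isPreconnected_Ioc
  have hclosed : IsClosed {x : Ioc 0 d | g₁ x = g₂ x} :=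
    isClosed_eq (continuousOn_iff_continuous_domRestrict.1 h₁)
      (continuousOn_iff_continuous_domRestrict.1 h₂)
  have hbox : ∀ x ∈ Ioc 0 d, x ∈ Icc 0 r := fun x hx ↦ ⟨hx.1.le, hx.2.trans hdr⟩
  have hopen : IsOpen {x : Ioc 0 d | g₁ x = g₂ x} := by
    rw [isOpen_iff_mem_nhds]
    rintro ⟨x, hx⟩ hxe
    have hxe' : g₁ x = g₂ x := hxe
    have hcont : ContinuousWithinAt
        (fun z : ℝ × ℝ ↦ coordDeriv p 1 (C.areaDensity p) (chartPoint p z.1 z.2))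
        (Icc 0 r ×ˢ Icc (-r) r) (x, g₁ x) := by
      have h3 := continuousAt_coordDeriv (hr.mem_source hx.1.le (hbox x hx).2 (hr₁ x hx)) 1
        ((C.contMDiffAt_areaDensity
          (hr.mem_source hx.1.le (hbox x hx).2 (hr₁ x hx))).of_le (by simp))
      exact ContinuousAt.comp_continuousWithinAt (x := (x, g₁ x))
        (f := fun z : ℝ × ℝ ↦ chartPoint p z.1 z.2) h3
        (continuousOn_chartPoint hr (x, g₁ x) ⟨hbox x hx, abs_le.1 (hr₁ x hx)⟩)
    obtain ⟨ρ, hρ, hball⟩ := Metric.mem_nhdsWithin_iff.1 (hcont.eventually_ne (hL x hx))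
    have hnear : ∀ g : ℝ → ℝ, ContinuousOn g (Ioc 0 d) → g x = g₁ x →
        ∀ᶠ z in 𝓝[Ioc 0 d] x, |g z - g₁ x| < ρ := by
      intro g hg hgx
      have h3 := (hg x hx).eventually (Metric.ball_mem_nhds _ hρ)
      filter_upwards [h3] with z hz
      rwa [hgx, Real.dist_eq] at hz
    have hev : ∀ᶠ z in 𝓝[Ioc 0 d] x, g₁ z = g₂ z := by
      filter_upwards [self_mem_nhdsWithin, mem_nhdsWithin_of_mem_nhds (Metric.ball_mem_nhds x hρ),
        hnear g₁ h₁ rfl, hnear g₂ h₂ hxe'.symm] with z hz hzx hz₁ hz₂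
      rw [Metric.mem_ball, Real.dist_eq] at hzx
      -- otherwise the area density has a critical point between the two graphs
      have hcrit : ∀ a b, a < b → |a| ≤ r → |b| ≤ r → |a - g₁ x| < ρ → |b - g₁ x| < ρ →
          chartPoint p z a ∈ C.singularSet → chartPoint p z b ∈ C.singularSet → False := by
        intro a b hab ha hb ha' hb' hsa hsb
        have hyr : ∀ y ∈ Icc a b, |y| ≤ r := fun y hy ↦
          abs_le.2 ⟨(abs_le.1 ha).1.trans hy.1, hy.2.trans (abs_le.1 hb).2⟩
        have hsrc := fun y hy ↦ hr.mem_source hz.1.le (hbox z hz).2 (hyr y hy)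
        have hder := fun y hy ↦ hasDerivAt_chartPoint_right hr hz.1.le (hbox z hz).2 (hyr y hy)
          (C.mdifferentiableAt_areaDensity (hsrc y hy))
        obtain ⟨c, hc, hc0⟩ := exists_hasDerivAt_eq_zero hab
          (fun y hy ↦ (hder y hy).continuousAt.continuousWithinAt)
          (((C.mem_singularSet_iff (hsrc a ⟨le_rfl, hab.le⟩)).1 hsa).trans
            ((C.mem_singularSet_iff (hsrc b ⟨hab.le, le_rfl⟩)).1 hsb).symm)
          fun y hy ↦ hder y (Ioo_subset_Icc_self hy)
        refine hball (a := (z, c)) ⟨?_, hbox z hz, abs_le.1 (hyr c (Ioo_subset_Icc_self hc))⟩ hc0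
        rw [Metric.mem_ball, Prod.dist_eq, Real.dist_eq, Real.dist_eq]
        refine max_lt hzx (abs_lt.2 ⟨?_, ?_⟩)
        · linarith [(abs_lt.1 ha').1, hc.1]
        · linarith [(abs_lt.1 hb').2, hc.2]
      by_contra hne
      rcases lt_or_gt_of_ne hne with h3 | h3
      · exact hcrit _ _ h3 (hr₁ z hz) (hr₂ z hz) hz₁ hz₂ (hs₁ z hz) (hs₂ z hz)
      · exact hcrit _ _ h3 (hr₂ z hz) (hr₁ z hz) hz₂ hz₁ (hs₂ z hz) (hs₁ z hz)
    rw [nhds_subtype_eq_comap_nhdsWithin]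
    exact preimage_mem_comap hev
  rcases isClopen_iff.1 ⟨hclosed, hopen⟩ with h3 | h3
  · exact absurd (show (⟨x₀, hx₀⟩ : Ioc 0 d) ∈ {x : Ioc 0 d | g₁ x = g₂ x} from h₀)
      (by rw [h3]; exact notMem_empty _)
  · intro x hx
    have : (⟨x, hx⟩ : Ioc 0 d) ∈ {x : Ioc 0 d | g₁ x = g₂ x} := by rw [h3]; trivial
    exact this

/-- The singular set near a degenerate peak is a graph system: any two of the finitely many arcs
of which it consists either have the same germ or do not meet again. -/
theorem exists_isGraphSystem_of_isPeak [T2Space M] (hp : p ∈ (𝓡∂ 2).boundary M)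
    (htr : C.SingularDirectionTransversal p) (hpk : C.IsPeak p) (hdeg : ¬ C.IsNonDegenerate p) :
    ∃ m g δ η, C.IsGraphSystem p m g δ η := by
  obtain ⟨-, -, U, hU, hpU, hA, -, n, γ, hγ, hcov⟩ := hpk
  have hsing : ∀ i, C.IsSingularArc p (γ i) := by
    intro i
    refine ⟨hγ i, ?_⟩
    have h1 : γ i '' Ico 0 1 ⊆ C.singularSet := fun q hq ↦
      (hcov.ge (Or.inr (mem_iUnion.2 ⟨i, hq⟩)) : q ∈ C.singularSet ∩ U).1
    have h2 := ((hγ i).continuousOn.mono (by rw [closure_Ico zero_ne_one])).image_closure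
      (s := Ico 0 1)
    rw [closure_Ico zero_ne_one] at h2
    exact h2.trans (closure_minimal h1 C.isClosed_singularSet)
  choose d ε hd hε g hg hg0 hgs hgγ using fun i ↦ IsSingularArc.exists_graph C hp htr (hsing i)
  have hn : Nonempty (Fin n) := by
    obtain ⟨v, -, hv⟩ := htr.1
    rcases hv with hv | ⟨-, σ, hσ, -⟩
    · exact (hdeg hv.1).elim
    · have hσU : ∀ᶠ t in 𝓝[>] (0 : ℝ), σ t ∈ U := hσ.1.tendsto (hU.mem_nhds hpU)
      obtain ⟨t, h1, h2, h3⟩ := (hσU.and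
        (hσ.1.eventually_ne.and (Ioo_mem_nhdsGT (zero_lt_one' ℝ)))).exists
      have h4 : σ t ∈ C.singularSet ∩ U := ⟨hσ.2 ⟨t, Ioo_subset_Icc_self h3, rfl⟩, h1⟩
      rw [hcov] at h4
      obtain ⟨i, -⟩ := mem_iUnion.1 (h4.resolve_left h2)
      exact ⟨i⟩
  -- a neighbourhood which the arcs do not enter again
  have hV : ∀ᶠ q in 𝓝 p, q ∈ U ∧ ∀ i, q ∉ γ i '' Icc (ε i) 1 := by
    have h1 : ∀ᶠ q in 𝓝 p, ∀ i, q ∉ γ i '' Icc (ε i) 1 := by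
      refine eventually_all.2 fun i ↦ ?_
      have h2 : IsClosed (γ i '' Icc (ε i) 1) := (isCompact_Icc.image_of_continuousOn
        ((hγ i).continuousOn.mono (Icc_subset_Icc_left (hε i).le))).isClosed
      refine h2.isOpen_compl.mem_nhds ?_
      rintro ⟨t, ht, htp⟩
      exact (hγ i).ne ((hε i).trans_le ht.1) ht.2 htp
    filter_upwards [hU.mem_nhds hpU, h1] with q h2 h3 using ⟨h2, h3⟩
  obtain ⟨r, hr, hrV⟩ := exists_isChartRadius hp hV
  have hr0 := hr.1
  have hev : ∀ᶠ x in 𝓝[≥] (0 : ℝ), x ≤ r ∧ ∀ i, x ≤ d i ∧ |g i x| < r := by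
    have h1 : ∀ᶠ x in 𝓝[≥] (0 : ℝ), ∀ i, x ≤ d i ∧ |g i x| < r := by
      refine eventually_all.2 fun i ↦ ?_
      have h2 := ((hg i).continuousOn.abs 0 ⟨le_rfl, (hd i).le⟩).tendsto
      rw [hg0 i, abs_zero, nhdsWithin_Icc_eq_nhdsGE (hd i)] at h2
      filter_upwards [h2.eventually_lt_const hr0, Icc_mem_nhdsGE (hd i)] with x a b using ⟨b.2, a⟩
    filter_upwards [h1, Icc_mem_nhdsGE hr0] with x a b using ⟨b.2, a⟩
  obtain ⟨δ, hδ, hδI⟩ := mem_nhdsGE_iff_exists_Icc_subset.1 hev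
  have hδ0 : (0 : ℝ) < δ := hδ
  have hδδ : δ ∈ Icc 0 δ := ⟨hδ0.le, le_rfl⟩
  have hδr : δ ≤ r := (hδI hδδ).1
  have hgr : ∀ i, ∀ x ∈ Icc 0 δ, |g i x| < r := fun i x hx ↦ ((hδI hx).2 i).2
  have hgd : ∀ i, Icc 0 δ ⊆ Icc 0 (d i) := fun i ↦ Icc_subset_Icc_right ((hδI hδδ).2 i).1
  have hgc : ∀ i, ContinuousOn (g i) (Icc 0 δ) := fun i ↦ (hg i).continuousOn.mono (hgd i)
  have hgS : ∀ i, ∀ x ∈ Icc 0 δ, chartPoint p x (g i x) ∈ C.singularSet := fun i x hx ↦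
    (hgs i x (hgd i hx)).1
  have heq : ∀ i j, ∀ x ∈ Ioc 0 δ, g i x = g j x → EqOn (g i) (g j) (Ioc 0 δ) := by
    intro i j x hx hxe
    have hI : Ioc 0 δ ⊆ Icc 0 δ := Ioc_subset_Icc_self
    refine C.eqOn_graph hr hδr ((hgc i).mono hI) ((hgc j).mono hI) (fun y hy ↦ (hgr i y (hI hy)).le)
      (fun y hy ↦ (hgr j y (hI hy)).le) (fun y hy ↦ hgS i y (hI hy)) (fun y hy ↦ hgS j y (hI hy))
      (fun y hy ↦ (hgs i y (hgd i (hI hy))).2 ?_) hx hxe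
    have hgy := (hgr i y (hI hy)).le
    refine (hA _ ⟨hgS i y (hI hy), (hrV y _ hy.1.le (hy.2.trans hδr) hgy).1⟩ fun h ↦ ?_).1
    have h1 := hr.chartFst_chartPoint hy.1.le (hy.2.trans hδr) hgy
    rw [h, chartFst_self hp] at h1
    exact hy.1.ne h1
  -- the distinct graphs in increasing order, told apart by their values at `δ`
  set S : Finset ℝ := Finset.univ.image fun i ↦ g i δ with hS
  have hSm : 1 ≤ S.card := Finset.card_pos.2 (Finset.univ_nonempty.image _)
  have hidx : ∀ k : Fin S.card, ∃ i, g i δ = S.orderEmbOfFin rfl k := by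
    intro k
    obtain ⟨i, -, hi⟩ := Finset.mem_image.1 (S.orderEmbOfFin_mem rfl k)
    exact ⟨i, hi⟩
  choose idx hidx using hidx
  let G : ℕ → ℝ → ℝ := fun k ↦ if h : k - 1 < S.card then g (idx ⟨k - 1, h⟩) else 0
  have hG : ∀ k (h1 : 1 ≤ k) (h2 : k ≤ S.card), G k = g (idx ⟨k - 1, by omega⟩) := fun k h1 h2 ↦
    dif_pos (show k - 1 < S.card by omega)
  have hGi : ∀ i, ∃ k, 1 ≤ k ∧ k ≤ S.card ∧ ∀ x ∈ Icc 0 δ, g i x = G k x := by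
    intro i
    have h1 : g i δ ∈ Set.range (S.orderEmbOfFin rfl) := by
      rw [Finset.range_orderEmbOfFin]
      exact Finset.mem_coe.2 (Finset.mem_image_of_mem _ (Finset.mem_univ i))
    obtain ⟨k, hk⟩ := h1
    refine ⟨k + 1, by omega, k.2, fun x hx ↦ ?_⟩
    rw [hG _ (by omega) k.2]
    have h2 : g i δ = g (idx k) δ := by rw [hidx, hk]
    rcases hx.1.eq_or_lt with h0 | h0
    · rw [← h0, hg0, hg0]
    · exact heq _ _ δ ⟨hδ0, le_rfl⟩ h2 ⟨h0, hx.2⟩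
  refine ⟨S.card, G, δ, r, hSm, hδ0, hr0, ⟨r, hr, hδr, le_rfl⟩, fun k h1 h2 ↦ ?_, fun k h1 h2 ↦ ?_,
    fun k h1 h2 ↦ ?_, fun j k h1 h2 h3 x hx ↦ ?_, fun x hx y hy ↦ ⟨fun h ↦ ?_, ?_⟩⟩
  · rw [hG k h1 h2]; exact (hg _).mono (hgd _)
  · rw [hG k h1 h2]; exact hg0 _
  · rw [hG k h1 h2]; exact hgr _
  · rw [hG j h1 (by omega), hG k (by omega) h3]
    by_contra! hcon
    have hlt : g (idx ⟨j - 1, by omega⟩) δ < g (idx ⟨k - 1, by omega⟩) δ := by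
      rw [hidx, hidx]
      refine (S.orderEmbOfFin rfl).strictMono ?_
      rw [Fin.lt_def]
      simp only
      omega
    have hsub : Icc x δ ⊆ Icc 0 δ := Icc_subset_Icc_left hx.1.le
    obtain ⟨c, hc, hc0⟩ := intermediate_value_Icc hx.2
      (((hgc (idx ⟨k - 1, by omega⟩)).sub (hgc (idx ⟨j - 1, by omega⟩))).mono hsub)
      (show (0 : ℝ) ∈ _ from ⟨sub_nonpos.2 hcon, (sub_pos.2 hlt).le⟩)
    have h4 := heq _ _ c ⟨hx.1.trans_le hc.1, hc.2⟩ (sub_eq_zero.1 hc0) ⟨hδ0, le_rfl⟩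
    exact hlt.ne' h4
  · obtain ⟨hqU, hqγ⟩ := hrV x y hx.1 (hx.2.trans hδr) hy.le
    have h1 := hr.chartFst_chartPoint hx.1 (hx.2.trans hδr) hy.le
    have h2 := hr.chartSnd_chartPoint hx.1 (hx.2.trans hδr) hy.le
    have h3 : chartPoint p x y ∈ C.singularSet ∩ U := ⟨h, hqU⟩
    rw [hcov] at h3
    rcases h3 with h3 | h3
    · rw [mem_singleton_iff] at h3
      rw [h3, chartFst_self hp] at h1
      rw [h3, chartSnd_self] at h2
      refine ⟨1, le_rfl, hSm, ?_⟩
      rw [hG 1 le_rfl hSm, ← h1, ← h2, hg0]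
    · obtain ⟨i, t, ht, hti⟩ := mem_iUnion.1 h3
      have htε : t < ε i := by
        by_contra! hle
        exact hqγ i ⟨t, ⟨hle, ht.2.le⟩, hti⟩
      have h4 := hgγ i t ⟨ht.1, htε.le⟩
      rw [hti, h1, h2] at h4
      obtain ⟨k, hk1, hk2, hk⟩ := hGi i
      exact ⟨k, hk1, hk2, h4.trans (hk x hx)⟩
  · rintro ⟨k, h1, h2, rfl⟩
    rw [hG k h1 h2]
    exact hgS _ x hx

end CoherentTangentBundle

end

theorem mainTheorem6 {M : Type*} [TopologicalSpace M] [T2Space M] [CompactSpace M]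
    [ChartedSpace (EuclideanHalfSpace 2) M] [IsManifold (𝓡∂ 2) ∞ M]
    {E : M → Type*} [TopologicalSpace (TotalSpace Plane E)]
    [∀ x, NormedAddCommGroup (E x)] [∀ x, InnerProductSpace ℝ (E x)]
    [FiberBundle Plane E] [VectorBundle ℝ Plane E]
    [ContMDiffVectorBundle ∞ Plane E (𝓡∂ 2)]
    [IsContMDiffRiemannianBundle (𝓡∂ 2) ∞ Plane E]
    (C : CoherentTangentBundle M E) (o : SurfaceOrientation M)
    (p : M) (hbd : p ∈ (𝓡∂ 2).boundary M)
    (hp : C.IsA2 p ∨ C.IsPeak p)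
    (htr : C.SingularDirectionTransversal p) :
    (C.NullDirectionTransversal p →
      (∃ a b, C.HasAngleSums o p a b) ∧
      ∀ a b, C.HasAngleSums o p a b →
        a + b = Real.pi ∧ (a - b = -Real.pi ∨ a - b = Real.pi)) ∧
    (C.IsNonDegenerate p → C.NullDirectionTangent p →
      (∃ a b, C.HasAngleSums o p a b) ∧
      ∀ a b, C.HasAngleSums o p a b → a = b) := by
  have hg : ∃ m g δ η, C.IsGraphSystem p m g δ η := by
    by_cases hnd : C.IsNonDegenerate p
    · obtain ⟨g, δ, η, h, -⟩ := C.exists_isGraphSystem_of_isNonDegenerate hbd htr hnd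
      exact ⟨_, _, _, _, h⟩
    · exact C.exists_isGraphSystem_of_isPeak hbd htr (hp.resolve_left fun h ↦ hnd h.1) hnd
  refine ⟨fun hnull ↦ ?_, fun hnd hnull ↦ ?_⟩
  · obtain ⟨m, g, δ, η, h⟩ := hg
    obtain ⟨a, b, hab, hval⟩ :=
      h.exists_hasAngleSums_of_nullDirectionTransversal C o hbd htr hp hnull
    refine ⟨⟨a, b, hab⟩, fun a' b' hab' ↦ ?_⟩
    obtain ⟨rfl, rfl⟩ := CoherentTangentBundle.HasAngleSums.unique C o hab' hab
    rcases hval with ⟨rfl, rfl⟩ | ⟨rfl, rfl⟩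
    · exact ⟨add_zero _, Or.inr (sub_zero _)⟩
    · exact ⟨zero_add _, Or.inl (zero_sub _)⟩
  · obtain ⟨a, ha⟩ := C.exists_hasAngleSums_of_nullDirectionTangent o hbd htr hnd hnull
    refine ⟨⟨a, a, ha⟩, fun a' b' hab' ↦ ?_⟩
    obtain ⟨rfl, rfl⟩ := CoherentTangentBundle.HasAngleSums.unique C o hab' ha
    rfl
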